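/- Let $F:\mathbb R^d\to\mathbb R^d$ and $\zeta:\mathbb R^d\to\mathbb R$ be of class $C^3$ with $F(0)=0$, $\zeta(0)=0$, and let $\mathcal S=\{U:\zeta(U)=0\}$. Manifolds are embedded $C^1$ submanifolds of $\mathbb R^d$. A manifold $\mathcal N$ is locally invariant for an ODE if every solution $U$ with $U(0)\in\mathcal N$ satisfies $U(t)\in\mathcal N$ for $|t|$ small. A center manifold of $dU/d\tau=F(U)$ around $0$ is a locally invariant manifold through $0$ whose tangent space at $0$ is the center subspace of $DF(0)$, i.e. the sum of the real generalized eigenspaces for the eigenvalues with zero real part. Assume: (1) $\nabla\zeta(0)\neq 0$. (2) If $\mathcal N$ is any center manifold of $dU/d\tau=F(U)$ around $0$, then $F(U)=0$ for all $U\in\mathcal N\cap\mathcal S$ with $|U|$ sufficiently small. (3) There is a manifold $\mathcal M^{eq}$ with $0\in\mathcal M^{eq}$ and $F=0$ on $\mathcal M^{eq}$ that is transversal to $\mathcal S$, in the sense that $\mathcal M^{eq}\cap\mathcal S$ is a manifold of dimension $\dim\mathcal M^{eq}-1$. (4) $\nabla\zeta(U)\cdot F(U)=0$ for all $U\in\mathcal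 S$ in a neighbourhood of $0$. (Hence $G=\nabla\zeta\cdot F/\zeta$ extends continuously to $\mathcal S$ near $0$.) (5) $G(U)=0$ for all $U$ in a neighbourhood of $0$ with $\zeta(U)=0$ and $F(U)=0$. Consider the singular ODE $$\frac{dU}{dt}=\frac{1}{\zeta(U)}F(U).$$ A solution on an interval $I$ is a continuous $U:I\to\mathbb R^d$ such that $\{t\in I:\zeta(U(t))\ne0\}$ is dense in $I$ and the equation holds at each of its points; a solution may a priori reach $\mathcal S$, and it need not be differentiable at such times. Then for every $r>0$ there exist a manifold $\mathcal M^c$ contained in the ball of radius $r$ around $0$, passing through $0$ and with tangent space at $0$ contained in the center subspace of $DF(0)$, and a constant $\delta>0$, such that: (i) $\mathcal M^c$ is locally invariant for the singular ODE; (ii) if $U$ is a solution of the singular ODE on $\mathbb R$ with $|U(t)|\le\delta$ for every $t\in\mathbb R$, then $U(t)\in\mathcal M^c$ for every $t$; (iii) if $U$ is a solution of the singular ODE on an interval $I\ni 0$ with $U(t)\in\mathcal M^c$ for every $t\in I$, and $\zeta(U(0))\neq0$, then $\zeta(U(t))\neq0$ for every $t\in I$. -/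

import Mathlib

open Set Filter Topology

namespace SingularODE

/-- Near the point `p` of `M`, the set `M` is an embedded `C¹` submanifold of `ℝ^d` whose tangent
space at `p` is `V`: near `p`, `M` is the zero set of a `C¹` submersion `g`, and `V = ker Dg(p)`. -/
def IsSubmanifoldAt {d : ℕ} (M : Set (EuclideanSpace ℝ (Fin d))) (p : EuclideanSpace ℝ (Fin d))
    (V : Submodule ℝ (EuclideanSpace ℝ (Fin d))) : Prop :=
  p ∈ M ∧ ∃ (m : ℕ) (g : EuclideanSpace ℝ (Fin d) → EuclideanSpace ℝ (Fin m)),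
    ContDiffAt ℝ 1 g p ∧
    Function.Surjective (fderiv ℝ g p) ∧
    LinearMap.ker (fderiv ℝ g p).toLinearMap = V ∧
    ∀ᶠ x in 𝓝 p, (x ∈ M ↔ g x = 0)

/-- `M` is an embedded (not necessarily closed) `C¹` submanifold of `ℝ^d` of dimension `n`. -/
def IsSubmanifold {d : ℕ} (M : Set (EuclideanSpace ℝ (Fin d))) (n : ℕ) : Prop :=
  ∀ p ∈ M, ∃ V : Submodule ℝ (EuclideanSpace ℝ (Fin d)),
    Module.finrank ℝ V = n ∧ IsSubmanifoldAt M p V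

/-- The center subspace of a linear operator `L` on `ℝ^d`: the sum of the real generalized
eigenspaces of `L` for the eigenvalues `± i ω` with zero real part. The real generalized eigenspace
for the pair `± i ω` is the generalized eigenspace of `L²` for `-ω²`. -/
def centerSubspace {d : ℕ} (L : EuclideanSpace ℝ (Fin d) →L[ℝ] EuclideanSpace ℝ (Fin d)) :
    Submodule ℝ (EuclideanSpace ℝ (Fin d)) :=
  ⨆ ω : ℝ, Module.End.maxGenEigenspace
    ((L.toLinearMap : Module.End ℝ (EuclideanSpace ℝ (Fin d))) ^ 2) (-(ω ^ 2))

/-- `M` is locally invariant for `dU/dτ = F(U)`: a solution that starts in `M` stays in `M` for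
small `|τ|`. -/
def IsLocallyInvariant {d : ℕ} (F : EuclideanSpace ℝ (Fin d) → EuclideanSpace ℝ (Fin d))
    (M : Set (EuclideanSpace ℝ (Fin d))) : Prop :=
  ∀ U : ℝ → EuclideanSpace ℝ (Fin d), U 0 ∈ M →
    (∀ᶠ τ in 𝓝 (0 : ℝ), HasDerivAt U (F (U τ)) τ) → ∀ᶠ τ in 𝓝 (0 : ℝ), U τ ∈ M

/-- `M` is a (local) center manifold for `dU/dτ = F(U)` around the equilibrium `0`: a locally
invariant submanifold through `0`, tangent at `0` to the center subspace of `DF(0)`. -/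
structure IsCenterManifold {d : ℕ} (F : EuclideanSpace ℝ (Fin d) → EuclideanSpace ℝ (Fin d))
    (M : Set (EuclideanSpace ℝ (Fin d))) : Prop where
  submanifold : ∃ n, IsSubmanifold M n
  tangent : IsSubmanifoldAt M 0 (centerSubspace (fderiv ℝ F 0))
  invariant : IsLocallyInvariant F M

/-- `U` is a solution, on the set of times `I` (an interval), of the singular equation
`dU/dt = F(U) / ζ(U)`. A solution is continuous and satisfies the equation at every time at which
`ζ(U) ≠ 0`, that is, at which the right-hand side is defined. It may reach the singular set
`{ζ = 0}`, but only at times in a set without interior, and nothing about differentiability is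
asked at such times. -/
structure IsSolutionOn {d : ℕ} (F : EuclideanSpace ℝ (Fin d) → EuclideanSpace ℝ (Fin d))
    (ζ : EuclideanSpace ℝ (Fin d) → ℝ) (U : ℝ → EuclideanSpace ℝ (Fin d)) (I : Set ℝ) : Prop where
  continuousOn : ContinuousOn U I
  dense_regular : I ⊆ closure {t ∈ I | ζ (U t) ≠ 0}
  hasDerivWithinAt : ∀ t ∈ I, ζ (U t) ≠ 0 → HasDerivWithinAt U ((1 / ζ (U t)) • F (U t)) I t

/-- `M` is locally invariant for the singular equation `dU/dt = F(U) / ζ(U)`. -/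
def IsLocallyInvariantSingular {d : ℕ}
    (F : EuclideanSpace ℝ (Fin d) → EuclideanSpace ℝ (Fin d))
    (ζ : EuclideanSpace ℝ (Fin d) → ℝ) (M : Set (EuclideanSpace ℝ (Fin d))) : Prop :=
  ∀ (U : ℝ → EuclideanSpace ℝ (Fin d)) (a : ℝ), 0 < a → IsSolutionOn F ζ U (Ioo (-a) a) →
    U 0 ∈ M → ∀ᶠ t in 𝓝 (0 : ℝ), U t ∈ M

/-- `M` is a manifold of equilibria for `dU/dτ = F(U)` which contains `0` and is transversal to
`S = {ζ = 0}`, in the sense that `M ∩ S` is a manifold with `dim (M ∩ S) = dim M - 1`. -/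
def IsTransversalEquilibriumManifold {d : ℕ}
    (F : EuclideanSpace ℝ (Fin d) → EuclideanSpace ℝ (Fin d))
    (ζ : EuclideanSpace ℝ (Fin d) → ℝ) (M : Set (EuclideanSpace ℝ (Fin d))) : Prop :=
  0 ∈ M ∧ (∀ U ∈ M, F U = 0) ∧
    ∃ n : ℕ, IsSubmanifold M (n + 1) ∧ IsSubmanifold (M ∩ {U | ζ U = 0}) n

end SingularODE

/-! The manifold is a center manifold of the regular equation `dU/dτ = F(U)`, cut off by a small
ball. It is the fixed-point set of a C¹ retraction `χ` that factors through the center projection.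
The distance to it is measured by the defect `w = U - χ(U)`. The work lies in showing that the
factor `1/ζ` neither lets a small solution reach the singular set nor spoils the hyperbolic
behaviour of `w`.

The retraction comes from the Lyapunov–Perron method: `χ ξ` is the value at time 0 of the only
slowly growing solution of a cut-off equation whose center part at time 0 is that of `ξ`
(`exists_global_retraction`). Along `F` the defect obeys `w' = L w + o(w)`, where `L = DF(0)`. Hence
an indefinite quadratic form `⟨S w, w⟩` has derivative at least `|w|²/2` in the regular time.

The decisive estimate is `|H| ≤ C |ζ| (|ζ| + |w|)` for `H = ∇ζ · F`
(`exists_eventually_abs_fderiv_le`). By (4), `H` vanishes on the singular set. By (5), `DH` vanishes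
at singular equilibria, and by (2) these include all singular points of the center manifold near 0.
So `DH` is of order `|ζ| + |w|` near `U`, and integrating it from a point of the singular set at
distance `O(|ζ|)` gives the bound.

In the singular time, `z = |ζ(U)|` thus satisfies `|z'| ≤ C (z + |w|)`. On the manifold `w = 0` and
Grönwall's inequality would keep `z` positive. Off the manifold `|w|` may be large compared with
`z`, and the quadratic form compensates: if `z` were to reach 0, then `v = ±⟨S w, w⟩` would have to
be nonpositive beforehand, and `log z + 2Ct + C v/z` would be nondecreasing, which bounds `z` away
from 0 (`false_of_reaches_zero`). Time reversal treats the other direction. Since regular times are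
dense, every solution in the ball is regular throughout, which contains (iii). For (i), `|w'| ≤
const |w|` as long as `1/ζ` is bounded. For (ii), `v' ≥ c |v|` on the whole line with `v` bounded
forces `v = 0`, hence `w = 0`. -/

set_option linter.unusedSectionVars false

namespace SingularODE

/-! ### The linear flow and its exponential growth spaces. -/

section ExpFlow

variable {E : Type*} [NormedAddCommGroup E] [NormedSpace ℝ E] [CompleteSpace E]

/-- The flow `t ↦ exp (t L)` of the linear equation `x' = L x`. -/
noncomputable def expFlow (L : E →L[ℝ] E) (t : ℝ) : E →L[ℝ] E := NormedSpace.exp (t • L)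

@[simp] lemma expFlow_zero (L : E →L[ℝ] E) : expFlow L 0 = 1 := by
  simp [expFlow]

lemma expFlow_add (L : E →L[ℝ] E) (s t : ℝ) : expFlow L (s + t) = expFlow L s * expFlow L t := by
  let _ : NormedAlgebra ℚ (E →L[ℝ] E) := NormedAlgebra.restrictScalars ℚ ℝ _
  unfold expFlow
  rw [add_smul]
  exact NormedSpace.exp_add_of_commute (((Commute.refl L).smul_left s).smul_right t)

lemma expFlow_neg_operator (L : E →L[ℝ] E) (t : ℝ) : expFlow (-L) t = expFlow L (-t) := by
  simp [expFlow]

lemma expFlow_neg_apply_apply (L : E →L[ℝ] E) (t : ℝ) (x : E) :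
    expFlow L (-t) (expFlow L t x) = x := by
  have := expFlow_add L (-t) t
  rw [neg_add_cancel, expFlow_zero] at this
  simpa using (congrArg (fun A : E →L[ℝ] E => A x) this).symm

lemma expFlow_apply_neg_apply (L : E →L[ℝ] E) (t : ℝ) (x : E) :
    expFlow L t (expFlow L (-t) x) = x := by
  simpa using expFlow_neg_apply_apply L (-t) x

lemma hasDerivAt_expFlow (L : E →L[ℝ] E) (t : ℝ) :
    HasDerivAt (expFlow L) (L * expFlow L t) t :=
  hasDerivAt_exp_smul_const' L t

lemma hasDerivAt_expFlow' (L : E →L[ℝ] E) (t : ℝ) :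
    HasDerivAt (expFlow L) (expFlow L t * L) t :=
  hasDerivAt_exp_smul_const L t

lemma continuous_expFlow (L : E →L[ℝ] E) : Continuous (expFlow L) :=
  continuous_iff_continuousAt.2 fun t => (hasDerivAt_expFlow L t).continuousAt

lemma hasDerivAt_expFlow_apply (L : E →L[ℝ] E) (x : E) (t : ℝ) :
    HasDerivAt (fun t => expFlow L t x) (L (expFlow L t x)) t := by
  simpa using (hasDerivAt_expFlow L t).clm_apply (hasDerivAt_const t x)

lemma commute_expFlow {L A : E →L[ℝ] E} (h : Commute A L) (t : ℝ) : Commute A (expFlow L t) :=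
  let _ : NormedAlgebra ℚ (E →L[ℝ] E) := NormedAlgebra.restrictScalars ℚ ℝ _
  (h.smul_right t).exp_right

lemma expFlow_apply_comm {L A : E →L[ℝ] E} (h : Commute A L) (t : ℝ) (x : E) :
    expFlow L t (A x) = A (expFlow L t x) :=
  congrArg (fun B : E →L[ℝ] E => B x) (commute_expFlow h t).symm.eq

/-- The vectors whose forward orbit under `exp (t L)` is `O(exp (a t))`. -/
def growthSpace (L : E →L[ℝ] E) (a : ℝ) : Submodule ℝ E where
  carrier := {x | ∃ C, ∀ t, 0 ≤ t → ‖expFlow L t x‖ ≤ C * Real.exp (a * t)}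
  zero_mem' := ⟨0, fun t _ => by simp⟩
  add_mem' := by
    rintro x y ⟨C, hC⟩ ⟨D, hD⟩
    refine ⟨C + D, fun t ht => ?_⟩
    rw [map_add, add_mul]
    exact (norm_add_le _ _).trans (add_le_add (hC t ht) (hD t ht))
  smul_mem' := by
    rintro c x ⟨C, hC⟩
    refine ⟨‖c‖ * C, fun t ht => ?_⟩
    rw [map_smul, norm_smul, mul_assoc]
    exact mul_le_mul_of_nonneg_left (hC t ht) (norm_nonneg _)

lemma growthSpace_mono (L : E →L[ℝ] E) {a b : ℝ} (h : a ≤ b) : growthSpace L a ≤ growthSpace L b := by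
  rintro x ⟨C, hC⟩
  refine ⟨|C|, fun t ht => (hC t ht).trans ?_⟩
  have := Real.exp_le_exp.2 (mul_le_mul_of_nonneg_right h ht)
  calc C * Real.exp (a * t) ≤ |C| * Real.exp (a * t) :=
        mul_le_mul_of_nonneg_right (le_abs_self C) (Real.exp_pos _).le
    _ ≤ _ := mul_le_mul_of_nonneg_left this (abs_nonneg C)

lemma map_mem_growthSpace {L A : E →L[ℝ] E} (h : Commute A L) {a : ℝ} {x : E}
    (hx : x ∈ growthSpace L a) : A x ∈ growthSpace L a := by
  obtain ⟨C, hC⟩ := hx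
  refine ⟨‖A‖ * C, fun t ht => ?_⟩
  rw [expFlow_apply_comm h, mul_assoc]
  exact (A.le_opNorm _).trans (mul_le_mul_of_nonneg_left (hC t ht) (norm_nonneg _))

variable [FiniteDimensional ℝ E]

/-- Uniform boundedness, applied to the rescaled maps `exp(-a t) exp(tL)` on the growth space, makes
the constant independent of the vector. -/
lemma exists_uniform_growth (L : E →L[ℝ] E) (a : ℝ) : ∃ C, 0 < C ∧ ∀ x ∈ growthSpace L a,
    ∀ t, 0 ≤ t → ‖expFlow L t x‖ ≤ C * Real.exp (a * t) * ‖x‖ := by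
  let g : Ici (0 : ℝ) → (growthSpace L a →L[ℝ] E) := fun t =>
    Real.exp (-(a * t)) • (expFlow L t).comp (growthSpace L a).subtypeL
  have : CompleteSpace (growthSpace L a) := FiniteDimensional.complete ℝ _
  obtain ⟨C, hC⟩ := banach_steinhaus (g := g) (fun x => by
    obtain ⟨C, hC⟩ := x.2
    refine ⟨C, fun t => ?_⟩
    have := hC t t.2
    simp only [g, smul_apply, norm_smul, Real.norm_eq_abs, Real.abs_exp,
      ContinuousLinearMap.comp_apply, Submodule.subtypeL_apply]
    calc _ ≤ Real.exp (-(a * t)) * (C * Real.exp (a * t)) :=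
          mul_le_mul_of_nonneg_left this (Real.exp_pos _).le
      _ = C := by
          rw [mul_comm, mul_assoc, ← Real.exp_add]; simp)
  refine ⟨max C 1, by positivity, fun x hx t ht => ?_⟩
  have h1 := (g ⟨t, ht⟩).le_of_opNorm_le (hC ⟨t, ht⟩) ⟨x, hx⟩
  simp only [g, smul_apply, norm_smul, Real.norm_eq_abs, Real.abs_exp,
      ContinuousLinearMap.comp_apply, Submodule.subtypeL_apply, Submodule.coe_norm] at h1
  calc ‖expFlow L t x‖ = Real.exp (a * t) * (Real.exp (-(a * t)) * ‖expFlow L t x‖) := by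
        rw [← mul_assoc, ← Real.exp_add]; simp
    _ ≤ Real.exp (a * t) * (max C 1 * ‖x‖) := by
        refine mul_le_mul_of_nonneg_left (h1.trans ?_) (Real.exp_pos _).le
        exact mul_le_mul_of_nonneg_right (le_max_left _ _) (norm_nonneg _)
    _ = _ := by ring

/-- Going forward along `x` costs `exp(a t)` and coming back costs `exp(c t)`, uniformly on the
second space because it is invariant. So `‖x‖` is at most a multiple of `exp((a + c) t)`, which
tends to 0. -/
lemma disjoint_growthSpace (L : E →L[ℝ] E) {a c : ℝ} (h : a + c < 0) :
    Disjoint (growthSpace L a) (growthSpace (-L) c) := by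
  rw [Submodule.disjoint_def]
  intro x hx hx'
  obtain ⟨D, hD0, hD⟩ := exists_uniform_growth (-L) c
  obtain ⟨C, hC⟩ := hx
  have key : ∀ t, 0 ≤ t → ‖x‖ ≤ D * C * Real.exp ((a + c) * t) := by
    intro t ht
    have h1 : expFlow L t x ∈ growthSpace (-L) c := by
      refine map_mem_growthSpace ?_ hx'
      exact ((commute_expFlow (Commute.refl L) t).symm).neg_right
    have h2 := hD _ h1 t ht
    rw [expFlow_neg_operator, expFlow_neg_apply_apply] at h2
    refine h2.trans ?_
    calc _ ≤ D * Real.exp (c * t) * (C * Real.exp (a * t)) :=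
          mul_le_mul_of_nonneg_left (hC t ht) (by positivity)
      _ = _ := by rw [add_mul, Real.exp_add]; ring
  have lim : Tendsto (fun t : ℝ => D * C * Real.exp ((a + c) * t)) atTop (𝓝 (D * C * 0)) := by
    refine Tendsto.const_mul _ (Real.tendsto_exp_atBot.comp ?_)
    exact tendsto_id.const_mul_atTop_of_neg h
  have := ge_of_tendsto lim ((eventually_ge_atTop 0).mono key)
  rw [mul_zero] at this
  exact norm_le_zero_iff.1 this

end ExpFlow

/-! ### Growth rates from complex generalized eigenspaces, computed on the complex dual. -/

section Spectral

variable {E : Type*} [NormedAddCommGroup E] [InnerProductSpace ℝ E] [FiniteDimensional ℝ E]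

/-- The action of `L` by precomposition on the complex dual. -/
noncomputable def dualEnd (L : E →L[ℝ] E) : Module.End ℂ (E →L[ℝ] ℂ) where
  toFun v := v.comp L
  map_add' _ _ := rfl
  map_smul' _ _ := rfl

lemma dualEnd_apply (L : E →L[ℝ] E) (v : E →L[ℝ] ℂ) : dualEnd L v = v.comp L := rfl

/-- The vector that represents the real part of a complex functional. -/
noncomputable def realPart : (E →L[ℝ] ℂ) →ₗ[ℝ] E where
  toFun v := (InnerProductSpace.toDual ℝ E).symm (Complex.reCLM.comp v)
  map_add' v w := by rw [ContinuousLinearMap.comp_add, map_add]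
  map_smul' c v := by rw [ContinuousLinearMap.comp_smul, map_smulₛₗ]; rfl

lemma inner_realPart (v : E →L[ℝ] ℂ) (x : E) : inner ℝ (realPart v) x = (v x).re := by
  simp [realPart]

lemma norm_realPart_le (v : E →L[ℝ] ℂ) : ‖realPart v‖ ≤ ‖v‖ := by
  simp only [realPart, LinearMap.coe_mk, AddHom.coe_mk, LinearIsometryEquiv.norm_map]
  calc _ ≤ ‖Complex.reCLM‖ * ‖v‖ := ContinuousLinearMap.opNorm_comp_le _ _
    _ = ‖v‖ := by simp

/-- The adjoint appears because functionals are composed on the right: precomposition with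
`M.adjoint` on the dual corresponds to `M` on representing vectors. This transfers the spectral
theory of `dualEnd M.adjoint` to `M`. -/
lemma realPart_comp (v : E →L[ℝ] ℂ) (A : E →L[ℝ] E) :
    realPart (v.comp A.adjoint) = A (realPart v) := by
  refine ext_inner_right ℝ fun x => ?_
  rw [inner_realPart, ← ContinuousLinearMap.adjoint_inner_right, inner_realPart]
  rfl

/-- The complex functional represented by a vector. -/
noncomputable def complexify (x : E) : E →L[ℝ] ℂ :=
  Complex.ofRealCLM.comp (InnerProductSpace.toDual ℝ E x)

lemma complexify_apply (x y : E) : complexify x y = ((inner ℝ x y : ℝ) : ℂ) := by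
  simp [complexify]

lemma realPart_complexify (x : E) : realPart (complexify x) = x := by
  refine ext_inner_right ℝ fun y => ?_
  rw [inner_realPart, complexify_apply, Complex.ofReal_re]

lemma complexify_map (A : E →L[ℝ] E) (x : E) :
    complexify (A x) = (complexify x).comp A.adjoint := by
  ext y
  rw [complexify_apply, ContinuousLinearMap.comp_apply, complexify_apply,
    ContinuousLinearMap.adjoint_inner_right]

lemma complexify_zero : complexify (0 : E) = 0 := by
  ext y; simp [complexify_apply]

lemma adjoint_expFlow (L : E →L[ℝ] E) (t : ℝ) :
    (expFlow L t).adjoint = expFlow L.adjoint t := by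
  unfold expFlow
  rw [← ContinuousLinearMap.star_eq_adjoint, NormedSpace.star_exp, star_smul]
  simp [ContinuousLinearMap.star_eq_adjoint]

/-- The functional `v` composed with `exp (t L)` grows at most like `exp (a t + ε |t|)`. -/
def HasGrowth (L : E →L[ℝ] E) (a : ℝ) (v : E →L[ℝ] ℂ) : Prop :=
  ∀ ε > 0, ∃ C, ∀ t, ‖v.comp (expFlow L t)‖ ≤ C * Real.exp (a * t + ε * |t|)

lemma hasGrowth_zero (L : E →L[ℝ] E) (a : ℝ) : HasGrowth L a 0 :=
  fun _ _ => ⟨0, fun t => by simp⟩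

/-- With `w = (L - λ) v`, the curve `exp(-λt) v ∘ exp(tL)` has derivative `exp(-λt) w ∘ exp(tL)`.
Integrating costs one factor `|t|`, which is absorbed by half of the `ε` allowed in the exponent.
Iteration handles Jordan chains. -/
lemma HasGrowth.of_sub_smul {L : E →L[ℝ] E} {v : E →L[ℝ] ℂ} {lam : ℂ}
    (h : HasGrowth L lam.re ((dualEnd L - lam • 1) v)) : HasGrowth L lam.re v := by
  intro ε hε
  obtain ⟨C, hC⟩ := h (ε / 2) (by positivity)
  set w := (dualEnd L - lam • 1) v with hw
  have hwv : v.comp L = w + lam • v := by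
    rw [hw]; simp [dualEnd_apply]
  let q : ℝ → (E →L[ℝ] ℂ) := fun t => Complex.exp (-(lam * t)) • v.comp (expFlow L t)
  have hn : ∀ t : ℝ, ‖Complex.exp (-(lam * t))‖ = Real.exp (-(lam.re * t)) := by
    intro t; rw [Complex.norm_exp]; simp
  have hq : ∀ t : ℝ, HasDerivAt q (Complex.exp (-(lam * t)) • w.comp (expFlow L t)) t := by
    intro t
    have h1 : HasDerivAt (fun t : ℝ => Complex.exp (-(lam * t)))
        (Complex.exp (-(lam * t)) * (-(lam * 1))) t := by
      have : HasDerivAt (fun t : ℝ => -(lam * (t : ℂ))) (-(lam * 1)) t :=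
        ((Complex.ofRealCLM.hasDerivAt (x := t)).const_mul lam).neg
      exact this.cexp
    have h2 : HasDerivAt (fun t => v.comp (expFlow L t)) (v.comp (L * expFlow L t)) t := by
      have := (hasDerivAt_const t v).clm_comp (hasDerivAt_expFlow L t)
      simpa using this
    refine (h1.smul h2).congr_deriv ?_
    have : v.comp (L * expFlow L t) = (v.comp L).comp (expFlow L t) := rfl
    rw [this, hwv, ContinuousLinearMap.add_comp]
    ext x
    simp
    ring
  have hb : ∀ t, ‖q t - q 0‖ ≤ |C| * Real.exp (ε / 2 * |t|) * |t| := by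
    intro t
    have := Convex.norm_image_sub_le_of_norm_hasDerivWithin_le (s := uIcc 0 t) (x := 0) (y := t)
      (f := q) (C := |C| * Real.exp (ε / 2 * |t|)) (fun x _ => (hq x).hasDerivWithinAt) ?_
      (convex_uIcc 0 t) left_mem_uIcc right_mem_uIcc
    · simpa using this
    · intro s hs
      rw [norm_smul, hn]
      have hst : |s| ≤ |t| := by
        have := abs_sub_left_of_mem_uIcc hs
        simpa using this
      calc _ ≤ Real.exp (-(lam.re * s)) * (|C| * Real.exp (lam.re * s + ε / 2 * |s|)) :=
            mul_le_mul_of_nonneg_left ((hC s).trans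
              (mul_le_mul_of_nonneg_right (le_abs_self C) (Real.exp_pos _).le)) (Real.exp_pos _).le
        _ = |C| * Real.exp (ε / 2 * |s|) := by
            rw [mul_left_comm, ← Real.exp_add]; ring_nf
        _ ≤ _ := by gcongr
  refine ⟨‖q 0‖ + |C| * (2 / ε), fun t => ?_⟩
  have h1 : ‖v.comp (expFlow L t)‖ = Real.exp (lam.re * t) * ‖q t‖ := by
    simp only [q, norm_smul, hn]
    rw [← mul_assoc, ← Real.exp_add]; simp
  have h2 : |t| ≤ 2 / ε * Real.exp (ε / 2 * |t|) := by
    have := Real.add_one_le_exp (ε / 2 * |t|)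
    calc |t| = 2 / ε * (ε / 2 * |t|) := by field_simp
      _ ≤ _ := by gcongr; linarith
  have h3 : ‖q t‖ ≤ (‖q 0‖ + |C| * (2 / ε)) * Real.exp (ε * |t|) := by
    have e1 : Real.exp (ε * |t|) = Real.exp (ε / 2 * |t|) * Real.exp (ε / 2 * |t|) := by
      rw [← Real.exp_add]; ring_nf
    have e2 : 1 ≤ Real.exp (ε * |t|) := Real.one_le_exp (by positivity)
    calc ‖q t‖ ≤ ‖q 0‖ + ‖q t - q 0‖ := by
          have := norm_add_le (q 0) (q t - q 0); simpa using this
      _ ≤ ‖q 0‖ * Real.exp (ε * |t|) +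
          |C| * Real.exp (ε / 2 * |t|) * (2 / ε * Real.exp (ε / 2 * |t|)) := by
          refine add_le_add (le_mul_of_one_le_right (norm_nonneg _) e2) ((hb t).trans ?_)
          gcongr
      _ = _ := by rw [e1]; ring
  rw [h1, Real.exp_add]
  calc _ ≤ Real.exp (lam.re * t) * ((‖q 0‖ + |C| * (2 / ε)) * Real.exp (ε * |t|)) := by gcongr
    _ = _ := by ring

lemma HasGrowth.of_pow_sub_smul {L : E →L[ℝ] E} {lam : ℂ} (k : ℕ) {v : E →L[ℝ] ℂ}
    (h : HasGrowth L lam.re (((dualEnd L - lam • 1) ^ k) v)) : HasGrowth L lam.re v := by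
  induction k with
  | zero => simpa using h
  | succ k ih =>
    rw [pow_succ'] at h
    exact ih (HasGrowth.of_sub_smul h)

lemma norm_expFlow_realPart_le (M : E →L[ℝ] E) (v : E →L[ℝ] ℂ) (t : ℝ) :
    ‖expFlow M t (realPart v)‖ ≤ ‖v.comp (expFlow M.adjoint t)‖ := by
  rw [← realPart_comp, adjoint_expFlow]
  exact norm_realPart_le _

lemma HasGrowth.realPart_mem {M : E →L[ℝ] E} {v : E →L[ℝ] ℂ} {a b : ℝ}
    (h : HasGrowth M.adjoint a v) (hab : a < b) : realPart v ∈ growthSpace M b := by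
  obtain ⟨C, hC⟩ := h (b - a) (sub_pos.2 hab)
  refine ⟨C, fun t ht => (norm_expFlow_realPart_le M v t).trans ((hC t).trans_eq ?_)⟩
  rw [abs_of_nonneg ht]; ring_nf

lemma HasGrowth.realPart_mem_neg {M : E →L[ℝ] E} {v : E →L[ℝ] ℂ} {a b : ℝ}
    (h : HasGrowth M.adjoint a v) (hab : -a < b) : realPart v ∈ growthSpace (-M) b := by
  obtain ⟨C, hC⟩ := h (b + a) (by linarith)
  refine ⟨C, fun t ht => ?_⟩
  rw [expFlow_neg_operator]
  refine (norm_expFlow_realPart_le M v (-t)).trans ((hC (-t)).trans_eq ?_)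
  rw [abs_neg, abs_of_nonneg ht]; ring_nf

/-- The sum of the real generalized eigenspaces for the eigenvalues with zero real part. -/
def centerSpace (M : E →L[ℝ] E) : Submodule ℝ E :=
  ⨆ ω : ℝ, Module.End.maxGenEigenspace ((M.toLinearMap : Module.End ℝ E) ^ 2) (-(ω ^ 2))

lemma commute_sub_smul_one {K V : Type*} [Field K] [AddCommGroup V] [Module K V]
    (T : Module.End K V) (a b : K) :
    Commute (T - a • (1 : Module.End K V)) (T - b • (1 : Module.End K V)) := by
  refine Commute.sub_right (Commute.sub_left (Commute.refl _) ?_) ?_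
  · exact (Commute.one_left _).smul_left _
  · exact (Commute.one_right _).smul_right _

/-- This factorization connects the real description of the center subspace, through the square of
the operator, with the complex eigenvalues `±iω`. -/
lemma dualEnd_sq_add (L : E →L[ℝ] E) (ω : ℝ) :
    dualEnd L ^ 2 + ((ω : ℂ) ^ 2) • (1 : Module.End ℂ (E →L[ℝ] ℂ)) =
      (dualEnd L - (-(ω * Complex.I)) • (1 : Module.End ℂ (E →L[ℝ] ℂ))) *
        (dualEnd L - (ω * Complex.I) • (1 : Module.End ℂ (E →L[ℝ] ℂ))) := by
  ext v x
  simp only [pow_two, LinearMap.add_apply, Module.End.mul_apply, LinearMap.sub_apply,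
    LinearMap.smul_apply, Module.End.one_apply, dualEnd_apply, add_apply,
    sub_apply, smul_apply, ContinuousLinearMap.comp_apply,
    smul_eq_mul, ContinuousLinearMap.sub_comp, ContinuousLinearMap.smul_comp]
  linear_combination ((ω : ℂ) * ω * v x) * Complex.I_mul_I

lemma realPart_sq_add_pow (M : E →L[ℝ] E) (ω : ℝ) (k : ℕ) (v : E →L[ℝ] ℂ) :
    (((M.toLinearMap : Module.End ℝ E) ^ 2 - (-(ω ^ 2)) • (1 : Module.End ℝ E)) ^ k) (realPart v) =
      realPart (((dualEnd M.adjoint ^ 2 + ((ω : ℂ) ^ 2) • (1 : Module.End ℂ (E →L[ℝ] ℂ))) ^ k) v) := by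
  induction k with
  | zero => simp
  | succ k ih =>
    rw [pow_succ' _ k, pow_succ' _ k, Module.End.mul_apply, Module.End.mul_apply, ih]
    generalize ((dualEnd M.adjoint ^ 2 + ((ω : ℂ) ^ 2) • (1 : Module.End ℂ (E →L[ℝ] ℂ))) ^ k) v = u
    simp only [LinearMap.add_apply, LinearMap.smul_apply, Module.End.one_apply,
      neg_smul, sub_neg_eq_add, map_add, pow_two, Module.End.mul_apply, dualEnd_apply,
      realPart_comp]
    congr 1
    have : ((ω : ℂ) * ω) • u = (ω * ω : ℝ) • u := by
      ext x; simp
    rw [this, map_smul]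

lemma complexify_sq_add_pow (M : E →L[ℝ] E) (ω : ℝ) (k : ℕ) (x : E) :
    complexify ((((M.toLinearMap : Module.End ℝ E) ^ 2 - (-(ω ^ 2)) • (1 : Module.End ℝ E)) ^ k) x) =
      ((dualEnd M.adjoint ^ 2 + ((ω : ℂ) ^ 2) • (1 : Module.End ℂ (E →L[ℝ] ℂ))) ^ k) (complexify x) := by
  induction k with
  | zero => simp
  | succ k ih =>
    rw [pow_succ' _ k, pow_succ' _ k, Module.End.mul_apply, Module.End.mul_apply, ← ih]
    generalize (((M.toLinearMap : Module.End ℝ E) ^ 2 - (-(ω ^ 2)) • (1 : Module.End ℝ E)) ^ k) x = u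
    have h : complexify (M (M u)) = ((complexify u).comp M.adjoint).comp M.adjoint := by
      rw [complexify_map, complexify_map]
    simp only [LinearMap.add_apply, LinearMap.smul_apply, Module.End.one_apply,
      neg_smul, sub_neg_eq_add, pow_two, Module.End.mul_apply, dualEnd_apply,
      ContinuousLinearMap.coe_coe]
    rw [← h]
    ext y
    simp [complexify_apply, inner_add_left, inner_smul_left]

lemma realPart_mem_centerSpace {M : E →L[ℝ] E} {lam : ℂ} (h0 : lam.re = 0) {v : E →L[ℝ] ℂ}
    (hv : v ∈ (dualEnd M.adjoint).maxGenEigenspace lam) : realPart v ∈ centerSpace M := by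
  refine Submodule.mem_iSup_of_mem lam.im ?_
  rw [Module.End.mem_maxGenEigenspace] at hv ⊢
  obtain ⟨k, hk⟩ := hv
  refine ⟨k, ?_⟩
  have hl : lam = lam.im * Complex.I := by
    apply Complex.ext <;> simp [h0]
  rw [realPart_sq_add_pow, dualEnd_sq_add, ← hl, Commute.mul_pow, Module.End.mul_apply, hk,
    map_zero, map_zero]
  · exact commute_sub_smul_one _ _ _

lemma hasGrowth_complexify {M : E →L[ℝ] E} {ω : ℝ} {x : E}
    (hx : x ∈ Module.End.maxGenEigenspace ((M.toLinearMap : Module.End ℝ E) ^ 2) (-(ω ^ 2))) :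
    HasGrowth M.adjoint 0 (complexify x) := by
  rw [Module.End.mem_maxGenEigenspace] at hx
  obtain ⟨k, hk⟩ := hx
  have h := complexify_sq_add_pow M ω k x
  rw [hk, complexify_zero, dualEnd_sq_add, Commute.mul_pow, Module.End.mul_apply] at h
  · have h1 : HasGrowth M.adjoint (-(ω * Complex.I)).re
        (((dualEnd M.adjoint - (ω * Complex.I) • 1) ^ k) (complexify x)) := by
      refine HasGrowth.of_pow_sub_smul k ?_
      rw [← h]
      exact hasGrowth_zero _ _
    have h2 : HasGrowth M.adjoint (ω * Complex.I).re (complexify x) := by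
      refine HasGrowth.of_pow_sub_smul k ?_
      simpa using h1
    simpa using h2
  · exact commute_sub_smul_one _ _ _

lemma centerSpace_le_growthSpace (M : E →L[ℝ] E) {b : ℝ} (hb : 0 < b) :
    centerSpace M ≤ growthSpace M b ⊓ growthSpace (-M) b := by
  refine iSup_le fun ω x hx => ?_
  have h := hasGrowth_complexify hx
  rw [← realPart_complexify x]
  exact ⟨h.realPart_mem hb, h.realPart_mem_neg (by simpa using hb)⟩

lemma hasGrowth_of_mem_maxGenEigenspace {L : E →L[ℝ] E} {lam : ℂ} {v : E →L[ℝ] ℂ}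
    (hv : v ∈ (dualEnd L).maxGenEigenspace lam) : HasGrowth L lam.re v := by
  rw [Module.End.mem_maxGenEigenspace] at hv
  obtain ⟨k, hk⟩ := hv
  refine HasGrowth.of_pow_sub_smul k ?_
  rw [hk]
  exact hasGrowth_zero _ _

instance : FiniteDimensional ℂ (E →L[ℝ] ℂ) := Module.Finite.right ℝ ℂ _

lemma exists_spectral_gap (L : E →L[ℝ] E) : ∃ b : ℝ, 0 < b ∧
    ∀ lam : ℂ, (dualEnd L).HasEigenvalue lam → lam.re ≠ 0 → b < |lam.re| := by
  have hfin : {lam | (dualEnd L).HasEigenvalue lam ∧ lam.re ≠ 0}.Finite :=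
    (Module.End.finite_hasEigenvalue (dualEnd L)).subset fun x hx => hx.1
  have : ∀ᶠ b in 𝓝[>] (0 : ℝ), ∀ lam ∈ {lam | (dualEnd L).HasEigenvalue lam ∧ lam.re ≠ 0},
      b < |lam.re| := by
    rw [hfin.eventually_all]
    intro lam hlam
    exact nhdsWithin_le_nhds (eventually_lt_nhds (abs_pos.2 hlam.2))
  obtain ⟨b, hb, hb0⟩ := (this.and self_mem_nhdsWithin).exists
  exact ⟨b, hb0, fun lam h1 h2 => hb lam ⟨h1, h2⟩⟩

/-- The complex generalized eigenspaces span the dual, and each one falls into the center, stable or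
unstable part according to the sign of the real part of its eigenvalue. The gap `b` leaves room for
the `ε` loss in `HasGrowth`. -/
lemma sup_growthSpace_eq_top (M : E →L[ℝ] E) : ∃ b : ℝ, 0 < b ∧
    centerSpace M ⊔ (growthSpace M (-b) ⊔ growthSpace (-M) (-b)) = ⊤ := by
  obtain ⟨b, hb, hgap⟩ := exists_spectral_gap M.adjoint
  refine ⟨b, hb, ?_⟩
  rw [eq_top_iff]
  intro x _
  rw [← realPart_complexify x]
  have hx : complexify x ∈ ⨆ μ, (dualEnd M.adjoint).maxGenEigenspace μ := by
    rw [Module.End.iSup_maxGenEigenspace_eq_top]; trivial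
  refine Submodule.iSup_induction _ (motive := fun v => realPart v ∈ centerSpace M ⊔
    (growthSpace M (-b) ⊔ growthSpace (-M) (-b))) hx ?_ ?_ ?_
  rotate_left
  · rw [map_zero]; exact zero_mem _
  · intro v w hv hw
    rw [map_add]; exact add_mem hv hw
  · intro lam v hv
    by_cases hv0 : v = 0
    · rw [hv0, map_zero]; exact zero_mem _
    have hev : (dualEnd M.adjoint).HasEigenvalue lam := by
      obtain ⟨k, hk⟩ := (Module.End.mem_maxGenEigenspace _ _ _).1 hv
      by_contra hne
      have hinj : Function.Injective (dualEnd M.adjoint - lam • (1 : Module.End ℂ (E →L[ℝ] ℂ))) := by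
        rw [← LinearMap.ker_eq_bot]
        rw [Module.End.hasEigenvalue_iff, Module.End.eigenspace_def, not_not] at hne
        exact hne
      have : Function.Injective ((dualEnd M.adjoint - lam • (1 : Module.End ℂ (E →L[ℝ] ℂ))) ^ k) := by
        rw [Module.End.coe_pow]
        exact hinj.iterate k
      exact hv0 (this (by rw [hk, map_zero]))
    have hg := hasGrowth_of_mem_maxGenEigenspace hv
    rcases lt_trichotomy lam.re 0 with h | h | h
    · have := hgap lam hev h.ne
      rw [abs_of_neg h] at this
      exact Submodule.mem_sup_right (Submodule.mem_sup_left (hg.realPart_mem (by linarith)))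
    · exact Submodule.mem_sup_left (realPart_mem_centerSpace h hv)
    · have := hgap lam hev h.ne'
      rw [abs_of_pos h] at this
      exact Submodule.mem_sup_right (Submodule.mem_sup_right (hg.realPart_mem_neg (by linarith)))

end Spectral

/-! ### Center, stable and unstable projections with exponential bounds. -/

section Splitting

variable {E : Type*} [NormedAddCommGroup E] [InnerProductSpace ℝ E] [FiniteDimensional ℝ E]

lemma exists_projections_of_isCompl {A B C : Submodule ℝ E} (hA : IsCompl A (B ⊔ C))
    (hB : IsCompl B (A ⊔ C)) (hC : IsCompl C (A ⊔ B)) :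
    ∃ P Q R : E →L[ℝ] E, (∀ x, P x ∈ A) ∧ (∀ x, Q x ∈ B) ∧ (∀ x, R x ∈ C) ∧
      (∀ x ∈ A, P x = x ∧ Q x = 0 ∧ R x = 0) ∧ (∀ x ∈ B, P x = 0 ∧ Q x = x ∧ R x = 0) ∧
      (∀ x ∈ C, P x = 0 ∧ Q x = 0 ∧ R x = x) ∧ ∀ x, P x + Q x + R x = x := by
  let P := A.projection (B ⊔ C) hA
  let Q := B.projection (A ⊔ C) hB
  let R := C.projection (A ⊔ B) hC
  have a : ∀ x ∈ A, P x = x ∧ Q x = 0 ∧ R x = 0 := fun x hx =>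
    ⟨Submodule.projection_apply_of_mem_left hA hx,
      (Submodule.projection_apply_eq_zero_iff hB).2 (Submodule.mem_sup_left hx),
      (Submodule.projection_apply_eq_zero_iff hC).2 (Submodule.mem_sup_left hx)⟩
  have b : ∀ x ∈ B, P x = 0 ∧ Q x = x ∧ R x = 0 := fun x hx =>
    ⟨(Submodule.projection_apply_eq_zero_iff hA).2 (Submodule.mem_sup_left hx),
      Submodule.projection_apply_of_mem_left hB hx,
      (Submodule.projection_apply_eq_zero_iff hC).2 (Submodule.mem_sup_right hx)⟩
  have c : ∀ x ∈ C, P x = 0 ∧ Q x = 0 ∧ R x = x := fun x hx =>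
    ⟨(Submodule.projection_apply_eq_zero_iff hA).2 (Submodule.mem_sup_right hx),
      (Submodule.projection_apply_eq_zero_iff hB).2 (Submodule.mem_sup_right hx),
      Submodule.projection_apply_of_mem_left hC hx⟩
  refine ⟨LinearMap.toContinuousLinearMap P, LinearMap.toContinuousLinearMap Q,
    LinearMap.toContinuousLinearMap R, fun x => Submodule.projection_apply_mem hA x,
    fun x => Submodule.projection_apply_mem hB x, fun x => Submodule.projection_apply_mem hC x,
    a, b, c, fun x => ?_⟩
  have hx : x ∈ A ⊔ (B ⊔ C) := by rw [hA.sup_eq_top]; trivial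
  obtain ⟨u, hu, v', hv', rfl⟩ := Submodule.mem_sup.1 hx
  obtain ⟨v, hv, w, hw, rfl⟩ := Submodule.mem_sup.1 hv'
  change P _ + Q _ + R _ = _
  simp only [map_add, (a u hu).1, (a u hu).2.1, (a u hu).2.2, (b v hv).1, (b v hv).2.1,
    (b v hv).2.2, (c w hw).1, (c w hw).2.1, (c w hw).2.2]
  abel

/-- The splitting of the space into center, stable and unstable directions of `L`, with the
exponential estimates for `exp (t L)` on them. -/
structure SpectralSplitting (L : E →L[ℝ] E) where
  rate : ℝ
  const : ℝ
  Pc : E →L[ℝ] E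
  Ps : E →L[ℝ] E
  Pu : E →L[ℝ] E
  rate_pos : 0 < rate
  const_pos : 0 < const
  add_eq : ∀ x, Pc x + Ps x + Pu x = x
  comm_c : Commute Pc L
  comm_s : Commute Ps L
  comm_u : Commute Pu L
  cc : ∀ x, Pc (Pc x) = Pc x
  cs : ∀ x, Pc (Ps x) = 0
  cu : ∀ x, Pc (Pu x) = 0
  ss : ∀ x, Ps (Ps x) = Ps x
  uu : ∀ x, Pu (Pu x) = Pu x
  range_c : LinearMap.range Pc.toLinearMap = centerSpace L
  bound_c : ∀ t x, ‖expFlow L t (Pc x)‖ ≤ const * Real.exp (rate * |t|) * ‖x‖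
  bound_s : ∀ t, 0 ≤ t → ∀ x, ‖expFlow L t (Ps x)‖ ≤ const * Real.exp (-(8 * rate) * t) * ‖x‖
  bound_u : ∀ t, 0 ≤ t → ∀ x, ‖expFlow (-L) t (Pu x)‖ ≤ const * Real.exp (-(8 * rate) * t) * ‖x‖

lemma commute_of_mapsTo {L P Q R : E →L[ℝ] E} {A B C : Submodule ℝ E}
    (hP : ∀ x, P x ∈ A) (hQ : ∀ x, Q x ∈ B) (hR : ∀ x, R x ∈ C)
    (a : ∀ x ∈ A, P x = x) (b : ∀ x ∈ B, P x = 0) (c : ∀ x ∈ C, P x = 0)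
    (hsum : ∀ x, P x + Q x + R x = x)
    (hA : ∀ x ∈ A, L x ∈ A) (hB : ∀ x ∈ B, L x ∈ B) (hC : ∀ x ∈ C, L x ∈ C) : Commute P L := by
  ext x
  change P (L x) = L (P x)
  conv_lhs => rw [← hsum x]
  simp only [map_add, a _ (hA _ (hP x)), b _ (hB _ (hQ x)), c _ (hC _ (hR x)), add_zero]

theorem exists_spectralSplitting (L : E →L[ℝ] E) : Nonempty (SpectralSplitting L) := by
  obtain ⟨b, hb, htop⟩ := sup_growthSpace_eq_top L
  have hβ : 0 < b / 8 := by positivity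
  set S := growthSpace L (-b) with hS
  set U := growthSpace (-L) (-b) with hU
  -- Rate `b / 8` against decay `b`: the gap must contain both weights `2 · rate` and `4 · rate`
  -- used for the nonlinear equation and its second-order remainder.
  set G := growthSpace L (b / 8) ⊓ growthSpace (-L) (b / 8) with hG
  have hcG : centerSpace L ≤ G := centerSpace_le_growthSpace L hβ
  have d1 : Disjoint S (G ⊔ U) := (disjoint_growthSpace L (a := -b) (c := b / 8) (by linarith)).mono_right
    (sup_le inf_le_right (growthSpace_mono _ (by linarith)))
  have d2 : Disjoint U (G ⊔ S) := by
    refine (disjoint_growthSpace L (a := b / 8) (c := -b) (by linarith)).symm.mono_right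
      (sup_le inf_le_left (growthSpace_mono _ (by linarith)))
  have d3 : Disjoint G (S ⊔ U) := by
    have hGU : Disjoint G U := (d2.mono_right le_sup_left).symm
    rw [sup_comm] at d1 ⊢
    exact (hGU.disjoint_sup_right_of_disjoint_sup_left (by rw [sup_comm]; exact d1.symm))
  -- Both spaces together with `S ⊔ U` span, and the larger one is disjoint from `S ⊔ U`. By
  -- modularity they coincide.
  have hGc : centerSpace L = G := by
    refine eq_of_le_of_inf_le_of_sup_le (z := S ⊔ U) hcG ?_ ?_
    · rw [d3.eq_bot]; exact bot_le
    · rw [htop]; exact le_top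
  rw [hGc] at htop
  have c1 : IsCompl G (S ⊔ U) := ⟨d3, codisjoint_iff.2 htop⟩
  have c2 : IsCompl S (G ⊔ U) := ⟨d1, codisjoint_iff.2 (by rw [← htop]; ac_rfl)⟩
  have c3 : IsCompl U (G ⊔ S) := ⟨d2, codisjoint_iff.2 (by rw [← htop]; ac_rfl)⟩
  obtain ⟨P, Q, R, hP, hQ, hR, hg, hs, hu, hsum⟩ := exists_projections_of_isCompl c1 c2 c3
  have hcomm := Commute.refl L
  have iS : ∀ x ∈ S, L x ∈ S := fun x hx => map_mem_growthSpace hcomm hx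
  have iU : ∀ x ∈ U, L x ∈ U := fun x hx => map_mem_growthSpace hcomm.neg_right hx
  have iG : ∀ x ∈ G, L x ∈ G := fun x hx =>
    ⟨map_mem_growthSpace hcomm hx.1, map_mem_growthSpace hcomm.neg_right hx.2⟩
  obtain ⟨C1, hC1, b1⟩ := exists_uniform_growth L (b / 8)
  obtain ⟨C2, hC2, b2⟩ := exists_uniform_growth (-L) (b / 8)
  obtain ⟨C3, hC3, b3⟩ := exists_uniform_growth L (-b)
  obtain ⟨C4, hC4, b4⟩ := exists_uniform_growth (-L) (-b)
  let N := ‖P‖ + ‖Q‖ + ‖R‖ + 1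
  let K := C1 + C2 + C3 + C4
  have est : ∀ (c e : ℝ) (T : E →L[ℝ] E) (x y : E), 0 < c → c ≤ K → ‖T‖ ≤ N →
      ‖y‖ ≤ c * Real.exp e * ‖T x‖ → ‖y‖ ≤ K * N * Real.exp e * ‖x‖ := by
    intro c e T x y h0 hc hT hy
    calc ‖y‖ ≤ c * Real.exp e * ‖T x‖ := hy
      _ ≤ K * Real.exp e * (N * ‖x‖) := by
          gcongr
          exact T.le_of_opNorm_le hT x
      _ = _ := by ring
  have hp := norm_nonneg P
  have hq := norm_nonneg Q
  have hr := norm_nonneg R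
  exact ⟨
    { rate := b / 8
      const := K * N
      Pc := P
      Ps := Q
      Pu := R
      rate_pos := hβ
      const_pos := by positivity
      add_eq := hsum
      comm_c := commute_of_mapsTo hP hQ hR (fun x hx => (hg x hx).1) (fun x hx => (hs x hx).1)
        (fun x hx => (hu x hx).1) hsum iG iS iU
      comm_s := commute_of_mapsTo (Q := P) (R := R) hQ hP hR (fun x hx => (hs x hx).2.1)
        (fun x hx => (hg x hx).2.1) (fun x hx => (hu x hx).2.1)
        (fun x => by rw [← hsum x]; simp only [hsum]; rw [add_comm (Q x)]; exact hsum x) iS iG iU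
      comm_u := commute_of_mapsTo (Q := P) (R := Q) hR hP hQ (fun x hx => (hu x hx).2.2)
        (fun x hx => (hg x hx).2.2) (fun x hx => (hs x hx).2.2)
        (fun x => by rw [add_assoc, add_comm]; exact hsum x) iU iG iS
      cc := fun x => (hg _ (hP x)).1
      cs := fun x => (hs _ (hQ x)).1
      cu := fun x => (hu _ (hR x)).1
      ss := fun x => (hs _ (hQ x)).2.1
      uu := fun x => (hu _ (hR x)).2.2
      range_c := by
        rw [hGc]
        ext x
        constructor
        · rintro ⟨y, rfl⟩; exact hP y
        · intro hx; exact ⟨x, (hg x hx).1⟩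
      bound_c := by
        intro t x
        rcases le_total 0 t with ht | ht
        · rw [abs_of_nonneg ht]
          exact est C1 _ P x _ hC1 (by simp only [K]; linarith) (by simp only [N]; linarith)
            (b1 _ (hP x).1 t ht)
        · rw [abs_of_nonpos ht]
          have := b2 _ (hP x).2 (-t) (by linarith)
          rw [expFlow_neg_operator, neg_neg] at this
          exact est C2 _ P x _ hC2 (by simp only [K]; linarith) (by simp only [N]; linarith) this
      bound_s := by
        intro t ht x
        refine est C3 _ Q x _ hC3 (by simp only [K]; linarith) (by simp only [N]; linarith) ?_
        have := b3 _ (hQ x) t ht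
        rwa [show -(8 * (b / 8)) = -b by ring]
      bound_u := by
        intro t ht x
        refine est C4 _ R x _ hC4 (by simp only [K]; linarith) (by simp only [N]; linarith) ?_
        have := b4 _ (hR x) t ht
        rwa [show -(8 * (b / 8)) = -b by ring] }⟩

end Splitting

/-! ### The inhomogeneous linear equation in exponentially weighted spaces. -/

section LinearSolvability

open MeasureTheory

variable {E : Type*} [NormedAddCommGroup E] [InnerProductSpace ℝ E] [FiniteDimensional ℝ E]

lemma hasDerivAt_variation_of_constants (L : E →L[ℝ] E) {h : ℝ → E} (hh : Continuous h) (c : E)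
    (t : ℝ) :
    HasDerivAt (fun t => expFlow L t (c + ∫ s in (0 : ℝ)..t, expFlow L (-s) (h s)))
      (L (expFlow L t (c + ∫ s in (0 : ℝ)..t, expFlow L (-s) (h s))) + h t) t := by
  have hc : Continuous fun s => expFlow L (-s) (h s) :=
    ((continuous_expFlow L).comp continuous_neg).clm_apply hh
  have h1 : HasDerivAt (fun t => c + ∫ s in (0 : ℝ)..t, expFlow L (-s) (h s))
      (expFlow L (-t) (h t)) t :=
    (intervalIntegral.integral_hasDerivAt_right (hc.intervalIntegrable _ _)
      (hc.stronglyMeasurableAtFilter _ _) hc.continuousAt).const_add c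
  have h2 := (hasDerivAt_expFlow L t).clm_apply h1
  rw [expFlow_apply_neg_apply] at h2
  exact h2

lemma exists_stable_solution {L P : E →L[ℝ] E} {b C η M : ℝ}
    (hC : ∀ t, 0 ≤ t → ∀ x, ‖expFlow L t (P x)‖ ≤ C * Real.exp (-b * t) * ‖x‖)
    (hC0 : 0 ≤ C) (hη : 0 ≤ η) (hηb : η < b) {f : ℝ → E} (hf : Continuous f)
    (hM : ∀ t, ‖f t‖ ≤ M * Real.exp (η * |t|)) :
    ∃ y : ℝ → E, (∀ t, HasDerivAt y (L (y t) + P (f t)) t) ∧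
      ∀ t, ‖y t‖ ≤ C * M / (b - η) * Real.exp (η * |t|) := by
  have hM0 : 0 ≤ M := by
    have := (norm_nonneg _).trans (hM 0)
    simpa using this
  have hPf : Continuous fun s => P (f s) := P.continuous.comp hf
  set g : ℝ → E := fun s => expFlow L (-s) (P (f s)) with hg
  have hgc : Continuous g := ((continuous_expFlow L).comp continuous_neg).clm_apply hPf
  have key : ∀ t s, s ≤ t → ‖expFlow L t (g s)‖ ≤
      C * M * Real.exp (η * |t|) * Real.exp (-(b - η) * t) * Real.exp ((b - η) * s) := by
    intro t s hst
    have e1 : expFlow L t (g s) = expFlow L (t - s) (P (f s)) := by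
      rw [sub_eq_add_neg, expFlow_add]; rfl
    have e2 : |s| ≤ |t| + (t - s) := by
      have := abs_sub_abs_le_abs_sub s t
      rw [abs_sub_comm, abs_of_nonneg (sub_nonneg.2 hst)] at this
      linarith
    rw [e1]
    calc _ ≤ C * Real.exp (-b * (t - s)) * ‖f s‖ := hC _ (sub_nonneg.2 hst) _
      _ ≤ C * Real.exp (-b * (t - s)) * (M * Real.exp (η * (|t| + (t - s)))) := by
          gcongr
          exact (hM s).trans (by gcongr)
      _ = C * M * (Real.exp (-b * (t - s)) * Real.exp (η * (|t| + (t - s)))) := by ring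
      _ = C * M * (Real.exp (η * |t|) * Real.exp (-(b - η) * t) * Real.exp ((b - η) * s)) := by
          rw [← Real.exp_add, ← Real.exp_add, ← Real.exp_add]; ring_nf
      _ = _ := by ring
  have hexp : ∀ t, IntegrableOn (fun s => Real.exp ((b - η) * s)) (Iic t) := fun t =>
    integrableOn_exp_mul_Iic (sub_pos.2 hηb) t
  have hint' : ∀ t, IntegrableOn (fun s => expFlow L t (g s)) (Iic t) := by
    intro t
    refine Integrable.mono' ((hexp t).const_mul
      (C * M * Real.exp (η * |t|) * Real.exp (-(b - η) * t)))
      ((expFlow L t).continuous.comp hgc).aestronglyMeasurable ?_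
    exact (ae_restrict_iff' measurableSet_Iic).2 (ae_of_all _ fun s hs => key t s hs)
  have hint : ∀ t, IntegrableOn g (Iic t) := by
    intro t
    have := (expFlow L (-t)).integrable_comp (hint' t)
    simp only [expFlow_neg_apply_apply] at this
    exact this
  -- This initial value turns variation of constants into an integral from `-∞`, the choice that
  -- keeps the growth `exp(η|t|)` also backwards in time.
  set c := ∫ s in Iic (0 : ℝ), g s with hc
  have hy : ∀ t, c + ∫ s in (0 : ℝ)..t, g s = ∫ s in Iic t, g s := by
    intro t
    rw [hc, ← intervalIntegral.integral_Iic_sub_Iic (hint 0) (hint t)]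
    abel
  refine ⟨fun t => expFlow L t (c + ∫ s in (0 : ℝ)..t, g s),
    hasDerivAt_variation_of_constants L hPf c, fun t => ?_⟩
  change ‖expFlow L t (c + ∫ s in (0 : ℝ)..t, g s)‖ ≤ _
  rw [hy, ← ContinuousLinearMap.integral_comp_comm _ (hint t)]
  have h1 : ‖∫ s in Iic t, expFlow L t (g s)‖ ≤ ∫ s in Iic t,
      C * M * Real.exp (η * |t|) * Real.exp (-(b - η) * t) * Real.exp ((b - η) * s) :=
    norm_integral_le_of_norm_le ((hexp t).const_mul _)
      ((ae_restrict_iff' measurableSet_Iic).2 (ae_of_all _ fun s hs => key t s hs))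
  refine h1.trans_eq ?_
  rw [integral_const_mul, integral_exp_mul_Iic (sub_pos.2 hηb)]
  have h3 : Real.exp (-(b - η) * t) * Real.exp ((b - η) * t) = 1 := by
    rw [← Real.exp_add, neg_mul, neg_add_cancel, Real.exp_zero]
  calc _ = C * M / (b - η) * Real.exp (η * |t|) *
        (Real.exp (-(b - η) * t) * Real.exp ((b - η) * t)) := by ring
    _ = _ := by rw [h3, mul_one]

lemma exists_unstable_solution {L P : E →L[ℝ] E} {b C η M : ℝ}
    (hC : ∀ t, 0 ≤ t → ∀ x, ‖expFlow (-L) t (P x)‖ ≤ C * Real.exp (-b * t) * ‖x‖)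
    (hC0 : 0 ≤ C) (hη : 0 ≤ η) (hηb : η < b) {f : ℝ → E} (hf : Continuous f)
    (hM : ∀ t, ‖f t‖ ≤ M * Real.exp (η * |t|)) :
    ∃ y : ℝ → E, (∀ t, HasDerivAt y (L (y t) + P (f t)) t) ∧
      ∀ t, ‖y t‖ ≤ C * M / (b - η) * Real.exp (η * |t|) := by
  obtain ⟨z, hz, hzb⟩ := exists_stable_solution (f := fun t => f (-t)) hC hC0 hη hηb
    (hf.comp continuous_neg) (fun t => by simpa using hM (-t))
  refine ⟨fun t => -z (-t), fun t => ?_, fun t => by simpa using hzb (-t)⟩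
  have h1 : HasDerivAt (fun t => z (-t)) (-((-L) (z (-t)) + P (f (- -t)))) t := by
    have := (hz (-t)).scomp t (hasDerivAt_neg t)
    rw [neg_one_smul] at this
    exact this
  refine h1.neg.congr_deriv ?_
  simp

lemma norm_center_integral_le {L P : E →L[ℝ] E} {β C η M : ℝ}
    (hC : ∀ t x, ‖expFlow L t (P x)‖ ≤ C * Real.exp (β * |t|) * ‖x‖)
    (hC0 : 0 ≤ C) (hβη : β < η) {f : ℝ → E}
    (hM : ∀ t, ‖f t‖ ≤ M * Real.exp (η * |t|)) {t : ℝ} (ht : 0 ≤ t) :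
    ‖∫ s in (0 : ℝ)..t, expFlow L (t - s) (P (f s))‖ ≤ C * M / (η - β) * Real.exp (η * t) := by
  have hM0 : 0 ≤ M := by
    have := (norm_nonneg _).trans (hM 0)
    simpa using this
  have hd := sub_pos.2 hβη
  have h1 : ‖∫ s in (0 : ℝ)..t, expFlow L (t - s) (P (f s))‖ ≤
      ∫ s in (0 : ℝ)..t, C * M * Real.exp (β * t) * Real.exp ((η - β) * s) := by
    refine intervalIntegral.norm_integral_le_of_norm_le ht (ae_of_all _ fun s hs => ?_)
      (Continuous.intervalIntegrable (by fun_prop) _ _)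
    calc _ ≤ C * Real.exp (β * |t - s|) * ‖f s‖ := hC _ _
      _ ≤ C * Real.exp (β * |t - s|) * (M * Real.exp (η * |s|)) := by
          gcongr; exact hM s
      _ = C * M * (Real.exp (β * (t - s)) * Real.exp (η * s)) := by
          rw [abs_of_nonneg (sub_nonneg.2 hs.2), abs_of_pos hs.1]; ring
      _ = _ := by
          rw [← Real.exp_add, mul_assoc (C * M), ← Real.exp_add]; ring_nf
  refine h1.trans ?_
  rw [intervalIntegral.integral_const_mul]
  have h2 : ∫ s in (0 : ℝ)..t, Real.exp ((η - β) * s) ≤ Real.exp ((η - β) * t) / (η - β) := by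
    have hder : ∀ s ∈ uIcc 0 t, HasDerivAt (fun s => Real.exp ((η - β) * s) / (η - β))
        (Real.exp ((η - β) * s)) s := by
      intro s _
      have := ((hasDerivAt_id s).const_mul (η - β)).exp.div_const (η - β)
      refine this.congr_deriv ?_
      field_simp
      simp
    rw [intervalIntegral.integral_eq_sub_of_hasDerivAt hder
      (Continuous.intervalIntegrable (by fun_prop) _ _)]
    have : 0 ≤ Real.exp ((η - β) * 0) / (η - β) := by positivity
    linarith
  calc _ ≤ C * M * Real.exp (β * t) * (Real.exp ((η - β) * t) / (η - β)) := by gcongr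
    _ = C * M / (η - β) * (Real.exp (β * t) * Real.exp ((η - β) * t)) := by ring
    _ = _ := by rw [← Real.exp_add]; ring_nf

lemma exists_center_solution {L P : E →L[ℝ] E} {β C η M : ℝ}
    (hC : ∀ t x, ‖expFlow L t (P x)‖ ≤ C * Real.exp (β * |t|) * ‖x‖)
    (hC0 : 0 ≤ C) (hβη : β < η) {f : ℝ → E} (hf : Continuous f)
    (hM : ∀ t, ‖f t‖ ≤ M * Real.exp (η * |t|)) :
    ∃ y : ℝ → E, (∀ t, HasDerivAt y (L (y t) + P (f t)) t) ∧ y 0 = 0 ∧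
      ∀ t, ‖y t‖ ≤ C * M / (η - β) * Real.exp (η * |t|) := by
  have hPf : Continuous fun s => P (f s) := P.continuous.comp hf
  refine ⟨fun t => expFlow L t (0 + ∫ s in (0 : ℝ)..t, expFlow L (-s) (P (f s))),
    hasDerivAt_variation_of_constants L hPf 0, by simp, fun t => ?_⟩
  have hcont : Continuous fun s => expFlow L (-s) (P (f s)) :=
    ((continuous_expFlow L).comp continuous_neg).clm_apply hPf
  have e : expFlow L t (0 + ∫ s in (0 : ℝ)..t, expFlow L (-s) (P (f s))) =
      ∫ s in (0 : ℝ)..t, expFlow L (t - s) (P (f s)) := by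
    rw [zero_add, ← ContinuousLinearMap.intervalIntegral_comp_comm _
      (hcont.intervalIntegrable _ _)]
    refine intervalIntegral.integral_congr fun s _ => ?_
    simp only [sub_eq_add_neg, expFlow_add]; rfl
  change ‖expFlow L t (0 + ∫ s in (0 : ℝ)..t, expFlow L (-s) (P (f s)))‖ ≤ _
  rw [e]
  rcases le_total 0 t with ht | ht
  · rw [abs_of_nonneg ht]
    exact norm_center_integral_le hC hC0 hβη hM ht
  · have h1 := norm_center_integral_le (L := -L) (f := fun s => f (-s))
      (fun t x => by rw [expFlow_neg_operator]; simpa using hC (-t) x) hC0 hβη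
      (fun t => by simpa using hM (-t)) (neg_nonneg.2 ht)
    have h2 : ∫ s in (0 : ℝ)..-t, expFlow (-L) (-t - s) (P (f (-s))) =
        -∫ s in (0 : ℝ)..t, expFlow L (t - s) (P (f s)) := by
      have := intervalIntegral.integral_comp_neg (a := 0) (b := -t)
        (fun s => expFlow L (t - s) (P (f s)))
      rw [neg_zero, neg_neg] at this
      rw [← intervalIntegral.integral_symm, ← this]
      refine intervalIntegral.integral_congr fun s _ => ?_
      simp only [expFlow_neg_operator]
      congr 2
      ring
    rw [h2, norm_neg] at h1
    rwa [abs_of_nonpos ht]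

namespace SpectralSplitting

variable {L : E →L[ℝ] E}

lemma exists_solution (σ : SpectralSplitting L) : ∃ K, 0 < K ∧ ∀ η, 2 * σ.rate ≤ η →
    η ≤ 4 * σ.rate → ∀ (f : ℝ → E) (M : ℝ), Continuous f →
      (∀ t, ‖f t‖ ≤ M * Real.exp (η * |t|)) →
      ∃ y : ℝ → E, (∀ t, HasDerivAt y (L (y t) + f t) t) ∧ σ.Pc (y 0) = 0 ∧
        ∀ t, ‖y t‖ ≤ K * M * Real.exp (η * |t|) := by
  have hβ := σ.rate_pos
  have hC := σ.const_pos
  refine ⟨σ.const / σ.rate * (1 + ‖σ.Ps‖ + ‖σ.Pu‖), by positivity, ?_⟩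
  intro η h2 h4 f M hf hM
  have hM0 : 0 ≤ M := by
    have := (norm_nonneg _).trans (hM 0)
    simpa using this
  obtain ⟨y1, d1, z1, b1⟩ := exists_center_solution σ.bound_c hC.le (by linarith) hf hM
  obtain ⟨y2, d2, b2⟩ := exists_stable_solution σ.bound_s hC.le (by linarith) (by linarith) hf hM
  obtain ⟨y3, d3, b3⟩ := exists_unstable_solution σ.bound_u hC.le (by linarith) (by linarith) hf hM
  have c2 : ∀ x, σ.Ps (L x) = L (σ.Ps x) := fun x =>
    congrArg (fun A : E →L[ℝ] E => A x) σ.comm_s.eq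
  have c3 : ∀ x, σ.Pu (L x) = L (σ.Pu x) := fun x =>
    congrArg (fun A : E →L[ℝ] E => A x) σ.comm_u.eq
  -- The stable and unstable solutions are projected once more so that they contribute nothing to
  -- `Pc (y 0)`.
  refine ⟨fun t => y1 t + σ.Ps (y2 t) + σ.Pu (y3 t), fun t => ?_, ?_, fun t => ?_⟩
  · refine (((d1 t).add (σ.Ps.hasFDerivAt.comp_hasDerivAt t (d2 t))).add
      (σ.Pu.hasFDerivAt.comp_hasDerivAt t (d3 t))).congr_deriv ?_
    simp only [map_add, c2, c3, σ.ss, σ.uu]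
    conv_rhs => rw [← σ.add_eq (f t)]
    abel
  · simp [z1, σ.cs, σ.cu]
  · have e1 : σ.const * M / (η - σ.rate) ≤ σ.const / σ.rate * M := by
      rw [div_mul_eq_mul_div]
      gcongr
      linarith
    have e2 : σ.const * M / (8 * σ.rate - η) ≤ σ.const / σ.rate * M := by
      rw [div_mul_eq_mul_div]
      gcongr
      linarith
    calc ‖y1 t + σ.Ps (y2 t) + σ.Pu (y3 t)‖ ≤ ‖y1 t‖ + ‖σ.Ps‖ * ‖y2 t‖ + ‖σ.Pu‖ * ‖y3 t‖ :=
          (norm_add₃_le).trans (add_le_add (add_le_add le_rfl (σ.Ps.le_opNorm _))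
            (σ.Pu.le_opNorm _))
      _ ≤ σ.const / σ.rate * M * Real.exp (η * |t|) +
          ‖σ.Ps‖ * (σ.const / σ.rate * M * Real.exp (η * |t|)) +
          ‖σ.Pu‖ * (σ.const / σ.rate * M * Real.exp (η * |t|)) := by
          gcongr
          · exact (b1 t).trans (by gcongr)
          · exact (b2 t).trans (by gcongr)
          · exact (b3 t).trans (by gcongr)
      _ = _ := by ring

lemma eq_expFlow_of_hasDerivAt {y : ℝ → E} (hy : ∀ t, HasDerivAt y (L (y t)) t) (t : ℝ) :
    y t = expFlow L t (y 0) := by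
  have h : ∀ s, HasDerivAt (fun s => expFlow L (-s) (y s)) 0 s := by
    intro s
    have h1 : HasDerivAt (fun s => expFlow L (-s)) (-(expFlow L (-s) * L)) s := by
      have := (hasDerivAt_expFlow' L (-s)).scomp s (hasDerivAt_neg s)
      rw [neg_one_smul] at this
      exact this
    refine (h1.clm_apply (hy s)).congr_deriv ?_
    simp
  have := is_const_of_deriv_eq_zero (fun s => (h s).differentiableAt) (fun s => (h s).deriv) t 0
  simp only [neg_zero, expFlow_zero, one_apply_eq_self] at this
  rw [← this, expFlow_apply_neg_apply]

/-- Growth at rate `4 · rate` is beaten by the hyperbolic rate `8 · rate`: writing the stable part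
of `y 0` as the transport of `y (-t)`, and the unstable part as that of `y t`, shows that both are
arbitrarily small. -/
lemma eq_zero_of_solution (σ : SpectralSplitting L) {y : ℝ → E} {M : ℝ}
    (hy : ∀ t, HasDerivAt y (L (y t)) t) (h0 : σ.Pc (y 0) = 0)
    (hM : ∀ t, ‖y t‖ ≤ M * Real.exp (4 * σ.rate * |t|)) (t : ℝ) : y t = 0 := by
  have hβ := σ.rate_pos
  have hC := σ.const_pos
  have lim : Tendsto (fun t : ℝ => σ.const * M * Real.exp (-(4 * σ.rate) * t)) atTop (𝓝 0) := by
    have : Tendsto (fun t : ℝ => σ.const * M * Real.exp (-(4 * σ.rate) * t)) atTop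
        (𝓝 (σ.const * M * 0)) :=
      Tendsto.const_mul _ (Real.tendsto_exp_atBot.comp
        (tendsto_id.const_mul_atTop_of_neg (by linarith)))
    simpa using this
  have aux : ∀ t : ℝ, σ.const * Real.exp (-(8 * σ.rate) * t) * (M * Real.exp (4 * σ.rate * t)) =
      σ.const * M * Real.exp (-(4 * σ.rate) * t) := by
    intro t
    calc _ = σ.const * M * (Real.exp (-(8 * σ.rate) * t) * Real.exp (4 * σ.rate * t)) := by ring
      _ = _ := by rw [← Real.exp_add]; ring_nf
  have hs : σ.Ps (y 0) = 0 := by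
    refine norm_le_zero_iff.1 (ge_of_tendsto lim ((eventually_ge_atTop 0).mono fun t ht => ?_))
    have h1 : σ.Ps (y 0) = expFlow L t (σ.Ps (y (-t))) := by
      rw [expFlow_apply_comm σ.comm_s, eq_expFlow_of_hasDerivAt hy (-t), expFlow_apply_neg_apply]
    rw [h1, ← aux]
    refine (σ.bound_s t ht _).trans ?_
    gcongr
    simpa [abs_of_nonneg ht] using hM (-t)
  have hu : σ.Pu (y 0) = 0 := by
    refine norm_le_zero_iff.1 (ge_of_tendsto lim ((eventually_ge_atTop 0).mono fun t ht => ?_))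
    have h1 : σ.Pu (y 0) = expFlow (-L) t (σ.Pu (y t)) := by
      rw [expFlow_neg_operator, expFlow_apply_comm σ.comm_u, eq_expFlow_of_hasDerivAt hy t,
        expFlow_neg_apply_apply]
    rw [h1, ← aux]
    refine (σ.bound_u t ht _).trans ?_
    gcongr
    simpa [abs_of_nonneg ht] using hM t
  have hz : y 0 = 0 := by
    rw [← σ.add_eq (y 0), h0, hs, hu]; simp
  rw [eq_expFlow_of_hasDerivAt hy t, hz, map_zero]

end SpectralSplitting

end LinearSolvability

/-! ### Small Lipschitz perturbations of the linear equation. -/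

section Nonlinear

variable {E : Type*} [NormedAddCommGroup E] [InnerProductSpace ℝ E] [FiniteDimensional ℝ E]

namespace SpectralSplitting

variable {L : E →L[ℝ] E}

/-- `K` is a constant in the estimates for the linear equation `y' = L y + f` in the spaces of
functions that are `O(exp (η |t|))`. -/
structure IsSolvabilityConst (σ : SpectralSplitting L) (K : ℝ) : Prop where
  pos : 0 < K
  exists_solution : ∀ η, 2 * σ.rate ≤ η → η ≤ 4 * σ.rate → ∀ (f : ℝ → E) (M : ℝ), Continuous f →
    (∀ t, ‖f t‖ ≤ M * Real.exp (η * |t|)) →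
    ∃ y : ℝ → E, (∀ t, HasDerivAt y (L (y t) + f t) t) ∧ σ.Pc (y 0) = 0 ∧
      ∀ t, ‖y t‖ ≤ K * M * Real.exp (η * |t|)
  norm_expFlow_le : ∀ t x, ‖expFlow L t (σ.Pc x)‖ ≤ K * Real.exp (σ.rate * |t|) * ‖x‖

lemma exists_isSolvabilityConst (σ : SpectralSplitting L) : ∃ K, σ.IsSolvabilityConst K := by
  obtain ⟨K, hK, h⟩ := σ.exists_solution
  have hC := σ.const_pos
  refine ⟨K + σ.const, by positivity, fun η h2 h4 f M hf hM => ?_, fun t x => ?_⟩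
  · obtain ⟨y, h1, h2, h3⟩ := h η h2 h4 f M hf hM
    have hM0 : 0 ≤ M := by
      have := (norm_nonneg _).trans (hM 0)
      simpa using this
    refine ⟨y, h1, h2, fun t => (h3 t).trans ?_⟩
    gcongr
    linarith
  · refine (σ.bound_c t x).trans ?_
    gcongr
    linarith

namespace IsSolvabilityConst

variable {σ : SpectralSplitting L} {K : ℝ}

/-- By uniqueness in the weighted space, any solution of weighted growth is the constructed one plus
the center flow of its initial value, so the bound does not depend on `M'`. -/
lemma norm_le (hK : σ.IsSolvabilityConst K) {η : ℝ} (h2 : 2 * σ.rate ≤ η) (h4 : η ≤ 4 * σ.rate)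
    {y f : ℝ → E} {M M' : ℝ} (hf : Continuous f) (hy : ∀ t, HasDerivAt y (L (y t) + f t) t)
    (hM : ∀ t, ‖f t‖ ≤ M * Real.exp (η * |t|)) (hM' : ∀ t, ‖y t‖ ≤ M' * Real.exp (η * |t|))
    (t : ℝ) : ‖y t‖ ≤ K * (M + ‖σ.Pc (y 0)‖) * Real.exp (η * |t|) := by
  have hβ := σ.rate_pos
  have hK0 := hK.pos
  obtain ⟨z, hz, hz0, hzb⟩ := hK.exists_solution η h2 h4 f M hf hM
  have hM0 : 0 ≤ M := by
    have := (norm_nonneg _).trans (hM 0)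
    simpa using this
  have hM'0 : 0 ≤ M' := by
    have := (norm_nonneg _).trans (hM' 0)
    simpa using this
  have hX : ∀ t, ‖expFlow L t (σ.Pc (y 0))‖ ≤ K * ‖σ.Pc (y 0)‖ * Real.exp (η * |t|) := by
    intro t
    have := hK.norm_expFlow_le t (σ.Pc (y 0))
    rw [σ.cc] at this
    calc _ ≤ _ := this
      _ ≤ K * Real.exp (η * |t|) * ‖σ.Pc (y 0)‖ := by gcongr; linarith
      _ = _ := by ring
  have h0 : ∀ t, y t - z t - expFlow L t (σ.Pc (y 0)) = 0 := by
    refine σ.eq_zero_of_solution (M := M' + K * M + K * ‖σ.Pc (y 0)‖) ?_ ?_ ?_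
    · intro t
      refine (((hy t).sub (hz t)).sub (hasDerivAt_expFlow_apply L _ t)).congr_deriv ?_
      simp only [map_sub]
      abel
    · simp [hz0, σ.cc]
    · intro t
      have e : Real.exp (η * |t|) ≤ Real.exp (4 * σ.rate * |t|) := by gcongr
      calc _ ≤ ‖y t‖ + ‖z t‖ + ‖expFlow L t (σ.Pc (y 0))‖ :=
            (norm_sub_le _ _).trans (add_le_add (norm_sub_le _ _) le_rfl)
        _ ≤ M' * Real.exp (η * |t|) + K * M * Real.exp (η * |t|) +
            K * ‖σ.Pc (y 0)‖ * Real.exp (η * |t|) :=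
          add_le_add (add_le_add (hM' t) (hzb t)) (hX t)
        _ = (M' + K * M + K * ‖σ.Pc (y 0)‖) * Real.exp (η * |t|) := by ring
        _ ≤ _ := by gcongr
  have e : y t = z t + expFlow L t (σ.Pc (y 0)) := by
    have := h0 t
    rwa [sub_sub, sub_eq_zero] at this
  rw [e]
  calc _ ≤ K * M * Real.exp (η * |t|) + K * ‖σ.Pc (y 0)‖ * Real.exp (η * |t|) :=
        (norm_add_le _ _).trans (add_le_add (hzb t) (hX t))
    _ = _ := by ring

/-- The weighted supremum `N` is finite by assumption, and it satisfies `N ≤ K (κ N + M + ‖Pc (y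
0)‖)`. Since `K κ ≤ 1/2`, the first term is absorbed on the left. -/
lemma norm_le_of_perturbation (hK : σ.IsSolvabilityConst K) {η : ℝ} (h2 : 2 * σ.rate ≤ η)
    (h4 : η ≤ 4 * σ.rate) {y f : ℝ → E} {M M' κ : ℝ} (hκ0 : 0 ≤ κ) (hκ : 2 * K * κ ≤ 1)
    (hf : Continuous f) (hy : ∀ t, HasDerivAt y (L (y t) + f t) t)
    (hM : ∀ t, ‖f t‖ ≤ κ * ‖y t‖ + M * Real.exp (η * |t|))
    (hM' : ∀ t, ‖y t‖ ≤ M' * Real.exp (η * |t|))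
    (t : ℝ) : ‖y t‖ ≤ 2 * K * (M + ‖σ.Pc (y 0)‖) * Real.exp (η * |t|) := by
  have hK0 := hK.pos
  set q : ℝ → ℝ := fun t => ‖y t‖ * Real.exp (-(η * |t|)) with hq
  have e : ∀ t, ‖y t‖ = q t * Real.exp (η * |t|) := by
    intro t
    simp only [hq]
    rw [mul_assoc, ← Real.exp_add]; simp
  have hle : ∀ c t, (‖y t‖ ≤ c * Real.exp (η * |t|) ↔ q t ≤ c) := by
    intro c t
    rw [e]
    exact mul_le_mul_iff_of_pos_right (Real.exp_pos _)
  have hbdd : BddAbove (range q) := ⟨M', by rintro _ ⟨t, rfl⟩; exact (hle _ _).1 (hM' t)⟩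
  set N := sSup (range q) with hN
  have hqN : ∀ t, q t ≤ N := fun t => le_csSup hbdd ⟨t, rfl⟩
  have hyN : ∀ t, ‖y t‖ ≤ N * Real.exp (η * |t|) := fun t => (hle _ _).2 (hqN t)
  have h1 : ∀ t, ‖y t‖ ≤ K * (κ * N + M + ‖σ.Pc (y 0)‖) * Real.exp (η * |t|) := by
    refine hK.norm_le h2 h4 hf hy (fun t => (hM t).trans ?_) hM'
    rw [add_mul, mul_assoc]
    gcongr
    exact hyN t
  have h3 : N ≤ K * (κ * N + M + ‖σ.Pc (y 0)‖) :=
    csSup_le (range_nonempty q) (by rintro _ ⟨t, rfl⟩; exact (hle _ _).1 (h1 t))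
  have hN0 : 0 ≤ N := le_trans (by simp only [hq]; positivity) (hqN 0)
  refine (hle _ _).2 ((hqN t).trans ?_)
  nlinarith

/-- A contraction of ratio 1/2 on the rescaled functions `exp(-η|t|) x(t)`. The nonlinearity may
depend on time so that the same result also solves the linearised equation along a solution. -/
lemma exists_nonlinear_solution (hK : σ.IsSolvabilityConst K) {g : ℝ → E → E} {κ : ℝ}
    (hκ0 : 0 ≤ κ) (hκ : 2 * K * κ ≤ 1) (hg : Continuous (Function.uncurry g))
    (hlip : ∀ t x y, ‖g t x - g t y‖ ≤ κ * ‖x - y‖) (hg0 : ∀ t, g t 0 = 0) (ξ : E) :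
    ∃ x : ℝ → E, (∀ t, HasDerivAt x (L (x t) + g t (x t)) t) ∧ σ.Pc (x 0) = σ.Pc ξ ∧
      ∀ t, ‖x t‖ ≤ 2 * K * ‖σ.Pc ξ‖ * Real.exp (2 * σ.rate * |t|) := by
  have hK0 := hK.pos
  have hβ := σ.rate_pos
  set η := 2 * σ.rate with hη
  have h4 : η ≤ 4 * σ.rate := by linarith
  have hgle : ∀ t x, ‖g t x‖ ≤ κ * ‖x‖ := by
    intro t x
    simpa [hg0] using hlip t x 0
  have hw : Continuous fun t : ℝ => Real.exp (η * |t|) := by fun_prop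
  have hw' : Continuous fun t : ℝ => Real.exp (-(η * |t|)) := by fun_prop
  let f : BoundedContinuousFunction ℝ E → ℝ → E := fun u t => g t (Real.exp (η * |t|) • u t)
  have hf : ∀ u, Continuous (f u) := fun u =>
    hg.comp (continuous_id.prodMk (hw.smul u.continuous))
  have hfb : ∀ u t, ‖f u t‖ ≤ κ * ‖u‖ * Real.exp (η * |t|) := by
    intro u t
    refine (hgle _ _).trans ?_
    rw [norm_smul, Real.norm_eq_abs, Real.abs_exp]
    calc _ = κ * ‖u t‖ * Real.exp (η * |t|) := by ring
      _ ≤ _ := by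
          gcongr
          exact u.norm_coe_le_norm t
  have hex := fun u => hK.exists_solution η le_rfl h4 (f u) _ (hf u) (hfb u)
  choose y0 hy0 hy00 hy0b using hex
  let y : BoundedContinuousFunction ℝ E → ℝ → E := fun u t => y0 u t + expFlow L t (σ.Pc ξ)
  have hy : ∀ u t, HasDerivAt (y u) (L (y u t) + f u t) t := by
    intro u t
    refine ((hy0 u t).add (hasDerivAt_expFlow_apply L (σ.Pc ξ) t)).congr_deriv ?_
    simp only [y, map_add]
    abel
  have hy1 : ∀ u, σ.Pc (y u 0) = σ.Pc ξ := by
    intro u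
    simp [y, hy00, σ.cc]
  have hyb : ∀ u t, ‖y u t‖ ≤ (K * (κ * ‖u‖) + K * ‖ξ‖) * Real.exp (η * |t|) := by
    intro u t
    rw [add_mul]
    refine (norm_add_le _ _).trans (add_le_add (hy0b u t) ((hK.norm_expFlow_le t ξ).trans ?_))
    rw [mul_right_comm]
    gcongr
    linarith
  have hyc : ∀ u, Continuous (y u) := fun u =>
    continuous_iff_continuousAt.2 fun t => (hy u t).continuousAt
  have hwb : ∀ u t, ‖Real.exp (-(η * |t|)) • y u t‖ ≤ K * (κ * ‖u‖) + K * ‖ξ‖ := by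
    intro u t
    rw [norm_smul, Real.norm_eq_abs, Real.abs_exp]
    calc _ ≤ Real.exp (-(η * |t|)) * ((K * (κ * ‖u‖) + K * ‖ξ‖) * Real.exp (η * |t|)) := by
          gcongr; exact hyb u t
      _ = _ := by rw [mul_left_comm, ← Real.exp_add]; simp
  let Φ : BoundedContinuousFunction ℝ E → BoundedContinuousFunction ℝ E := fun u =>
    BoundedContinuousFunction.ofNormedAddCommGroup (fun t => Real.exp (-(η * |t|)) • y u t)
      (hw'.smul (hyc u)) _ (hwb u)
  have hΦ : ContractingWith (1 / 2) Φ := by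
    refine ⟨by norm_num, LipschitzWith.of_dist_le_mul fun u v => ?_⟩
    rw [BoundedContinuousFunction.dist_le (by positivity)]
    intro t
    have h1 : ‖y u t - y v t‖ ≤
        K * (κ * dist u v + ‖σ.Pc (y u 0 - y v 0)‖) * Real.exp (η * |t|) := by
      refine hK.norm_le le_rfl h4 (y := fun t => y u t - y v t) (f := fun t => f u t - f v t)
        (M := κ * dist u v)
        (M' := K * (κ * ‖u‖) + K * ‖ξ‖ + (K * (κ * ‖v‖) + K * ‖ξ‖)) ((hf u).sub (hf v)) ?_ ?_ ?_ t
      · intro t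
        refine ((hy u t).sub (hy v t)).congr_deriv ?_
        rw [map_sub]; abel
      · intro t
        refine (hlip _ _ _).trans ?_
        rw [← smul_sub, norm_smul, Real.norm_eq_abs, Real.abs_exp, ← dist_eq_norm]
        calc _ = κ * dist (u t) (v t) * Real.exp (η * |t|) := by ring
          _ ≤ _ := by
              gcongr
              exact BoundedContinuousFunction.dist_coe_le_dist t
      · intro t
        rw [add_mul]
        exact (norm_sub_le _ _).trans (add_le_add (hyb u t) (hyb v t))
    rw [map_sub, hy1, hy1, sub_self, norm_zero, add_zero] at h1
    change dist (Real.exp (-(η * |t|)) • y u t) (Real.exp (-(η * |t|)) • y v t) ≤ _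
    rw [dist_eq_norm, ← smul_sub, norm_smul, Real.norm_eq_abs, Real.abs_exp]
    have hd : 0 ≤ dist u v := dist_nonneg
    calc _ ≤ Real.exp (-(η * |t|)) * (K * (κ * dist u v) * Real.exp (η * |t|)) := by gcongr
      _ = K * κ * dist u v := by
          rw [mul_left_comm, ← Real.exp_add]; simp [mul_assoc]
      _ ≤ _ := by
          push_cast
          nlinarith
  obtain ⟨u, hu⟩ : ∃ u, Φ u = u := ⟨_, hΦ.fixedPoint_isFixedPt⟩
  have hyu : ∀ t, Real.exp (η * |t|) • u t = y u t := by
    intro t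
    have : u t = Real.exp (-(η * |t|)) • y u t := by
      conv_lhs => rw [← hu]
      rfl
    rw [this, smul_smul, ← Real.exp_add]; simp
  have hyg : ∀ t, f u t = g t (y u t) := fun t => by simp only [f, hyu]
  refine ⟨y u, fun t => by rw [← hyg]; exact hy u t, hy1 u, fun t => ?_⟩
  have := hK.norm_le_of_perturbation (M := 0) le_rfl h4 hκ0 hκ (hf u) (hy u)
    (fun t => by rw [hyg, zero_mul, add_zero]; exact hgle _ _) (hyb u) t
  rwa [hy1, zero_add] at this

end IsSolvabilityConst

end SpectralSplitting

/-- A remainder bound uniform in the base point makes `D` Lipschitz: expand `f (x + v + w)` about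
`x` and about `x + v` with `‖w‖ = ‖v‖`. The three remainders add up to `(4 + 1 + 1) C ‖v‖²`. -/
lemma contDiff_one_of_quadratic_remainder {F : Type*} [NormedAddCommGroup F] [NormedSpace ℝ F]
    {f : E → F} {D : E → E →L[ℝ] F} {C : ℝ}
    (h : ∀ x v, ‖f (x + v) - f x - D x v‖ ≤ C * ‖v‖ ^ 2) :
    ContDiff ℝ 1 f ∧ ∀ x, HasFDerivAt f (D x) x := by
  have hD : ∀ x, HasFDerivAt f (D x) x := by
    intro x
    rw [hasFDerivAt_iff_isLittleO_nhds_zero]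
    refine Asymptotics.IsBigO.trans_isLittleO (g := fun v : E => ‖v‖ ^ 2) ?_ ?_
    · refine Asymptotics.IsBigO.of_bound C (Eventually.of_forall fun v => ?_)
      simpa using h x v
    · have := Asymptotics.isLittleO_norm_pow_id (E' := E) (n := 2) (by norm_num)
      exact this
  have hL : ∀ x v, ‖D (x + v) - D x‖ ≤ 6 * C * ‖v‖ := by
    intro x v
    have hC : 0 ≤ C * ‖v‖ ^ 2 := (norm_nonneg _).trans (h x v)
    rcases eq_or_ne v 0 with rfl | hv
    · simp
    have hv' : 0 < ‖v‖ := norm_pos_iff.2 hv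
    have hC0 : 0 ≤ C := nonneg_of_mul_nonneg_left hC (by positivity)
    refine ContinuousLinearMap.opNorm_le_of_unit_norm (by positivity) fun k hk => ?_
    set w := ‖v‖ • k with hw
    have hwn : ‖w‖ = ‖v‖ := by rw [hw, norm_smul, hk]; simp
    have e : (D (x + v) - D x) w = (f (x + (v + w)) - f x - D x (v + w)) -
        (f (x + v + w) - f (x + v) - D (x + v) w) - (f (x + v) - f x - D x v) := by
      rw [← add_assoc]
      simp only [sub_apply, map_add]
      abel
    have h1 : ‖(D (x + v) - D x) w‖ ≤ 6 * C * ‖v‖ ^ 2 := by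
      rw [e]
      calc _ ≤ C * ‖v + w‖ ^ 2 + C * ‖w‖ ^ 2 + C * ‖v‖ ^ 2 :=
            (norm_sub_le _ _).trans (add_le_add ((norm_sub_le _ _).trans
              (add_le_add (h _ _) (h _ _))) (h _ _))
        _ ≤ C * (‖v‖ + ‖v‖) ^ 2 + C * ‖v‖ ^ 2 + C * ‖v‖ ^ 2 := by
            rw [hwn]
            gcongr
            exact (norm_add_le _ _).trans_eq (by rw [hwn])
        _ = _ := by ring
    have e2 : ‖(D (x + v) - D x) w‖ = ‖v‖ * ‖(D (x + v) - D x) k‖ := by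
      rw [hw, map_smul, norm_smul, norm_norm]
    rw [e2] at h1
    refine le_of_mul_le_mul_left ?_ hv'
    linarith
  have hc : Continuous D := by
    have : LipschitzWith (Real.toNNReal (6 * C)) D := by
      refine LipschitzWith.of_dist_le_mul fun x y => ?_
      rw [dist_eq_norm, dist_eq_norm]
      have := hL y (x - y)
      rw [add_sub_cancel] at this
      refine this.trans ?_
      gcongr
      exact Real.le_coe_toNNReal _
    exact this.continuous
  refine ⟨contDiff_one_iff_fderiv.2 ⟨fun x => (hD x).differentiableAt, ?_⟩, hD⟩
  rwa [show fderiv ℝ f = D from funext fun x => (hD x).fderiv]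

end Nonlinear

/-! ### The center manifold as the image of a retraction. -/

section CenterRetraction

variable {E : Type*} [NormedAddCommGroup E] [InnerProductSpace ℝ E] [FiniteDimensional ℝ E]

lemma norm_sub_sub_fderiv_le {T : E → E} (hT : Differentiable ℝ T) {M : ℝ}
    (hM : ∀ x y, ‖fderiv ℝ T x - fderiv ℝ T y‖ ≤ M * ‖x - y‖) (x y : E) :
    ‖T y - T x - fderiv ℝ T x (y - x)‖ ≤ M * ‖y - x‖ ^ 2 := by
  have h := (convex_segment x y).norm_image_sub_le_of_norm_hasFDerivWithin_le' (f := T)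
    (φ := fderiv ℝ T x) (C := M * ‖y - x‖)
    (fun z _ => (hT z).hasFDerivAt.hasFDerivWithinAt) ?_ (left_mem_segment ℝ x y)
    (right_mem_segment ℝ x y)
  · refine h.trans_eq (by ring)
  · intro z hz
    refine (hM z x).trans ?_
    rcases eq_or_ne x y with rfl | hxy
    · rw [segment_same, mem_singleton_iff] at hz
      simp [hz]
    have hM0 : 0 ≤ M := by
      have h1 := (norm_nonneg _).trans (hM x y)
      exact nonneg_of_mul_nonneg_left h1 (norm_pos_iff.2 (sub_ne_zero.2 hxy))
    gcongr
    obtain ⟨a, b, ha, hb, hab, rfl⟩ := hz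
    have : a • x + b • y - x = b • (y - x) := by
      rw [eq_sub_of_add_eq hab]; module
    rw [this, norm_smul, Real.norm_eq_abs, abs_of_nonneg hb]
    exact mul_le_of_le_one_left (norm_nonneg _) (by linarith)

namespace SpectralSplitting.IsSolvabilityConst

variable {L : E →L[ℝ] E} {σ : SpectralSplitting L} {K : ℝ}

lemma norm_sub_le_of_solutions (hK : σ.IsSolvabilityConst K) {g : ℝ → E → E} {κ : ℝ}
    (hκ0 : 0 ≤ κ) (hκ : 2 * K * κ ≤ 1) (hg : Continuous (Function.uncurry g))
    (hlip : ∀ t x y, ‖g t x - g t y‖ ≤ κ * ‖x - y‖) {x y : ℝ → E} {A B : ℝ}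
    (hx : ∀ t, HasDerivAt x (L (x t) + g t (x t)) t)
    (hy : ∀ t, HasDerivAt y (L (y t) + g t (y t)) t)
    (hA : ∀ t, ‖x t‖ ≤ A * Real.exp (2 * σ.rate * |t|))
    (hB : ∀ t, ‖y t‖ ≤ B * Real.exp (2 * σ.rate * |t|)) (t : ℝ) :
    ‖x t - y t‖ ≤ 2 * K * ‖σ.Pc (x 0) - σ.Pc (y 0)‖ * Real.exp (2 * σ.rate * |t|) := by
  have hβ := σ.rate_pos
  have cx : Continuous x := continuous_iff_continuousAt.2 fun t => (hx t).continuousAt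
  have cy : Continuous y := continuous_iff_continuousAt.2 fun t => (hy t).continuousAt
  have := hK.norm_le_of_perturbation (y := fun t => x t - y t)
    (f := fun t => g t (x t) - g t (y t)) (M := 0) (M' := A + B) le_rfl (by linarith) hκ0 hκ
    ((hg.comp (continuous_id.prodMk cx)).sub (hg.comp (continuous_id.prodMk cy)))
    (fun t => ((hx t).sub (hy t)).congr_deriv (by rw [map_sub]; abel))
    (fun t => by rw [zero_mul, add_zero]; exact hlip _ _ _)
    (fun t => by rw [add_mul]; exact (norm_sub_le _ _).trans (add_le_add (hA t) (hB t))) t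
  rwa [zero_add, map_sub] at this

lemma solution_unique (hK : σ.IsSolvabilityConst K) {g : ℝ → E → E} {κ : ℝ}
    (hκ0 : 0 ≤ κ) (hκ : 2 * K * κ ≤ 1) (hg : Continuous (Function.uncurry g))
    (hlip : ∀ t x y, ‖g t x - g t y‖ ≤ κ * ‖x - y‖) {x y : ℝ → E} {A B : ℝ}
    (hx : ∀ t, HasDerivAt x (L (x t) + g t (x t)) t)
    (hy : ∀ t, HasDerivAt y (L (y t) + g t (y t)) t)
    (hA : ∀ t, ‖x t‖ ≤ A * Real.exp (2 * σ.rate * |t|))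
    (hB : ∀ t, ‖y t‖ ≤ B * Real.exp (2 * σ.rate * |t|)) (h0 : σ.Pc (x 0) = σ.Pc (y 0)) (t : ℝ) :
    x t = y t := by
  have := hK.norm_sub_le_of_solutions hκ0 hκ hg hlip hx hy hA hB t
  rw [h0, sub_self, norm_zero, mul_zero, zero_mul] at this
  exact sub_eq_zero.1 (norm_le_zero_iff.1 this)

/-- The center manifold of `x' = L x + T x`, for `T` with small Lipschitz constant, as the image of
a retraction `χ` that factors through the projection to the center space. -/
theorem exists_global_retraction (hK : σ.IsSolvabilityConst K) {T : E → E} {κ M : ℝ}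
    (hκ0 : 0 ≤ κ) (hκ : 2 * K * κ ≤ 1) (hT : ContDiff ℝ 1 T) (hT0 : T 0 = 0)
    (hDT0 : fderiv ℝ T 0 = 0) (hlip : ∀ x y, ‖T x - T y‖ ≤ κ * ‖x - y‖)
    (hM : ∀ x y, ‖fderiv ℝ T x - fderiv ℝ T y‖ ≤ M * ‖x - y‖) :
    ∃ χ : E → E, ContDiff ℝ 1 χ ∧ χ 0 = 0 ∧ (∀ x, σ.Pc (χ x) = σ.Pc x) ∧
      (∀ x, χ (σ.Pc x) = χ x) ∧ fderiv ℝ χ 0 = σ.Pc ∧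
      ∀ x, fderiv ℝ χ x (L (χ x) + T (χ x)) = L (χ x) + T (χ x) := by
  have hK0 := hK.pos
  have hβ := σ.rate_pos
  have hTd : Differentiable ℝ T := hT.differentiable (by norm_num)
  have cg : Continuous (Function.uncurry fun (_ : ℝ) (x : E) => T x) :=
    hT.continuous.comp continuous_snd
  have lg : ∀ (_ : ℝ) (x y : E), ‖T x - T y‖ ≤ κ * ‖x - y‖ := fun _ => hlip
  have hex := fun ξ => hK.exists_nonlinear_solution hκ0 hκ cg lg (fun _ => hT0) ξ
  choose x hx hx0 hxb using hex
  have hxc : ∀ ξ, Continuous (x ξ) := fun ξ =>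
    continuous_iff_continuousAt.2 fun t => (hx ξ t).continuousAt
  have hxu : ∀ (ξ : E) (y : ℝ → E) (A : ℝ), (∀ t, HasDerivAt y (L (y t) + T (y t)) t) →
      (∀ t, ‖y t‖ ≤ A * Real.exp (2 * σ.rate * |t|)) → σ.Pc (y 0) = σ.Pc ξ → y = x ξ :=
    fun ξ y A h1 h2 h3 => funext fun t => hK.solution_unique hκ0 hκ cg lg h1 (hx ξ) h2 (hxb ξ)
      (h3.trans (hx0 ξ).symm) t
  -- the linearised equation
  let g : E → ℝ → E → E := fun ξ t v => fderiv ℝ T (x ξ t) v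
  have hgc : ∀ ξ, Continuous (Function.uncurry (g ξ)) := fun ξ =>
    (((hT.continuous_fderiv (by norm_num)).comp ((hxc ξ).comp continuous_fst))).clm_apply
      continuous_snd
  have hDκ : ∀ z, ‖fderiv ℝ T z‖ ≤ κ := by
    intro z
    have : LipschitzWith ⟨κ, hκ0⟩ T := LipschitzWith.of_dist_le_mul fun a b => by
      rw [dist_eq_norm, dist_eq_norm]; exact hlip a b
    exact norm_fderiv_le_of_lipschitz ℝ this
  have hgl : ∀ ξ t v w, ‖g ξ t v - g ξ t w‖ ≤ κ * ‖v - w‖ := fun ξ t v w => by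
    simp only [g]
    rw [← map_sub]
    exact (fderiv ℝ T (x ξ t)).le_of_opNorm_le (hDκ _) _
  have hex2 := fun ξ h => hK.exists_nonlinear_solution hκ0 hκ (hgc ξ) (hgl ξ)
    (fun t => by simp [g]) h
  choose y hy hy0 hyb using hex2
  have hyu : ∀ (ξ h : E) (z : ℝ → E) (A : ℝ), (∀ t, HasDerivAt z (L (z t) + g ξ t (z t)) t) →
      (∀ t, ‖z t‖ ≤ A * Real.exp (2 * σ.rate * |t|)) → σ.Pc (z 0) = σ.Pc h → z = y ξ h :=
    fun ξ h z A h1 h2 h3 => funext fun t => hK.solution_unique hκ0 hκ (hgc ξ) (hgl ξ) h1 (hy ξ h)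
      h2 (hyb ξ h) (h3.trans (hy0 ξ h).symm) t
  let D : E → E →L[ℝ] E := fun ξ => LinearMap.toContinuousLinearMap
    { toFun := fun h => y ξ h 0
      map_add' := by
        intro h k
        have := hyu ξ (h + k) (fun t => y ξ h t + y ξ k t)
          (2 * K * ‖σ.Pc h‖ + 2 * K * ‖σ.Pc k‖) ?_ ?_ ?_
        · exact (congrFun this 0).symm
        · intro t
          refine ((hy ξ h t).add (hy ξ k t)).congr_deriv ?_
          simp only [g, map_add]; abel
        · intro t
          rw [add_mul]
          exact (norm_add_le _ _).trans (add_le_add (hyb ξ h t) (hyb ξ k t))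
        · rw [map_add, map_add, hy0, hy0]
      map_smul' := by
        intro c h
        have := hyu ξ (c • h) (fun t => c • y ξ h t) (‖c‖ * (2 * K * ‖σ.Pc h‖)) ?_ ?_ ?_
        · exact (congrFun this 0).symm
        · intro t
          refine ((hy ξ h t).const_smul c).congr_deriv ?_
          simp only [g, map_smul, smul_add]
        · intro t
          rw [norm_smul, mul_assoc]
          gcongr
          exact hyb ξ h t
        · rw [map_smul, map_smul, hy0] }
  have hDy : ∀ ξ h, D ξ h = y ξ h 0 := fun ξ h => rfl
  -- The difference of two solutions is `O(‖h‖ exp(2 rate |t|))`, so the Taylor remainder of `T`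
  -- along it is `O(‖h‖² exp(4 rate |t|))`. This is where the second weight is used.
  have hquad : ∀ ξ h, ‖x (ξ + h) 0 - x ξ 0 - D ξ h‖ ≤
      2 * K * (M * (2 * K * ‖σ.Pc‖) ^ 2) * ‖h‖ ^ 2 := by
    intro ξ h
    have hM0 : 0 ≤ M * ‖h‖ := by
      have := (norm_nonneg _).trans (hM h 0)
      simpa using this
    have hd : ∀ t, ‖x (ξ + h) t - x ξ t‖ ≤
        2 * K * ‖σ.Pc‖ * ‖h‖ * Real.exp (2 * σ.rate * |t|) := by
      intro t
      refine (hK.norm_sub_le_of_solutions hκ0 hκ cg lg (hx _) (hx _) (hxb _) (hxb _) t).trans ?_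
      rw [hx0, hx0, map_add, add_sub_cancel_left]
      calc _ ≤ 2 * K * (‖σ.Pc‖ * ‖h‖) * Real.exp (2 * σ.rate * |t|) := by
            gcongr
            exact σ.Pc.le_opNorm h
        _ = _ := by ring
    have e2 : ∀ t : ℝ, Real.exp (2 * σ.rate * |t|) ^ 2 = Real.exp (4 * σ.rate * |t|) := by
      intro t
      rw [pow_two, ← Real.exp_add]; ring_nf
    have e3 : ∀ t : ℝ, Real.exp (2 * σ.rate * |t|) ≤ Real.exp (4 * σ.rate * |t|) := by
      intro t
      gcongr
      norm_num
    have := hK.norm_le_of_perturbation (η := 4 * σ.rate)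
      (y := fun t => x (ξ + h) t - x ξ t - y ξ h t)
      (f := fun t => T (x (ξ + h) t) - T (x ξ t) - g ξ t (y ξ h t))
      (M := M * (2 * K * ‖σ.Pc‖ * ‖h‖) ^ 2)
      (M' := 2 * K * ‖σ.Pc‖ * ‖h‖ + 2 * K * ‖σ.Pc h‖)
      (by linarith) le_rfl hκ0 hκ ?_ ?_ ?_ ?_ 0
    · rw [hDy]
      refine this.trans_eq ?_
      rw [map_sub, map_sub, hx0, hx0, hy0, map_add, add_sub_cancel_left, sub_self, norm_zero]
      simp
      ring
    · refine ((hT.continuous.comp (hxc _)).sub (hT.continuous.comp (hxc _))).sub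
        ((hgc ξ).comp (continuous_id.prodMk ?_))
      exact continuous_iff_continuousAt.2 fun t => (hy ξ h t).continuousAt
    · intro t
      refine (((hx (ξ + h) t).sub (hx ξ t)).sub (hy ξ h t)).congr_deriv ?_
      rw [map_sub, map_sub]; abel
    · intro t
      have e : T (x (ξ + h) t) - T (x ξ t) - g ξ t (y ξ h t) =
          fderiv ℝ T (x ξ t) (x (ξ + h) t - x ξ t - y ξ h t) +
          (T (x (ξ + h) t) - T (x ξ t) - fderiv ℝ T (x ξ t) (x (ξ + h) t - x ξ t)) := by
        simp only [g, map_sub]; abel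
      rw [e]
      refine (norm_add_le _ _).trans (add_le_add
        ((fderiv ℝ T (x ξ t)).le_of_opNorm_le (hDκ _) _)
        ((norm_sub_sub_fderiv_le hTd hM _ _).trans ?_))
      rcases eq_or_ne h 0 with rfl | hh
      · simp
      have hM1 : 0 ≤ M := nonneg_of_mul_nonneg_left hM0 (norm_pos_iff.2 hh)
      rw [mul_assoc M, ← e2, ← mul_pow]
      gcongr
      exact hd t
    · intro t
      calc _ ≤ 2 * K * ‖σ.Pc‖ * ‖h‖ * Real.exp (2 * σ.rate * |t|) +
            2 * K * ‖σ.Pc h‖ * Real.exp (2 * σ.rate * |t|) :=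
            (norm_sub_le _ _).trans (add_le_add (hd t) (hyb ξ h t))
        _ = (2 * K * ‖σ.Pc‖ * ‖h‖ + 2 * K * ‖σ.Pc h‖) * Real.exp (2 * σ.rate * |t|) := by ring
        _ ≤ _ := mul_le_mul_of_nonneg_left (e3 t) (by positivity)
  obtain ⟨hχ, hχD⟩ := contDiff_one_of_quadratic_remainder (f := fun ξ => x ξ 0) hquad
  have hχP : ∀ ξ, x (σ.Pc ξ) = x ξ := fun ξ =>
    hxu ξ _ _ (hx _) (hxb _) (by rw [hx0, σ.cc])
  have hx00 : x 0 = fun _ => 0 := by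
    refine (hxu 0 (fun _ => 0) 0 (fun t => ?_) (fun t => by simp) (by simp)).symm
    simpa [hT0] using hasDerivAt_const t (0 : E)
  refine ⟨fun ξ => x ξ 0, hχ, congrFun hx00 0, hx0, fun ξ => congrFun (hχP ξ) 0, ?_, fun ξ => ?_⟩
  · rw [(hχD 0).fderiv]
    ext h
    rw [hDy, ← hyu 0 h (fun t => expFlow L t (σ.Pc h)) (K * ‖h‖)]
    · simp
    · intro t
      refine (hasDerivAt_expFlow_apply L _ t).congr_deriv ?_
      simp [g, hx00, hDT0]
    · intro t
      refine (hK.norm_expFlow_le t h).trans ?_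
      rw [mul_right_comm]
      gcongr
      linarith
    · simp [σ.cc]
  · have hinv : ∀ t, x (x ξ t) 0 = x ξ t := by
      intro t
      have := hxu (x ξ t) (fun s => x ξ (s + t))
        (2 * K * ‖σ.Pc ξ‖ * Real.exp (2 * σ.rate * |t|)) ?_ ?_ ?_
      · simpa using (congrFun this 0).symm
      · intro s
        exact (hx ξ (s + t)).comp_add_const s t
      · intro s
        refine (hxb ξ _).trans ?_
        rw [mul_assoc _ (Real.exp _), ← Real.exp_add, ← mul_add]
        gcongr
        rw [add_comm]
        exact abs_add_le t s
      · simp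
    -- The derivative at a point depends only on its center projection, which `ξ` and `x ξ 0` share.
    -- So invariance, found at the image point, can be stated at `ξ`.
    have hDD : fderiv ℝ (fun ξ => x ξ 0) (x ξ 0) = fderiv ℝ (fun ξ => x ξ 0) ξ := by
      have h1 : ∀ z, D z = (D (σ.Pc z)).comp σ.Pc := by
        intro z
        have h2 : HasFDerivAt (fun ξ => x ξ 0) ((D (σ.Pc z)).comp σ.Pc) z := by
          have := (hχD (σ.Pc z)).comp z σ.Pc.hasFDerivAt
          refine this.congr_of_eventuallyEq (Eventually.of_forall fun w => ?_)
          simp [hχP]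
        exact (hχD z).unique h2
      rw [(hχD _).fderiv, (hχD _).fderiv, h1 (x ξ 0), h1 ξ, hx0]
    rw [← hDD]
    have h1 := ((hχD (x ξ 0)).comp_hasDerivAt 0 (hx ξ 0))
    have h2 : HasDerivAt (fun t => x ξ t) (D (x ξ 0) (L (x ξ 0) + T (x ξ 0))) 0 :=
      h1.congr_of_eventuallyEq (Eventually.of_forall fun t => (hinv t).symm)
    rw [(hχD _).fderiv]
    exact h2.unique (hx ξ 0)

end SpectralSplitting.IsSolvabilityConst

/-- Multiply by a bump of radius `2ρ`. Its gradient is of size `B/ρ`, but `‖R‖ ≤ 2ρε` there, so the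
derivative of the product is at most `ε (1 + 2B) = κ`, whatever `ρ` is. -/
lemma exists_cutoff {R : E → E} (hR : ContDiff ℝ 2 R) (hR0 : R 0 = 0) (hD : fderiv ℝ R 0 = 0)
    {κ : ℝ} (hκ : 0 < κ) : ∃ T : E → E, ContDiff ℝ 2 T ∧ T =ᶠ[𝓝 0] R ∧
      (∀ x y, ‖T x - T y‖ ≤ κ * ‖x - y‖) ∧
      ∃ M, ∀ x y, ‖fderiv ℝ T x - fderiv ℝ T y‖ ≤ M * ‖x - y‖ := by
  let b : ContDiffBump (0 : E) := ⟨1, 2, by norm_num, by norm_num⟩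
  have hbc : ContDiff ℝ 2 b := b.contDiff
  obtain ⟨B, hB⟩ := hbc.lipschitzWith_of_hasCompactSupport b.hasCompactSupport (by norm_num)
  have hBf : ∀ x, ‖fderiv ℝ b x‖ ≤ B := fun x => norm_fderiv_le_of_lipschitz ℝ hB
  set ε := κ / (1 + 2 * B) with hε
  have hε0 : 0 < ε := by positivity
  have hev : ∀ᶠ x in 𝓝 (0 : E), ‖fderiv ℝ R x‖ < ε := by
    have : ContinuousAt (fun x => ‖fderiv ℝ R x‖) 0 :=
      (hR.continuous_fderiv (by norm_num)).norm.continuousAt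
    refine this.eventually_lt_const ?_
    simpa [hD] using hε0
  obtain ⟨r, hr0, hr⟩ := Metric.eventually_nhds_iff_ball.1 hev
  set ρ := r / 3 with hρ
  have hρ0 : 0 < ρ := by positivity
  have hRd : Differentiable ℝ R := hR.differentiable (by norm_num)
  have hRle : ∀ x, ‖x‖ ≤ 2 * ρ → ‖R x‖ ≤ ε * ‖x‖ := by
    intro x hx
    have := (convex_ball (0 : E) r).norm_image_sub_le_of_norm_fderiv_le (𝕜 := ℝ) (f := R) (C := ε)
      (x := 0) (y := x) (fun z _ => hRd z) (fun z hz => (hr z hz).le) (by simpa using hr0)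
      (by rw [mem_ball_zero_iff]; linarith)
    simpa [hR0] using this
  let c : E → ℝ := fun x => b (ρ⁻¹ • x)
  have hc : ContDiff ℝ 2 c := hbc.comp (contDiff_const_smul _)
  have hcd : ∀ x, ‖fderiv ℝ c x‖ ≤ B * ρ⁻¹ := by
    intro x
    have hl : LipschitzWith (B * ‖ρ⁻¹‖₊) c := hB.comp (lipschitzWith_smul _)
    have := norm_fderiv_le_of_lipschitz (𝕜 := ℝ) (x₀ := x) hl
    refine this.trans_eq ?_
    rw [NNReal.coe_mul, coe_nnnorm, Real.norm_eq_abs, abs_of_pos (inv_pos.2 hρ0)]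
  have hc1 : ∀ x, |c x| ≤ 1 := fun x => by
    rw [abs_of_nonneg b.nonneg]; exact b.le_one
  have hcz : ∀ x, 2 * ρ ≤ ‖x‖ → c x = 0 := by
    intro x hx
    refine b.zero_of_le_dist ?_
    rw [dist_zero_right, norm_smul, Real.norm_eq_abs, abs_of_pos (inv_pos.2 hρ0)]
    change 2 ≤ ρ⁻¹ * ‖x‖
    rw [inv_mul_eq_div, le_div_iff₀ hρ0]
    exact hx
  have hT : ContDiff ℝ 2 fun x => c x • R x := hc.smul hR
  have hsupp : HasCompactSupport fun x => c x • R x := by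
    refine HasCompactSupport.intro (isCompact_closedBall (0 : E) (2 * ρ)) fun x hx => ?_
    rw [mem_closedBall_zero_iff, not_le] at hx
    simp [hcz x hx.le]
  have hTκ : ∀ x, ‖fderiv ℝ (fun x => c x • R x) x‖ ≤ κ := by
    intro x
    rcases le_or_gt ‖x‖ (2 * ρ) with hx | hx
    · have hR1 := hRle x hx
      have hR2 : ‖fderiv ℝ R x‖ ≤ ε := (hr x (by rw [mem_ball_zero_iff]; linarith)).le
      rw [fderiv_fun_smul ((hc.differentiable (by norm_num)) x) (hRd x)]
      calc _ ≤ |c x| * ‖fderiv ℝ R x‖ + ‖fderiv ℝ c x‖ * ‖R x‖ := by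
            refine (norm_add_le _ _).trans (add_le_add (norm_smul_le _ _) ?_)
            exact (ContinuousLinearMap.norm_smulRight_apply _ _).le
        _ ≤ 1 * ε + B * ρ⁻¹ * (ε * (2 * ρ)) := by
            have hB0 : (0 : ℝ) ≤ B := B.2
            gcongr
            · exact hc1 x
            · exact hcd x
            · exact hR1.trans (by gcongr)
        _ = ε * (1 + 2 * B) := by field_simp
        _ = κ := by rw [hε]; field_simp
    · have : (fun x => c x • R x) =ᶠ[𝓝 x] fun _ => 0 := by
        filter_upwards [(isOpen_lt continuous_const continuous_norm).mem_nhds hx] with z hz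
        rw [hcz z (le_of_lt hz), zero_smul]
      rw [this.fderiv_eq]
      simpa using hκ.le
  refine ⟨fun x => c x • R x, hT, ?_, fun x y => ?_, ?_⟩
  · filter_upwards [Metric.ball_mem_nhds (0 : E) hρ0] with x hx
    rw [mem_ball_zero_iff] at hx
    have : c x = 1 := by
      refine b.one_of_mem_closedBall ?_
      rw [mem_closedBall_zero_iff, norm_smul, Real.norm_eq_abs, abs_of_pos (inv_pos.2 hρ0)]
      change ρ⁻¹ * ‖x‖ ≤ 1
      rw [inv_mul_eq_div, div_le_one hρ0]
      exact hx.le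
    rw [this, one_smul]
  · exact convex_univ.norm_image_sub_le_of_norm_fderiv_le (𝕜 := ℝ)
      (fun z _ => (hT.differentiable (by norm_num)) z) (fun z _ => hTκ z) (mem_univ y) (mem_univ x)
  · obtain ⟨M, hM⟩ := (hT.fderiv_right (m := 1) (by norm_num)).lipschitzWith_of_hasCompactSupport
      (hsupp.fderiv ℝ) (by norm_num)
    refine ⟨M, fun x y => ?_⟩
    rw [← dist_eq_norm, ← dist_eq_norm]
    exact hM.dist_le_mul x y

/-- The center manifold of `x' = F x` near an equilibrium, as the local image of a retraction. -/
theorem SpectralSplitting.exists_center_retraction {F : E → E} (hF : ContDiff ℝ 2 F)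
    (hF0 : F 0 = 0) (σ : SpectralSplitting (fderiv ℝ F 0)) :
    ∃ χ : E → E, ContDiff ℝ 1 χ ∧ χ 0 = 0 ∧ (∀ x, σ.Pc (χ x) = σ.Pc x) ∧
      (∀ x, χ (σ.Pc x) = χ x) ∧ fderiv ℝ χ 0 = σ.Pc ∧
      ∀ᶠ x in 𝓝 0, fderiv ℝ χ x (F (χ x)) = F (χ x) := by
  obtain ⟨K, hK⟩ := σ.exists_isSolvabilityConst
  have hK0 := hK.pos
  set L := fderiv ℝ F 0 with hL
  have hRd : fderiv ℝ (fun x => F x - L x) 0 = 0 := by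
    rw [fderiv_fun_sub (hF.differentiable (by norm_num) 0) L.differentiableAt, L.fderiv, ← hL,
      sub_self]
  obtain ⟨T, hT, hTR, hlip, M, hM⟩ := exists_cutoff (R := fun x => F x - L x)
    (hF.sub L.contDiff) (by simp [hF0]) hRd (κ := 1 / (2 * K)) (by positivity)
  obtain ⟨χ, h1, h2, h3, h4, h5, h6⟩ := hK.exists_global_retraction (κ := 1 / (2 * K))
    (by positivity) (by field_simp; rfl) (hT.of_le (by norm_num))
    (by rw [hTR.eq_of_nhds]; simp [hF0]) (by rw [hTR.fderiv_eq, hRd]) hlip hM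
  refine ⟨χ, h1, h2, h3, h4, h5, ?_⟩
  have : Tendsto χ (𝓝 0) (𝓝 0) := by
    have := h1.continuous.tendsto 0
    rwa [h2] at this
  filter_upwards [this.eventually hTR] with x hx
  have e : L (χ x) + T (χ x) = F (χ x) := by rw [hx]; abel
  rw [← e]
  exact h6 x

end CenterRetraction

/-! ### Quadratic Lyapunov forms for the hyperbolic directions. -/

section Lyapunov

open MeasureTheory

variable {E : Type*} [NormedAddCommGroup E] [InnerProductSpace ℝ E] [FiniteDimensional ℝ E]

/-- Take `S = ∫ (exp(tL) P)* (exp(tL) P) dt` over `t > 0`. The integrand has derivative `L* f + f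
L`, so integration gives `L* S + S L = -P* P`. -/
lemma exists_lyapunov_of_decay {L P : E →L[ℝ] E} (hP : Commute P L) {b C : ℝ} (hb : 0 < b)
    (hC0 : 0 ≤ C)
    (hC : ∀ t, 0 ≤ t → ∀ x, ‖expFlow L t (P x)‖ ≤ C * Real.exp (-b * t) * ‖x‖) :
    ∃ S : E →L[ℝ] E, ∀ w, inner ℝ (S (L w)) w + inner ℝ (S w) (L w) = -‖P w‖ ^ 2 := by
  set Y : ℝ → E →L[ℝ] E := fun t => expFlow L t * P with hY
  set f : ℝ → E →L[ℝ] E := fun t => star (Y t) * Y t with hf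
  have hYd : ∀ t, HasDerivAt Y (Y t * L) t := by
    intro t
    refine ((hasDerivAt_expFlow' L t).mul_const P).congr_deriv ?_
    simp only [hY]
    rw [mul_assoc, mul_assoc, hP.eq]
  have hfd : ∀ t, HasDerivAt f (star L * f t + f t * L) t := by
    intro t
    refine ((hYd t).star.mul (hYd t)).congr_deriv ?_
    simp only [hf, star_mul, mul_assoc]
  have hfc : Continuous f := continuous_iff_continuousAt.2 fun t => (hfd t).continuousAt
  have hfb : ∀ t, 0 ≤ t → ‖f t‖ ≤ C ^ 2 * Real.exp (-(2 * b) * t) := by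
    intro t ht
    have h1 : ‖Y t‖ ≤ C * Real.exp (-b * t) :=
      ContinuousLinearMap.opNorm_le_bound _ (by positivity) (hC t ht)
    calc ‖f t‖ ≤ ‖star (Y t)‖ * ‖Y t‖ := norm_mul_le _ _
      _ = ‖Y t‖ * ‖Y t‖ := by
          rw [ContinuousLinearMap.star_eq_adjoint, LinearIsometryEquiv.norm_map]
      _ ≤ (C * Real.exp (-b * t)) * (C * Real.exp (-b * t)) := by gcongr
      _ = C ^ 2 * (Real.exp (-b * t) * Real.exp (-b * t)) := by ring
      _ = _ := by rw [← Real.exp_add]; ring_nf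
  have hint : IntegrableOn f (Ioi 0) := by
    refine Integrable.mono' ((integrableOn_exp_mul_Ioi (a := -(2 * b)) (by linarith) 0).const_mul
      (C ^ 2)) hfc.aestronglyMeasurable ?_
    exact (ae_restrict_iff' measurableSet_Ioi).2 (ae_of_all _ fun t ht => hfb t (le_of_lt ht))
  have hlim : Tendsto f atTop (𝓝 0) := by
    refine squeeze_zero_norm' ((eventually_ge_atTop 0).mono hfb) ?_
    have : Tendsto (fun t : ℝ => C ^ 2 * Real.exp (-(2 * b) * t)) atTop (𝓝 (C ^ 2 * 0)) :=
      Tendsto.const_mul _ (Real.tendsto_exp_atBot.comp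
        (tendsto_id.const_mul_atTop_of_neg (by linarith)))
    simpa using this
  have hI := integral_Ioi_of_hasDerivAt_of_tendsto (a := 0) hfc.continuousWithinAt
    (fun t _ => hfd t) ((hint.const_mul _).add (hint.mul_const _)) hlim
  rw [integral_add (hint.const_mul _) (hint.mul_const _), integral_const_mul_of_integrable hint,
    integral_mul_const_of_integrable hint] at hI
  have hf0 : f 0 = star P * P := by simp [hf, hY]
  rw [zero_sub, hf0] at hI
  generalize (∫ t in Ioi 0, f t) = S at hI
  refine ⟨S, fun w => ?_⟩
  have h1 : L.adjoint (S w) + S (L w) = -(P.adjoint (P w)) :=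
    congrArg (fun A : E →L[ℝ] E => A w) hI
  rw [← ContinuousLinearMap.adjoint_inner_left, ← inner_add_left, add_comm, h1, inner_neg_left,
    ContinuousLinearMap.adjoint_inner_left, real_inner_self_eq_norm_sq]

namespace SpectralSplitting

variable {L : E →L[ℝ] E}

/-- An indefinite quadratic form that increases along `exp (t L)` on the hyperbolic directions. -/
lemma exists_lyapunov (σ : SpectralSplitting L) : ∃ S : E →L[ℝ] E, ∀ w, σ.Pc w = 0 →
    ‖w‖ ^ 2 ≤ inner ℝ (S (L w)) w + inner ℝ (S w) (L w) := by
  have hβ := σ.rate_pos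
  obtain ⟨S1, h1⟩ := exists_lyapunov_of_decay σ.comm_s (by linarith) σ.const_pos.le σ.bound_s
  obtain ⟨S2, h2⟩ := exists_lyapunov_of_decay σ.comm_u.neg_right (by linarith) σ.const_pos.le
    σ.bound_u
  -- The form for `-L` enters with a plus sign, the one for `L` with a minus sign. The factor 2 pays
  -- for `‖w‖² ≤ 2 (‖Ps w‖² + ‖Pu w‖²)`.
  refine ⟨(2 : ℝ) • (S2 - S1), fun w hw => ?_⟩
  have e : ((2 : ℝ) • (S2 - S1)) (L w) = (2 : ℝ) • S2 (L w) - (2 : ℝ) • S1 (L w) := by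
    simp; module
  have e' : ((2 : ℝ) • (S2 - S1)) w = (2 : ℝ) • S2 w - (2 : ℝ) • S1 w := by
    simp; module
  have a1 := h1 w
  have a2 := h2 w
  simp only [neg_apply, map_neg, inner_neg_left, inner_neg_right] at a2
  rw [e, e']
  simp only [inner_sub_left, real_inner_smul_left]
  have a3 : ‖w‖ ^ 2 ≤ 2 * (‖σ.Ps w‖ ^ 2 + ‖σ.Pu w‖ ^ 2) := by
    have h := σ.add_eq w
    rw [hw, zero_add] at h
    have h3 : ‖w‖ ≤ ‖σ.Ps w‖ + ‖σ.Pu w‖ := by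
      conv_lhs => rw [← h]
      exact norm_add_le _ _
    calc ‖w‖ ^ 2 ≤ (‖σ.Ps w‖ + ‖σ.Pu w‖) ^ 2 := by gcongr
      _ ≤ _ := add_sq_le
  linarith

/-- The Lyapunov form shows that `L` is injective on the hyperbolic subspace `ker Pc`. By finite
dimension it is surjective there, so `ker Pc` lies in the range of `L`. -/
lemma apply_eq_zero_of_comp_eq_zero (σ : SpectralSplitting L) {A : E →L[ℝ] ℝ}
    (hA : ∀ x, A (L x) = 0) {x : E} (hx : σ.Pc x = 0) : A x = 0 := by
  obtain ⟨S, hS⟩ := σ.exists_lyapunov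
  have hmaps : ∀ y ∈ LinearMap.ker σ.Pc.toLinearMap, L.toLinearMap y ∈
      LinearMap.ker σ.Pc.toLinearMap := by
    intro y hy
    have : σ.Pc (L y) = L (σ.Pc y) := congrArg (fun A : E →L[ℝ] E => A y) σ.comm_c.eq
    have hy' : σ.Pc y = 0 := hy
    change σ.Pc (L y) = 0
    rw [this, hy', map_zero]
  have hinj : Function.Injective (L.toLinearMap.restrict hmaps) := by
    rw [← LinearMap.ker_eq_bot, LinearMap.ker_eq_bot']
    intro y hy
    have h0 : L (y : E) = 0 := congrArg Subtype.val hy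
    have := hS y y.2
    rw [h0, map_zero, inner_zero_left, inner_zero_right, add_zero] at this
    have h1 : ‖(y : E)‖ = 0 := by nlinarith [norm_nonneg (y : E)]
    exact Subtype.ext (norm_eq_zero.1 h1)
  obtain ⟨y, hy⟩ := LinearMap.injective_iff_surjective.1 hinj ⟨x, hx⟩
  have : L (y : E) = x := congrArg Subtype.val hy
  rw [← this, hA]

end SpectralSplitting

end Lyapunov

/-! ### Quotients by a defining function, and nearby zeros along a line. -/

section Geometry

variable {E : Type*} [NormedAddCommGroup E] [InnerProductSpace ℝ E] [FiniteDimensional ℝ E]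

/-- Along a direction `v` transversal to `{ζ = 0}`, the difference quotient of `H` is `H/ζ` times
that of `ζ`, hence tends to 0. A tangent direction is a difference of two transversal ones. -/
lemma fderiv_eq_zero_of_tendsto_div {H ζ : E → ℝ} {p : E} (hH : DifferentiableAt ℝ H p)
    (hζ : DifferentiableAt ℝ ζ p) (hH0 : H p = 0) (hζ0 : ζ p = 0) (hne : fderiv ℝ ζ p ≠ 0)
    (hlim : Tendsto (fun x => H x / ζ x) (𝓝[{x | ζ x ≠ 0}] p) (𝓝 0)) : fderiv ℝ H p = 0 := by
  have key : ∀ v, fderiv ℝ ζ p v ≠ 0 → fderiv ℝ H p v = 0 := by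
    intro v hv
    have hline : HasDerivAt (fun s : ℝ => p + s • v) v 0 := by
      simpa using ((hasDerivAt_id (0 : ℝ)).smul_const v).const_add p
    have hp : p + (0 : ℝ) • v = p := by simp
    have d1 : HasDerivAt (fun s : ℝ => ζ (p + s • v)) (fderiv ℝ ζ p v) 0 := by
      refine HasFDerivAt.comp_hasDerivAt (0 : ℝ) ?_ hline
      rw [hp]; exact hζ.hasFDerivAt
    have d2 : HasDerivAt (fun s : ℝ => H (p + s • v)) (fderiv ℝ H p v) 0 := by
      refine HasFDerivAt.comp_hasDerivAt (0 : ℝ) ?_ hline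
      rw [hp]; exact hH.hasFDerivAt
    have hev : ∀ᶠ s in 𝓝[≠] (0 : ℝ), ζ (p + s • v) ≠ 0 := d1.eventually_ne hv
    rw [hasDerivAt_iff_tendsto_slope] at d1 d2
    have hcurve : Tendsto (fun s : ℝ => p + s • v) (𝓝[≠] 0) (𝓝[{x | ζ x ≠ 0}] p) := by
      rw [tendsto_nhdsWithin_iff]
      refine ⟨?_, hev⟩
      have := hline.continuousAt.tendsto
      rw [hp] at this
      exact this.mono_left nhdsWithin_le_nhds
    have h3 := (hlim.comp hcurve).mul d1
    rw [zero_mul] at h3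
    refine tendsto_nhds_unique d2 (h3.congr' ?_)
    filter_upwards [hev] with s hs
    simp only [Function.comp_apply, slope_def_field, hp, hζ0, hH0, sub_zero]
    field_simp
  obtain ⟨e, he⟩ : ∃ e, fderiv ℝ ζ p e ≠ 0 := by
    by_contra! h
    exact hne (ContinuousLinearMap.ext h)
  ext v
  by_cases hv : fderiv ℝ ζ p v = 0
  · have h1 : fderiv ℝ H p (v + e) = 0 := key _ (by rw [map_add, hv, zero_add]; exact he)
    rw [map_add, key e he, add_zero] at h1
    exact h1
  · exact key v hv

/-- Strict differentiability gives `f (x - s e) = f x - s` up to `|s|/2`. So `f` has opposite weak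
signs at `s = ±2 |f x|`, and the intermediate value theorem applies. -/
lemma eventually_exists_zero_on_line {f : E → ℝ} {f' : E →L[ℝ] ℝ} (hf : Continuous f)
    (hd : HasStrictFDerivAt f f' 0) (h0 : f 0 = 0) {e : E} (he : f' e = 1) :
    ∀ᶠ x in 𝓝 (0 : E), ∃ s : ℝ, |s| ≤ 2 * |f x| ∧ f (x - s • e) = 0 := by
  have hc : 0 < 1 / (2 * (‖e‖ + 1)) := by positivity
  have h1 := hd.isLittleO.bound hc
  rw [nhds_prod_eq, Metric.nhds_basis_ball.prod_self.eventually_iff] at h1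
  obtain ⟨r, hr, hr'⟩ := h1
  have hcont : Tendsto (fun x : E => ‖x‖ + 2 * |f x| * ‖e‖) (𝓝 0) (𝓝 0) := by
    have : Continuous fun x : E => ‖x‖ + 2 * |f x| * ‖e‖ := by fun_prop
    simpa [h0] using this.tendsto 0
  filter_upwards [hcont.eventually_lt_const hr] with x hx
  have est : ∀ s : ℝ, |s| ≤ 2 * |f x| → |f (x - s • e) - f x + s| ≤ |s| / 2 := by
    intro s hs
    have hx1 : x ∈ Metric.ball (0 : E) r := by
      rw [mem_ball_zero_iff]
      have : 0 ≤ 2 * |f x| * ‖e‖ := by positivity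
      linarith
    have hx2 : x - s • e ∈ Metric.ball (0 : E) r := by
      rw [mem_ball_zero_iff]
      refine lt_of_le_of_lt ((norm_sub_le _ _).trans ?_) hx
      rw [norm_smul, Real.norm_eq_abs]
      gcongr
    have := hr' (Set.mk_mem_prod hx2 hx1)
    simp only [sub_sub_cancel_left, map_neg, map_smul, he, smul_eq_mul, mul_one, norm_neg,
      norm_smul, Real.norm_eq_abs, sub_neg_eq_add] at this
    refine this.trans ?_
    have h3 : ‖e‖ / (‖e‖ + 1) ≤ 1 := by
      rw [div_le_one (by positivity)]; linarith
    calc _ = |s| / 2 * (‖e‖ / (‖e‖ + 1)) := by field_simp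
      _ ≤ |s| / 2 * 1 := by gcongr
      _ = _ := mul_one _
  have hm : 0 ≤ 2 * |f x| := by positivity
  have hcs : ContinuousOn (fun s : ℝ => f (x - s • e)) (Icc (-(2 * |f x|)) (2 * |f x|)) := by
    fun_prop
  have b1 := est (2 * |f x|) (by rw [abs_of_nonneg hm])
  have b2 := est (-(2 * |f x|)) (by rw [abs_neg, abs_of_nonneg hm])
  rw [abs_of_nonneg hm] at b1
  rw [abs_neg, abs_of_nonneg hm] at b2
  have c1 := (abs_le.1 b1).2
  have c2 := (abs_le.1 b2).1
  have a1 := le_abs_self (f x)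
  have a2 := neg_abs_le (f x)
  have := intermediate_value_Icc' (by linarith) hcs
    (show (0 : ℝ) ∈ Icc _ _ from ⟨by linarith, by linarith⟩)
  obtain ⟨s, hs, hs0⟩ := this
  exact ⟨s, abs_le.2 hs, hs0⟩

lemma eventually_forall_on_line {f : E → ℝ} (hf : Continuous f) (h0 : f 0 = 0) (e : E)
    {Q : E → Prop} (hQ : ∀ᶠ y in 𝓝 (0 : E), Q y) :
    ∀ᶠ x in 𝓝 (0 : E), ∀ s : ℝ, |s| ≤ 2 * |f x| → Q (x - s • e) := by
  obtain ⟨r, hr, hr'⟩ := Metric.eventually_nhds_iff_ball.1 hQ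
  have hcont : Tendsto (fun x : E => ‖x‖ + 2 * |f x| * ‖e‖) (𝓝 0) (𝓝 0) := by
    have : Continuous fun x : E => ‖x‖ + 2 * |f x| * ‖e‖ := by fun_prop
    simpa [h0] using this.tendsto 0
  filter_upwards [hcont.eventually_lt_const hr] with x hx s hs
  refine hr' _ ?_
  rw [mem_ball_zero_iff]
  refine lt_of_le_of_lt ((norm_sub_le _ _).trans ?_) hx
  rw [norm_smul, Real.norm_eq_abs]
  gcongr

end Geometry

/-! ### Estimates near the origin for the defect and for `∇ζ · F`. -/

section LocalEstimates

variable {E : Type*} [NormedAddCommGroup E] [InnerProductSpace ℝ E] [FiniteDimensional ℝ E]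

/-- `χ` is a `C¹` retraction onto a center manifold of `x' = F x` near `0` that factors through
the center projection `P`. -/
structure IsCenterRetraction (F : E → E) (P : E →L[ℝ] E) (χ : E → E) : Prop where
  contDiff : ContDiff ℝ 1 χ
  map_zero : χ 0 = 0
  proj_apply : ∀ x, P (χ x) = P x
  apply_proj : ∀ x, χ (P x) = χ x
  fderiv_zero : fderiv ℝ χ 0 = P
  invariant : ∀ᶠ x in 𝓝 0, fderiv ℝ χ x (F (χ x)) = F (χ x)

namespace IsCenterRetraction

variable {F : E → E} {P : E →L[ℝ] E} {χ : E → E}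

lemma idem (hχ : IsCenterRetraction F P χ) (x : E) : χ (χ x) = χ x := by
  rw [← hχ.apply_proj (χ x), hχ.proj_apply, hχ.apply_proj]

lemma differentiable (hχ : IsCenterRetraction F P χ) : Differentiable ℝ χ :=
  hχ.contDiff.differentiable (by norm_num)

lemma fderiv_eq_comp (hχ : IsCenterRetraction F P χ) (x : E) :
    fderiv ℝ χ x = (fderiv ℝ χ (P x)).comp P := by
  have h : χ = χ ∘ P := funext fun x => (hχ.apply_proj x).symm
  conv_lhs => rw [h]
  rw [fderiv_comp _ (hχ.differentiable _) P.differentiableAt, P.fderiv]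

lemma fderiv_apply_eq_zero (hχ : IsCenterRetraction F P χ) (x : E) {v : E} (hv : P v = 0) :
    fderiv ℝ χ x v = 0 := by
  rw [hχ.fderiv_eq_comp, ContinuousLinearMap.comp_apply, hv, _root_.map_zero]

lemma proj_fderiv (hχ : IsCenterRetraction F P χ) (x v : E) : P (fderiv ℝ χ x v) = P v := by
  have h : P ∘ χ = P := funext hχ.proj_apply
  have h1 : fderiv ℝ (P ∘ χ) x = P := by rw [h, P.fderiv]
  rw [fderiv_comp _ P.differentiableAt (hχ.differentiable x), P.fderiv] at h1
  exact congrArg (fun A : E →L[ℝ] E => A v) h1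

lemma fderiv_id_sub (hχ : IsCenterRetraction F P χ) (x v : E) :
    fderiv ℝ (fun x => x - χ x) x v = v - fderiv ℝ χ x v := by
  rw [fderiv_fun_sub differentiableAt_fun_id (hχ.differentiable x), fderiv_fun_id]
  rfl

lemma proj_sub (hχ : IsCenterRetraction F P χ) (x : E) : P (x - χ x) = 0 := by
  rw [map_sub, hχ.proj_apply, sub_self]

lemma tendsto (hχ : IsCenterRetraction F P χ) : Tendsto χ (𝓝 0) (𝓝 0) := by
  have := hχ.contDiff.continuous.tendsto 0
  rwa [hχ.map_zero] at this

/-- Along `x' = F x`, the distance to the center manifold follows the linearised equation up to a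
small relative error. -/
lemma eventually_norm_transport_sub_le (hχ : IsCenterRetraction F P χ) (hF : ContDiff ℝ 1 F)
    (hcomm : Commute P (fderiv ℝ F 0)) {κ : ℝ} (hκ : 0 < κ) :
    ∀ᶠ x in 𝓝 (0 : E), ‖fderiv ℝ (fun x => x - χ x) x (F x) - fderiv ℝ F 0 (x - χ x)‖ ≤
      κ * ‖x - χ x‖ := by
  set L := fderiv ℝ F 0
  have hc : 0 < κ / (‖P‖ + 2) := by positivity
  have hd : HasStrictFDerivAt F L 0 := hF.contDiffAt.hasStrictFDerivAt (by norm_num)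
  have h1 := hd.isLittleO.bound hc
  have h2 : Tendsto (fun x => (x, χ x)) (𝓝 0) (𝓝 ((0 : E), (0 : E))) :=
    tendsto_id.prodMk_nhds hχ.tendsto
  have h3 : ∀ᶠ x in 𝓝 (0 : E), ‖fderiv ℝ χ x‖ < ‖P‖ + 1 := by
    have : ContinuousAt (fun x => ‖fderiv ℝ χ x‖) 0 :=
      (hχ.contDiff.continuous_fderiv (by norm_num)).norm.continuousAt
    refine this.eventually_lt_const ?_
    simp only [hχ.fderiv_zero]; linarith
  filter_upwards [h2.eventually h1, h3, hχ.invariant] with x hx1 hx3 hinv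
  set w := x - χ x with hw
  set ρ := F x - F (χ x) - L w with hρ
  have hLw : fderiv ℝ χ x (L w) = 0 := by
    refine hχ.fderiv_apply_eq_zero x ?_
    have : P (L w) = L (P w) := congrArg (fun A : E →L[ℝ] E => A w) hcomm.eq
    rw [this, hχ.proj_sub, _root_.map_zero]
  -- Invariance makes `F (χ x)` a fixed vector of `Dχ(x)`, so it drops out, and `Dχ(x)` kills `L w`
  -- because it factors through `P`. Only the remainder `ρ` survives.
  have e : fderiv ℝ (fun x => x - χ x) x (F x) - L w = ρ - fderiv ℝ χ x ρ := by
    rw [hχ.fderiv_id_sub, hρ, map_sub _ (F x - F (χ x)) (L w), hLw, map_sub (fderiv ℝ χ x) (F x) (F (χ x)), hinv]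
    abel
  rw [e]
  have hρle : ‖ρ‖ ≤ κ / (‖P‖ + 2) * ‖w‖ := hx1
  calc ‖ρ - fderiv ℝ χ x ρ‖ ≤ ‖ρ‖ + (‖P‖ + 1) * ‖ρ‖ :=
        (norm_sub_le _ _).trans (add_le_add le_rfl
          ((fderiv ℝ χ x).le_of_opNorm_le hx3.le _))
    _ = (‖P‖ + 2) * ‖ρ‖ := by ring
    _ ≤ (‖P‖ + 2) * (κ / (‖P‖ + 2) * ‖w‖) := by gcongr
    _ = κ * ‖w‖ := by field_simp

end IsCenterRetraction

lemma exists_eventually_norm_sub_le {F : Type*} [NormedAddCommGroup F] [NormedSpace ℝ F] {f : E → F}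
    (hf : ContDiff ℝ 1 f) : ∃ K : ℝ, 0 ≤ K ∧ ∃ r > 0, ∀ x ∈ Metric.ball (0 : E) r,
      ∀ y ∈ Metric.ball (0 : E) r, ‖f x - f y‖ ≤ K * ‖x - y‖ := by
  obtain ⟨K, t, ht, hK⟩ := (hf.contDiffAt (x := 0)).exists_lipschitzOnWith
  obtain ⟨r, hr, hr'⟩ := Metric.mem_nhds_iff.1 ht
  refine ⟨K, K.2, r, hr, fun x hx y hy => ?_⟩
  have := hK.dist_le_mul x (hr' hx) y (hr' hy)
  rwa [dist_eq_norm, dist_eq_norm] at this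

/-- Near `0` one has `|∇ζ · F| ≤ C |ζ| (|ζ| + dist)`, with the distance to the center manifold. -/
lemma exists_eventually_abs_fderiv_le {F : E → E} {ζ : E → ℝ} {χ : E → E}
    (hF : ContDiff ℝ 2 F) (hζ : ContDiff ℝ 3 ζ) (hF0 : F 0 = 0) (hζ0 : ζ 0 = 0)
    (h1 : fderiv ℝ ζ 0 ≠ 0) (σ : SpectralSplitting (fderiv ℝ F 0))
    (hχ : IsCenterRetraction F σ.Pc χ)
    (h2 : ∀ᶠ x in 𝓝 0, χ x = x → ζ x = 0 → F x = 0)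
    (h4 : ∀ᶠ x in 𝓝 0, ζ x = 0 → fderiv ℝ ζ x (F x) = 0)
    (h5 : ∀ᶠ x in 𝓝 0, ζ x = 0 → F x = 0 →
      Tendsto (fun y => fderiv ℝ ζ y (F y) / ζ y) (𝓝[{y | ζ y ≠ 0}] x) (𝓝 0)) :
    ∃ C, 0 ≤ C ∧ ∀ᶠ x in 𝓝 0, |fderiv ℝ ζ x (F x)| ≤ C * |ζ x| * (|ζ x| + ‖x - χ x‖) := by
  set H : E → ℝ := fun x => fderiv ℝ ζ x (F x) with hH
  have hζ' : ContDiff ℝ 2 (fderiv ℝ ζ) := hζ.fderiv_right (by norm_num)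
  have hHc : ContDiff ℝ 2 H := hζ'.clm_apply hF
  have hHd : Differentiable ℝ H := hHc.differentiable (by norm_num)
  have hζd : Differentiable ℝ ζ := hζ.differentiable (by norm_num)
  have hζc : Continuous ζ := hζ.continuous
  have hne : ∀ᶠ x in 𝓝 (0 : E), fderiv ℝ ζ x ≠ 0 :=
    (hζ'.continuous.continuousAt).eventually_ne h1
  -- the derivative of `H` vanishes at the singular equilibria
  have hDH : ∀ᶠ x in 𝓝 (0 : E), ζ x = 0 → F x = 0 → fderiv ℝ H x = 0 := by
    filter_upwards [h5, hne] with x hx5 hxne hxζ hxF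
    refine fderiv_eq_zero_of_tendsto_div (hHd x) (hζd x) ?_ hxζ hxne (hx5 hxζ hxF)
    simp [hH, hxF]
  -- `DH(0) = 0`, and since `F 0 = 0` the product rule leaves only `∇ζ(0) ∘ DF(0)`.
  have hA : ∀ v, fderiv ℝ ζ 0 (fderiv ℝ F 0 v) = 0 := by
    intro v
    have e := hDH.self_of_nhds hζ0 hF0
    have e2 := fderiv_clm_apply (hζ'.differentiable (by norm_num) 0)
      (hF.differentiable (by norm_num) 0)
    have e3 : fderiv ℝ H 0 v = fderiv ℝ ζ 0 (fderiv ℝ F 0 v) := by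
      rw [hH, e2]
      simp [hF0]
    rw [← e3, e]; rfl
  -- By `hA` the functional `∇ζ(0)` vanishes on the hyperbolic directions, so some center direction
  -- is transversal to the singular set. Hence `ζ ∘ χ` is also nondegenerate along `e`.
  obtain ⟨e, hePc, he⟩ : ∃ e, σ.Pc e = e ∧ fderiv ℝ ζ 0 e = 1 := by
    obtain ⟨v, hv⟩ : ∃ v, fderiv ℝ ζ 0 v ≠ 0 := by
      by_contra! h
      exact h1 (ContinuousLinearMap.ext h)
    have h6 : fderiv ℝ ζ 0 (v - σ.Pc v) = 0 :=
      σ.apply_eq_zero_of_comp_eq_zero hA (by rw [map_sub, σ.cc, sub_self])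
    rw [map_sub, sub_eq_zero] at h6
    rw [h6] at hv
    refine ⟨(fderiv ℝ ζ 0 (σ.Pc v))⁻¹ • σ.Pc v, by rw [map_smul, σ.cc], ?_⟩
    rw [map_smul, smul_eq_mul, inv_mul_cancel₀ hv]
  have hζχc : ContDiff ℝ 1 fun x => ζ (χ x) := (hζ.of_le (by norm_num)).comp hχ.contDiff
  have hζχ0 : ζ (χ 0) = 0 := by rw [hχ.map_zero, hζ0]
  have hζχe : fderiv ℝ (fun x => ζ (χ x)) 0 e = 1 := by
    have : fderiv ℝ (fun x => ζ (χ x)) 0 = (fderiv ℝ ζ (χ 0)).comp (fderiv ℝ χ 0) :=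
      fderiv_comp _ (hζd _) (hχ.differentiable _)
    rw [this, hχ.map_zero, hχ.fderiv_zero, ContinuousLinearMap.comp_apply, hePc, he]
  obtain ⟨K1, hK1, r1, hr1, l1⟩ := exists_eventually_norm_sub_le
    (hHc.fderiv_right (m := 1) (by norm_num))
  obtain ⟨K2, hK2, r2, hr2, l2⟩ := exists_eventually_norm_sub_le (hζ.of_le (m := 1) (by norm_num))
  obtain ⟨K3, hK3, r3, hr3, l3⟩ := exists_eventually_norm_sub_le hχ.contDiff
  have z1 := eventually_exists_zero_on_line hζc
    (hζ.contDiffAt.hasStrictFDerivAt (by norm_num)) hζ0 he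
  have z2 := eventually_exists_zero_on_line hζχc.continuous
    (hζχc.contDiffAt.hasStrictFDerivAt (by norm_num)) hζχ0 hζχe
  have q1 := eventually_forall_on_line hζc hζ0 e (h4.and (Metric.ball_mem_nhds (0 : E) hr1))
  have q2 := eventually_forall_on_line hζχc.continuous hζχ0 e
    ((hχ.tendsto.eventually (h2.and (hDH.and (Metric.ball_mem_nhds (0 : E) hr1)))).and
      (Metric.ball_mem_nhds (0 : E) hr3))
  set a := 2 * ‖e‖ with ha
  refine ⟨a * K1 * (a + 1 + K3 * a * (1 + K2)), by positivity, ?_⟩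
  filter_upwards [z1, z2, q1, q2, Metric.ball_mem_nhds (0 : E) hr1,
    Metric.ball_mem_nhds (0 : E) hr2, Metric.ball_mem_nhds (0 : E) hr3,
    hχ.tendsto.eventually (Metric.ball_mem_nhds (0 : E) hr2)]
    with x hz1 hz2 hq1 hq2 hx1 hx2 hx3 hx4
  obtain ⟨s, hs, hsz⟩ := hz1
  obtain ⟨s', hs', hsz'⟩ := hz2
  obtain ⟨hq4, hqr⟩ := hq1 s hs
  obtain ⟨⟨hp2, hpD, hpr⟩, hp3⟩ := hq2 s' hs'
  -- Two reference points: `q` lies on the singular set near `x`, where `H` vanishes. `p` below lies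
  -- on the center manifold and on the singular set, so it is an equilibrium with `DH(p) = 0`.
  set q := x - s • e with hq
  set p := χ (x - s' • e) with hp
  have hDp : fderiv ℝ H p = 0 := hpD hsz' (hp2 (hχ.idem _) hsz')
  have hHq : H q = 0 := hq4 hsz
  have dqx : ‖x - q‖ ≤ a * |ζ x| := by
    rw [hq, sub_sub_cancel, norm_smul, Real.norm_eq_abs]
    calc _ ≤ 2 * |ζ x| * ‖e‖ := by gcongr
      _ = _ := by rw [ha]; ring
  have dζχ : |ζ (χ x)| ≤ |ζ x| + K2 * ‖x - χ x‖ := by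
    have h := l2 x hx2 (χ x) hx4
    rw [Real.norm_eq_abs] at h
    have := abs_sub_abs_le_abs_sub (ζ (χ x)) (ζ x)
    rw [abs_sub_comm] at this
    linarith
  have dxp : ‖x - p‖ ≤ ‖x - χ x‖ + K3 * a * (|ζ x| + K2 * ‖x - χ x‖) := by
    have h := l3 x hx3 (x - s' • e) hp3
    rw [sub_sub_cancel, norm_smul, Real.norm_eq_abs] at h
    calc ‖x - p‖ ≤ ‖x - χ x‖ + ‖χ x - p‖ := by
          have := norm_add_le (x - χ x) (χ x - p)
          rwa [sub_add_sub_cancel] at this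
      _ ≤ ‖x - χ x‖ + K3 * (2 * |ζ (χ x)| * ‖e‖) := by
          gcongr
          exact h.trans (by gcongr)
      _ = ‖x - χ x‖ + K3 * a * |ζ (χ x)| := by rw [ha]; ring
      _ ≤ _ := by gcongr
  set w := ‖x - χ x‖
  have hbound : ∀ y ∈ segment ℝ q x, ‖fderiv ℝ H y‖ ≤
      K1 * ((a + 1 + K3 * a * (1 + K2)) * (|ζ x| + w)) := by
    intro y hy
    have hyr : y ∈ Metric.ball (0 : E) r1 := (convex_ball (0 : E) r1).segment_subset hqr hx1 hy
    have h := l1 y hyr p hpr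
    rw [hDp, sub_zero] at h
    have hyx : ‖y - x‖ ≤ ‖x - q‖ := by
      have := norm_sub_le_of_mem_segment (segment_symm ℝ q x ▸ hy)
      rwa [norm_sub_rev q x] at this
    refine h.trans ?_
    gcongr
    have hw0 : 0 ≤ w := norm_nonneg _
    have hζa := abs_nonneg (ζ x)
    calc ‖y - p‖ ≤ ‖y - x‖ + ‖x - p‖ := by
          have := norm_add_le (y - x) (x - p)
          rwa [sub_add_sub_cancel] at this
      _ ≤ a * |ζ x| + (w + K3 * a * (|ζ x| + K2 * w)) :=
          add_le_add (hyx.trans dqx) dxp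
      _ ≤ a * (|ζ x| + w) + ((|ζ x| + w) + K3 * a * ((|ζ x| + w) + K2 * (|ζ x| + w))) := by
          gcongr <;> linarith
      _ = _ := by ring
  have h := (convex_segment q x).norm_image_sub_le_of_norm_fderiv_le (𝕜 := ℝ) (f := H)
    (fun z _ => hHd z) hbound (left_mem_segment ℝ q x) (right_mem_segment ℝ q x)
  rw [hHq, sub_zero, Real.norm_eq_abs] at h
  refine h.trans ?_
  calc _ ≤ K1 * ((a + 1 + K3 * a * (1 + K2)) * (|ζ x| + w)) * (a * |ζ x|) := by gcongr
    _ = _ := by ring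

/-- Estimates in a ball around `0` for the singular equation `U' = F U / ζ U`, in terms of the
defect `w`, which vanishes on the center manifold. -/
structure LocalEstimates (F : E → E) (ζ : E → ℝ) (w : E → E) (S : E →L[ℝ] E) (C r : ℝ) : Prop where
  zeta : Differentiable ℝ ζ
  defect : Differentiable ℝ w
  nonneg : 0 ≤ C
  zeta_le : ∀ x ∈ Metric.ball (0 : E) r, |ζ x| ≤ 1
  transport : ∀ x ∈ Metric.ball (0 : E) r, ‖fderiv ℝ w x (F x)‖ ≤ C * ‖w x‖
  lyapunov : ∀ x ∈ Metric.ball (0 : E) r, ‖w x‖ ^ 2 / 2 ≤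
    inner ℝ (S (fderiv ℝ w x (F x))) (w x) + inner ℝ (S (w x)) (fderiv ℝ w x (F x))
  rate : ∀ x ∈ Metric.ball (0 : E) r, |fderiv ℝ ζ x (F x)| ≤ C * |ζ x| * (|ζ x| + ‖w x‖)
  slow : ∀ x ∈ Metric.ball (0 : E) r, 4 * ‖S‖ * |fderiv ℝ ζ x (F x)| ≤ |ζ x|

theorem exists_localEstimates {F : E → E} {ζ : E → ℝ} {χ : E → E}
    (hF : ContDiff ℝ 2 F) (hζ : ContDiff ℝ 3 ζ) (hF0 : F 0 = 0) (hζ0 : ζ 0 = 0)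
    (h1 : fderiv ℝ ζ 0 ≠ 0) (σ : SpectralSplitting (fderiv ℝ F 0))
    (hχ : IsCenterRetraction F σ.Pc χ)
    (h2 : ∀ᶠ x in 𝓝 0, χ x = x → ζ x = 0 → F x = 0)
    (h4 : ∀ᶠ x in 𝓝 0, ζ x = 0 → fderiv ℝ ζ x (F x) = 0)
    (h5 : ∀ᶠ x in 𝓝 0, ζ x = 0 → F x = 0 →
      Tendsto (fun y => fderiv ℝ ζ y (F y) / ζ y) (𝓝[{y | ζ y ≠ 0}] x) (𝓝 0)) :
    ∃ S C r, 0 < r ∧ LocalEstimates F ζ (fun x => x - χ x) S C r := by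
  obtain ⟨C, hC, hrate⟩ := exists_eventually_abs_fderiv_le hF hζ hF0 hζ0 h1 σ hχ h2 h4 h5
  obtain ⟨S, hS⟩ := σ.exists_lyapunov
  have hF1 : ContDiff ℝ 1 F := hF.of_le (by norm_num)
  have t1 := hχ.eventually_norm_transport_sub_le hF1 σ.comm_c one_pos
  have t2 := hχ.eventually_norm_transport_sub_le hF1 σ.comm_c
    (κ := 1 / (4 * (‖S‖ + 1))) (by positivity)
  have hsmall : Tendsto (fun x => |ζ x|) (𝓝 0) (𝓝 0) := by
    have := hζ.continuous.abs.tendsto 0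
    simpa [hζ0] using this
  have hsmall' : Tendsto (fun x => 4 * ‖S‖ * (C * (|ζ x| + ‖x - χ x‖))) (𝓝 0) (𝓝 0) := by
    have hc : Continuous fun x => 4 * ‖S‖ * (C * (|ζ x| + ‖x - χ x‖)) := by
      have h6 := hχ.contDiff.continuous
      have h7 := hζ.continuous
      fun_prop
    have := hc.tendsto 0
    simpa [hζ0, hχ.map_zero] using this
  have hev := ((hsmall.eventually_lt_const one_pos).and (t1.and t2)).and
    (hrate.and (hsmall'.eventually_lt_const one_pos))
  obtain ⟨r, hr, hr'⟩ := Metric.eventually_nhds_iff_ball.1 hev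
  refine ⟨S, max C (‖fderiv ℝ F 0‖ + 1), r, hr, ?_⟩
  have hCm : C ≤ max C (‖fderiv ℝ F 0‖ + 1) := le_max_left _ _
  refine
    { zeta := hζ.differentiable (by norm_num)
      defect := differentiable_id.sub hχ.differentiable
      nonneg := hC.trans hCm
      zeta_le := fun x hx => (hr' x hx).1.1.le
      transport := fun x hx => ?_
      lyapunov := fun x hx => ?_
      rate := fun x hx => (hr' x hx).2.1.trans (by gcongr)
      slow := fun x hx => ?_ }
  · have h := (hr' x hx).1.2.1
    rw [one_mul] at h
    set y := fderiv ℝ (fun x => x - χ x) x (F x)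
    set w := x - χ x
    calc ‖y‖ ≤ ‖fderiv ℝ F 0 w‖ + ‖y - fderiv ℝ F 0 w‖ := by
          have := norm_add_le (fderiv ℝ F 0 w) (y - fderiv ℝ F 0 w)
          rwa [add_sub_cancel] at this
      _ ≤ ‖fderiv ℝ F 0‖ * ‖w‖ + ‖w‖ := add_le_add ((fderiv ℝ F 0).le_opNorm w) h
      _ = (‖fderiv ℝ F 0‖ + 1) * ‖w‖ := by ring
      _ ≤ _ := by gcongr; exact le_max_right _ _
  · have h := (hr' x hx).1.2.2
    have hP := hS _ (hχ.proj_sub x)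
    set y := fderiv ℝ (fun x => x - χ x) x (F x)
    set w := x - χ x
    obtain ⟨ρ, hρ⟩ : ∃ ρ, y = fderiv ℝ F 0 w + ρ := ⟨y - fderiv ℝ F 0 w, by abel⟩
    rw [hρ, add_sub_cancel_left] at h
    rw [hρ, map_add, inner_add_left, inner_add_right]
    have b1 : |inner ℝ (S ρ) w| ≤ ‖S‖ * ‖ρ‖ * ‖w‖ :=
      (abs_real_inner_le_norm _ _).trans (by gcongr; exact S.le_opNorm ρ)
    have b2 : |inner ℝ (S w) ρ| ≤ ‖S‖ * ‖w‖ * ‖ρ‖ :=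
      (abs_real_inner_le_norm _ _).trans (by gcongr; exact S.le_opNorm w)
    -- Each of the two cross terms costs at most a quarter of `‖w‖²`, which leaves half of the
    -- Lyapunov gain.
    have b3 : ‖S‖ * ‖ρ‖ * ‖w‖ ≤ ‖w‖ ^ 2 / 4 := by
      calc ‖S‖ * ‖ρ‖ * ‖w‖ ≤ (‖S‖ + 1) * (1 / (4 * (‖S‖ + 1)) * ‖w‖) * ‖w‖ := by
            gcongr; linarith
        _ = _ := by field_simp
    have c1 := (abs_le.1 b1).1
    have c2 := (abs_le.1 b2).1
    have : ‖S‖ * ‖w‖ * ‖ρ‖ = ‖S‖ * ‖ρ‖ * ‖w‖ := by ring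
    linarith
  · have h := (hr' x hx).2
    calc _ ≤ 4 * ‖S‖ * (C * |ζ x| * (|ζ x| + ‖x - χ x‖)) := by gcongr; exact h.1
      _ = 4 * ‖S‖ * (C * (|ζ x| + ‖x - χ x‖)) * |ζ x| := by ring
      _ ≤ 1 * |ζ x| := by gcongr; exact h.2.le
      _ = _ := one_mul _

end LocalEstimates

/-! ### Dynamics in the singular time: the singular set is not reached. -/

section Singular

/-- A positive quantity `z` with `|z'| ≤ C (z + m)` cannot reach `0`, if `v` controls `m`. -/
lemma false_of_reaches_zero {a b C N : ℝ} (hab : a < b) {z v m z' v' : ℝ → ℝ}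
    (hzc : ContinuousOn z (Icc a b)) (hvc : ContinuousOn v (Icc a b))
    (hz : ∀ t ∈ Ico a b, 0 < z t) (hzb : z b = 0)
    (hzd : ∀ t ∈ Ioo a b, HasDerivAt z (z' t) t) (hvd : ∀ t ∈ Ioo a b, HasDerivAt v (v' t) t)
    (hC : 0 ≤ C) (hrate : ∀ t ∈ Ioo a b, |z' t| ≤ C * (z t + m t))
    (hslow : ∀ t ∈ Ioo a b, 4 * N * |z' t| ≤ 1) (hv : ∀ t ∈ Ioo a b, |v t| ≤ N * m t ^ 2)
    (hv' : ∀ t ∈ Ioo a b, m t ^ 2 / 2 ≤ z t * v' t) : False := by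
  have hvz : ∀ t ∈ Ioo a b, |v t * z' t| ≤ m t ^ 2 / 4 := by
    intro t ht
    rw [abs_mul]
    calc |v t| * |z' t| ≤ N * m t ^ 2 * |z' t| := by gcongr; exact hv t ht
      _ = (4 * N * |z' t|) * (m t ^ 2 / 4) := by ring
      _ ≤ 1 * (m t ^ 2 / 4) := by gcongr; exact hslow t ht
      _ = _ := one_mul _
  -- `(v z)' = z v' + v z' ≥ m²/2 - m²/4`. As `v z` vanishes at `b`, it is nonpositive before, and
  -- so is `v`.
  have hmono : MonotoneOn (fun t => v t * z t) (Icc a b) := by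
    refine monotoneOn_of_hasDerivWithinAt_nonneg (convex_Icc a b) (hvc.mul hzc)
      (f' := fun t => v' t * z t + v t * z' t) ?_ ?_
    · intro t ht
      rw [interior_Icc] at ht ⊢
      exact ((hvd t ht).mul (hzd t ht)).hasDerivWithinAt
    · intro t ht
      rw [interior_Icc] at ht
      have h1 := hv' t ht
      have h2 := (abs_le.1 (hvz t ht)).1
      nlinarith [sq_nonneg (m t)]
  have hneg : ∀ t ∈ Ico a b, v t ≤ 0 := by
    intro t ht
    have h := hmono (Ico_subset_Icc_self ht) (right_mem_Icc.2 hab.le) ht.2.le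
    simp only [hzb, mul_zero] at h
    exact nonpos_of_mul_nonpos_left h (hz t ht)
  -- The term `C v/z` repairs the Grönwall argument: `(v/z)' ≥ m²/(4z²)`, while `(log z)' ≥ -C (1 +
  -- m/z)` and `m/z ≤ 1 + m²/(4z²)`. As `v ≤ 0`, the repair term only helps the lower bound on `log
  -- z`.
  set Φ : ℝ → ℝ := fun t => Real.log (z t) + 2 * C * t + C * (v t / z t) with hΦ
  have hlow : ∀ c ∈ Ico a b, Real.exp (Φ a - 2 * C * b) ≤ z c := by
    intro c hc
    have hsub : Icc a c ⊆ Ico a b := fun t ht => ⟨ht.1, ht.2.trans_lt hc.2⟩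
    have hsub' : Icc a c ⊆ Icc a b := hsub.trans Ico_subset_Icc_self
    have hΦm : MonotoneOn Φ (Icc a c) := by
      refine monotoneOn_of_hasDerivWithinAt_nonneg (convex_Icc a c) ?_
        (f' := fun t => z' t / z t + 2 * C + C * ((v' t * z t - v t * z' t) / z t ^ 2)) ?_ ?_
      · have h0 : ∀ t ∈ Icc a c, z t ≠ 0 := fun t ht => (hz t (hsub ht)).ne'
        exact (((hzc.mono hsub').log h0).add (by fun_prop)).add
          (((hvc.mono hsub').div (hzc.mono hsub') h0).const_mul C)
      · intro t ht
        rw [interior_Icc] at ht ⊢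
        have ht' : t ∈ Ioo a b := ⟨ht.1, ht.2.trans hc.2⟩
        have h0 := (hz t ⟨ht.1.le, ht'.2⟩).ne'
        refine HasDerivAt.hasDerivWithinAt ?_
        refine (((hzd t ht').log h0).add ?_).add (((hvd t ht').div (hzd t ht') h0).const_mul C)
        simpa using (hasDerivAt_id t).const_mul (2 * C)
      · intro t ht
        rw [interior_Icc] at ht
        have ht' : t ∈ Ioo a b := ⟨ht.1, ht.2.trans hc.2⟩
        have h0 := hz t ⟨ht.1.le, ht'.2⟩
        have h1 := hv' t ht'
        have h2 := (abs_le.1 (hvz t ht')).2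
        have h3 := (abs_le.1 (hrate t ht')).1
        have h4 : m t ^ 2 / 4 / z t ^ 2 ≤ (v' t * z t - v t * z' t) / z t ^ 2 := by
          gcongr
          linarith
        have h5 : -(C * (1 + m t / z t)) ≤ z' t / z t := by
          rw [le_div_iff₀ h0]
          refine le_trans (le_of_eq ?_) h3
          field_simp
        have h6 : m t / z t ≤ 1 + m t ^ 2 / 4 / z t ^ 2 := by
          have : m t ^ 2 / 4 / z t ^ 2 = (m t / z t) ^ 2 / 4 := by ring
          rw [this]
          nlinarith [sq_nonneg (m t / z t - 2)]
        have h7 := mul_le_mul_of_nonneg_left h4 hC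
        have h8 := mul_le_mul_of_nonneg_left h6 hC
        linarith
    have h := hΦm (left_mem_Icc.2 hc.1) (right_mem_Icc.2 hc.1) hc.1
    have h0 := hz c hc
    rw [← Real.le_log_iff_exp_le h0]
    have h1 : C * (v c / z c) ≤ 0 :=
      mul_nonpos_of_nonneg_of_nonpos hC (div_nonpos_of_nonpos_of_nonneg (hneg c hc) h0.le)
    have h2 : 2 * C * c ≤ 2 * C * b := by
      have := hc.2.le
      gcongr
    have h3 : Φ c = Real.log (z c) + 2 * C * c + C * (v c / z c) := rfl
    linarith
  have hlim : Tendsto z (𝓝[Ico a b] b) (𝓝 0) := by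
    have := (hzc b (right_mem_Icc.2 hab.le)).mono Ico_subset_Icc_self
    rwa [ContinuousWithinAt, hzb] at this
  have hne : (𝓝[Ico a b] b).NeBot := by
    rw [← mem_closure_iff_nhdsWithin_neBot, closure_Ico hab.ne]
    exact right_mem_Icc.2 hab.le
  have := ge_of_tendsto hlim (eventually_nhdsWithin_of_forall hlow)
  exact absurd this (not_le.2 (Real.exp_pos _))

/-- `v` is nondecreasing. A positive value forces at least linear growth forwards, a negative one at
least linear decrease backwards, and either contradicts boundedness. -/
lemma eq_zero_of_bounded_of_abs_le_deriv {v v' : ℝ → ℝ} {c B : ℝ} (hc : 0 < c)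
    (hd : ∀ t, HasDerivAt v (v' t) t) (hv : ∀ t, c * |v t| ≤ v' t) (hB : ∀ t, |v t| ≤ B) (t : ℝ) :
    v t = 0 := by
  have hmono : Monotone v := monotone_of_hasDerivAt_nonneg hd fun t =>
    (mul_nonneg hc.le (abs_nonneg _)).trans (hv t)
  have hgrow : ∀ s u K, s ≤ u → (∀ x ∈ Icc s u, K ≤ v' x) → K * (u - s) ≤ v u - v s := by
    intro s u K hsu hK
    exact (convex_Icc s u).mul_sub_le_image_sub_of_le_deriv
      (fun x _ => (hd x).continuousAt.continuousWithinAt)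
      (fun x _ => (hd x).differentiableAt.differentiableWithinAt)
      (fun x hx => by rw [(hd x).deriv]; exact hK x (interior_subset hx))
      s (left_mem_Icc.2 hsu) u (right_mem_Icc.2 hsu) hsu
  by_contra hne
  have hpos : 0 < |v t| := abs_pos.2 hne
  have hB0 : 0 < B := hpos.trans_le (hB t)
  set T := (2 * B + 1) / (c * |v t|) with hT
  have hT0 : 0 < T := by positivity
  have hTc : c * |v t| * T = 2 * B + 1 := by rw [hT]; field_simp
  rcases lt_or_gt_of_ne hne with h | h
  · have := hgrow (t - T) t (c * |v t|) (by linarith) fun x hx => by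
      refine le_trans ?_ (hv x)
      have h1 := hmono hx.2
      refine mul_le_mul_of_nonneg_left ?_ hc.le
      rw [abs_of_neg h, abs_of_nonpos (h1.trans h.le)]
      linarith
    rw [sub_sub_cancel, hTc] at this
    have h1 := abs_le.1 (hB t)
    have h2 := abs_le.1 (hB (t - T))
    linarith
  · have := hgrow t (t + T) (c * |v t|) (by linarith) fun x hx => by
      refine le_trans ?_ (hv x)
      have h1 := hmono hx.1
      refine mul_le_mul_of_nonneg_left ?_ hc.le
      rw [abs_of_pos h, abs_of_nonneg (h.le.trans h1)]
      exact h1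
    rw [add_sub_cancel_left, hTc] at this
    have h1 := abs_le.1 (hB t)
    have h2 := abs_le.1 (hB (t + T))
    linarith

variable {E : Type*} [NormedAddCommGroup E] [InnerProductSpace ℝ E] [FiniteDimensional ℝ E]

lemma eventually_eq_zero_of_norm_deriv_le {w w' : ℝ → E} {K : ℝ}
    (hd : ∀ᶠ t in 𝓝 (0 : ℝ), HasDerivAt w (w' t) t ∧ ‖w' t‖ ≤ K * ‖w t‖) (h0 : w 0 = 0) :
    ∀ᶠ t in 𝓝 (0 : ℝ), w t = 0 := by
  obtain ⟨ε, hε, h⟩ := Metric.eventually_nhds_iff_ball.1 hd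
  have right : ∀ (u u' : ℝ → E), (∀ t ∈ Metric.ball (0 : ℝ) ε,
      HasDerivAt u (u' t) t ∧ ‖u' t‖ ≤ K * ‖u t‖) → u 0 = 0 →
      ∀ t ∈ Metric.ball (0 : ℝ) ε, 0 ≤ t → u t = 0 := by
    intro u u' hu hu0 t ht ht0
    rw [Real.ball_zero_eq_Ioo] at ht hu
    have hsub : ∀ s ∈ Icc 0 t, s ∈ Ioo (-ε) ε := fun s hs =>
      ⟨by linarith [hs.1], by linarith [hs.2, ht.2]⟩
    exact eq_zero_of_abs_deriv_le_mul_abs_self_of_eq_zero_right (a := 0) (b := t) (K := K)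
      (fun s hs => (hu s (hsub s hs)).1.continuousAt.continuousWithinAt)
      (fun s hs => (hu s (hsub s (Ico_subset_Icc_self hs))).1.hasDerivWithinAt) hu0
      (fun s hs => (hu s (hsub s (Ico_subset_Icc_self hs))).2) t ⟨ht0, le_rfl⟩
  filter_upwards [Metric.ball_mem_nhds (0 : ℝ) hε] with t ht
  rcases le_total 0 t with h1 | h1
  · exact right w w' h h0 t ht h1
  · have := right (fun t => w (-t)) (fun t => -w' (-t)) (fun s hs => ?_) (by simpa using h0) (-t)
      (by simpa using ht) (by linarith)
    · simpa using this
    · obtain ⟨h2, h3⟩ := h (-s) (by simpa using hs)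
      refine ⟨?_, by simpa using h3⟩
      have := h2.scomp s (hasDerivAt_neg s)
      rw [neg_one_smul] at this
      exact this

namespace LocalEstimates

variable {F : E → E} {ζ : E → ℝ} {w : E → E} {S : E →L[ℝ] E} {C r : ℝ}

/-- Reversing time in the singular equation amounts to replacing `ζ` by `-ζ`, so reaching the
singular set backwards reduces to reaching it forwards. -/
lemma neg_zeta (h : LocalEstimates F ζ w S C r) : LocalEstimates F (fun x => -ζ x) w S C r where
  zeta := h.zeta.neg
  defect := h.defect
  nonneg := h.nonneg
  zeta_le x hx := by rw [abs_neg]; exact h.zeta_le x hx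
  transport := h.transport
  lyapunov := h.lyapunov
  rate x hx := by
    rw [fderiv_fun_neg, neg_apply, abs_neg, abs_neg]; exact h.rate x hx
  slow x hx := by
    rw [fderiv_fun_neg, neg_apply, abs_neg, abs_neg]; exact h.slow x hx

lemma hasDerivAt_zeta (h : LocalEstimates F ζ w S C r) {U : ℝ → E} {t : ℝ}
    (hU : HasDerivAt U ((1 / ζ (U t)) • F (U t)) t) :
    HasDerivAt (fun t => ζ (U t)) (fderiv ℝ ζ (U t) (F (U t)) / ζ (U t)) t := by
  refine ((h.zeta (U t)).hasFDerivAt.comp_hasDerivAt t hU).congr_deriv ?_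
  rw [map_smul, smul_eq_mul]; ring

lemma hasDerivAt_lyapunov (h : LocalEstimates F ζ w S C r) {U : ℝ → E} {t : ℝ}
    (hU : HasDerivAt U ((1 / ζ (U t)) • F (U t)) t) :
    HasDerivAt (fun t => inner ℝ (S (w (U t))) (w (U t)))
      ((inner ℝ (S (fderiv ℝ w (U t) (F (U t)))) (w (U t)) +
        inner ℝ (S (w (U t))) (fderiv ℝ w (U t) (F (U t)))) / ζ (U t)) t := by
  have hw := (h.defect (U t)).hasFDerivAt.comp_hasDerivAt t hU
  refine ((S.hasFDerivAt.comp_hasDerivAt t hw).inner ℝ hw).congr_deriv ?_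
  simp only [map_smul, real_inner_smul_left, real_inner_smul_right, Function.comp_apply]
  ring

lemma false_of_reaches_right (h : LocalEstimates F ζ w S C r) {U : ℝ → E} {a b : ℝ} (hab : a < b)
    (hUc : ContinuousOn U (Icc a b))
    (hUd : ∀ t ∈ Ioo a b, HasDerivAt U ((1 / ζ (U t)) • F (U t)) t)
    (hball : ∀ t ∈ Icc a b, U t ∈ Metric.ball (0 : E) r)
    (hne : ∀ t ∈ Ico a b, ζ (U t) ≠ 0) (hb : ζ (U b) = 0) : False := by
  have hζc : ContinuousOn (fun t => ζ (U t)) (Icc a b) :=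
    h.zeta.continuous.comp_continuousOn hUc
  have hVc : ContinuousOn (fun t => inner ℝ (S (w (U t))) (w (U t))) (Icc a b) := by
    have hw : ContinuousOn (fun t => w (U t)) (Icc a b) :=
      h.defect.continuous.comp_continuousOn hUc
    exact (S.continuous.comp_continuousOn hw).inner hw
  obtain ⟨s, hs, hpos⟩ : ∃ s : ℝ, (s = 1 ∨ s = -1) ∧ ∀ t ∈ Ico a b, 0 < s * ζ (U t) := by
    have ha : a ∈ Ico a b := ⟨le_rfl, hab⟩
    have hc : ContinuousOn (fun t => ζ (U t)) (Ico a b) := hζc.mono Ico_subset_Icc_self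
    rcases lt_or_gt_of_ne (hne a ha) with h0 | h0
    · refine ⟨-1, Or.inr rfl, fun t ht => ?_⟩
      by_contra hcon
      obtain ⟨x, hx, hx0⟩ := isPreconnected_Ico.intermediate_value ha ht hc
        (show (0 : ℝ) ∈ Icc _ _ from ⟨h0.le, by linarith⟩)
      exact hne x hx hx0
    · refine ⟨1, Or.inl rfl, fun t ht => ?_⟩
      by_contra hcon
      obtain ⟨x, hx, hx0⟩ := isPreconnected_Ico.intermediate_value ht ha hc
        (show (0 : ℝ) ∈ Icc _ _ from ⟨by linarith, h0.le⟩)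
      exact hne x hx hx0
  have hss : s * s = 1 := by rcases hs with rfl | rfl <;> norm_num
  have hsa : |s| = 1 := by rcases hs with rfl | rfl <;> norm_num
  have hζabs : ∀ t ∈ Ico a b, |ζ (U t)| = s * ζ (U t) := by
    intro t ht
    rw [← abs_of_pos (hpos t ht), abs_mul, hsa, one_mul]
  refine false_of_reaches_zero (C := C) (N := ‖S‖) hab (z := fun t => s * ζ (U t))
    (v := fun t => s * inner ℝ (S (w (U t))) (w (U t))) (m := fun t => ‖w (U t)‖)
    (hζc.const_mul s) (hVc.const_mul s) hpos (by simp [hb])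
    (fun t ht => (h.hasDerivAt_zeta (hUd t ht)).const_mul s)
    (fun t ht => (h.hasDerivAt_lyapunov (hUd t ht)).const_mul s) h.nonneg ?_ ?_ ?_ ?_
  · intro t ht
    have ht' := Ioo_subset_Ico_self ht
    have h1 := h.rate _ (hball t (Ioo_subset_Icc_self ht))
    have h0 := abs_pos.2 (hne t ht')
    rw [abs_mul, hsa, one_mul, abs_div, div_le_iff₀ h0, ← hζabs t ht']
    linarith
  · intro t ht
    have ht' := Ioo_subset_Ico_self ht
    have h1 := h.slow _ (hball t (Ioo_subset_Icc_self ht))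
    have h0 := abs_pos.2 (hne t ht')
    rw [abs_mul, hsa, one_mul, abs_div, ← mul_div_assoc, div_le_one h0]
    exact h1
  · intro t ht
    rw [abs_mul, hsa, one_mul, pow_two, ← mul_assoc]
    exact (abs_real_inner_le_norm _ _).trans (by gcongr; exact S.le_opNorm _)
  · intro t ht
    have ht' := Ioo_subset_Ico_self ht
    have h1 := h.lyapunov _ (hball t (Ioo_subset_Icc_self ht))
    refine h1.trans_eq ?_
    have h0 := hne t ht'
    have : ∀ x : ℝ, x = s * ζ (U t) * (s * (x / ζ (U t))) := by
      intro x
      calc x = (s * s) * x := by rw [hss, one_mul]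
        _ = _ := by field_simp
    exact this _

lemma false_of_reaches_left (h : LocalEstimates F ζ w S C r) {U : ℝ → E} {a b : ℝ} (hab : a < b)
    (hUc : ContinuousOn U (Icc a b))
    (hUd : ∀ t ∈ Ioo a b, HasDerivAt U ((1 / ζ (U t)) • F (U t)) t)
    (hball : ∀ t ∈ Icc a b, U t ∈ Metric.ball (0 : E) r)
    (hne : ∀ t ∈ Ioc a b, ζ (U t) ≠ 0) (ha : ζ (U a) = 0) : False := by
  refine h.neg_zeta.false_of_reaches_right (U := fun t => U (-t)) (a := -b) (b := -a)
    (by linarith) ?_ ?_ ?_ ?_ (by simpa using ha)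
  · refine hUc.comp continuous_neg.continuousOn fun t ht => ?_
    exact ⟨by linarith [ht.2], by linarith [ht.1]⟩
  · intro t ht
    have := (hUd (-t) ⟨by linarith [ht.2], by linarith [ht.1]⟩).scomp t (hasDerivAt_neg t)
    refine this.congr_deriv ?_
    rw [smul_smul]
    congr 1
    rw [div_neg]; ring
  · intro t ht
    exact hball _ ⟨by linarith [ht.2], by linarith [ht.1]⟩
  · intro t ht
    exact neg_ne_zero.2 (hne _ ⟨by linarith [ht.2], by linarith [ht.1]⟩)

end LocalEstimates

end Singular

/-! ### Fixed points of the retraction as a manifold, and solutions near it. -/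

section CenterManifold

variable {d : ℕ}

lemma inner_gradient_eq_fderiv (ζ : EuclideanSpace ℝ (Fin d) → ℝ)
    (x v : EuclideanSpace ℝ (Fin d)) : inner ℝ (gradient ζ x) v = fderiv ℝ ζ x v := by
  simp [gradient]

variable {F : EuclideanSpace ℝ (Fin d) → EuclideanSpace ℝ (Fin d)}
  {ζ : EuclideanSpace ℝ (Fin d) → ℝ}
  {P : EuclideanSpace ℝ (Fin d) →L[ℝ] EuclideanSpace ℝ (Fin d)}
  {χ : EuclideanSpace ℝ (Fin d) → EuclideanSpace ℝ (Fin d)}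

namespace IsCenterRetraction

/-- The defect takes values in `ker P`, so composing it with an identification of `ker P` with a
Euclidean space loses nothing. It is a submersion since `Dχ` vanishes on `ker P`. -/
lemma exists_submersion (hχ : IsCenterRetraction F P χ) (hP : ∀ x, P (P x) = P x)
    (p : EuclideanSpace ℝ (Fin d)) :
    ∃ g : EuclideanSpace ℝ (Fin d) →
        EuclideanSpace ℝ (Fin (Module.finrank ℝ (LinearMap.ker P.toLinearMap))),
      ContDiffAt ℝ 1 g p ∧ Function.Surjective (fderiv ℝ g p) ∧
      (∀ v, fderiv ℝ g p v = 0 ↔ fderiv ℝ χ p v = v) ∧ ∀ x, g x = 0 ↔ χ x = x := by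
  set N := LinearMap.ker P.toLinearMap with hN
  let ψ : N ≃L[ℝ] EuclideanSpace ℝ (Fin (Module.finrank ℝ N)) :=
    ContinuousLinearEquiv.ofFinrankEq (by simp)
  let Q : EuclideanSpace ℝ (Fin d) →L[ℝ] N :=
    (ContinuousLinearMap.id ℝ _ - P).codRestrict N fun x => by
      change P (x - P x) = 0
      rw [map_sub, hP, sub_self]
  have hQ : ∀ y, P y = 0 → (Q y : EuclideanSpace ℝ (Fin d)) = y := by
    intro y hy
    change y - P y = y
    rw [hy, sub_zero]
  have hQ0 : ∀ y, P y = 0 → (Q y = 0 ↔ y = 0) := by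
    intro y hy
    constructor
    · intro h
      rw [← hQ y hy, h]
      rfl
    · intro h
      rw [h, Q.map_zero]
  let T := ψ.toContinuousLinearMap.comp Q
  have hd : HasFDerivAt (fun x => T (x - χ x))
      (T.comp (ContinuousLinearMap.id ℝ _ - fderiv ℝ χ p)) p :=
    T.hasFDerivAt.comp p ((hasFDerivAt_id p).sub (hχ.differentiable p).hasFDerivAt)
  have hT : ∀ y, P y = 0 → (T y = 0 ↔ y = 0) := by
    intro y hy
    change ψ (Q y) = 0 ↔ _
    rw [ψ.map_eq_zero_iff, hQ0 y hy]
  refine ⟨fun x => T (x - χ x), ?_, ?_, fun v => ?_, fun x => ?_⟩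
  · exact (T.contDiff.comp (contDiff_id.sub hχ.contDiff)).contDiffAt
  · rw [hd.fderiv]
    intro y
    refine ⟨(ψ.symm y : N), ?_⟩
    have hk : P (ψ.symm y : N) = 0 := (ψ.symm y).2
    change ψ (Q ((ψ.symm y : N) - fderiv ℝ χ p (ψ.symm y : N))) = y
    rw [hχ.fderiv_apply_eq_zero p hk, sub_zero]
    have : Q (ψ.symm y : N) = ψ.symm y := Subtype.ext (hQ _ hk)
    rw [this, ψ.apply_symm_apply]
  · rw [hd.fderiv]
    change T (v - fderiv ℝ χ p v) = 0 ↔ _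
    rw [hT _ (by rw [map_sub, hχ.proj_fderiv, sub_self]), sub_eq_zero, eq_comm]
  · rw [hT _ (hχ.proj_sub x), sub_eq_zero, eq_comm]

lemma eventually_mem_iff {p : EuclideanSpace ℝ (Fin d)} {r : ℝ}
    (hp : p ∈ Metric.ball (0 : EuclideanSpace ℝ (Fin d)) r) :
    ∀ᶠ x in 𝓝 p, (x ∈ {x | x ∈ Metric.ball (0 : EuclideanSpace ℝ (Fin d)) r ∧ χ x = x} ↔
      χ x = x) := by
  filter_upwards [Metric.isOpen_ball.mem_nhds hp] with x hx
  exact ⟨fun h => h.2, fun h => ⟨hx, h⟩⟩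

lemma exists_isSubmanifold (hχ : IsCenterRetraction F P χ) (hP : ∀ x, P (P x) = P x) (r : ℝ) :
    ∃ n, IsSubmanifold {x | x ∈ Metric.ball (0 : EuclideanSpace ℝ (Fin d)) r ∧ χ x = x} n := by
  refine ⟨d - Module.finrank ℝ (LinearMap.ker P.toLinearMap), fun p hp => ?_⟩
  obtain ⟨g, hg, hs, -, hz⟩ := hχ.exists_submersion hP p
  refine ⟨LinearMap.ker (fderiv ℝ g p).toLinearMap, ?_, hp, _, g, hg, hs, rfl, ?_⟩
  · have h1 := LinearMap.finrank_range_add_finrank_ker (fderiv ℝ g p).toLinearMap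
    rw [LinearMap.range_eq_top.2 hs, finrank_top, finrank_euclideanSpace_fin,
      finrank_euclideanSpace_fin] at h1
    omega
  · filter_upwards [eventually_mem_iff hp.1] with x hx
    rw [hx, hz]

lemma isSubmanifoldAt_zero (hχ : IsCenterRetraction F P χ) (hP : ∀ x, P (P x) = P x) {r : ℝ}
    (hr : 0 < r) :
    IsSubmanifoldAt {x | x ∈ Metric.ball (0 : EuclideanSpace ℝ (Fin d)) r ∧ χ x = x} 0
      (LinearMap.range P.toLinearMap) := by
  obtain ⟨g, hg, hs, hk, hz⟩ := hχ.exists_submersion hP 0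
  have h0 := Metric.mem_ball_self (x := (0 : EuclideanSpace ℝ (Fin d))) hr
  refine ⟨⟨h0, hχ.map_zero⟩, _, g, hg, hs, ?_, ?_⟩
  · ext v
    rw [LinearMap.mem_ker]
    change fderiv ℝ g 0 v = 0 ↔ _
    rw [hk, hχ.fderiv_zero]
    constructor
    · intro h; exact ⟨v, h⟩
    · rintro ⟨u, rfl⟩; exact hP u
  · filter_upwards [eventually_mem_iff h0] with x hx
    rw [hx, hz]

/-- Grönwall's inequality for the defect. The bounded factor `c` covers both the regular equation
(`c = 1`) and the singular one away from the singular set (`c = 1/ζ`). -/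
lemma eventually_defect_eq_zero (hχ : IsCenterRetraction F P χ) {C r : ℝ}
    (htr : ∀ x ∈ Metric.ball (0 : EuclideanSpace ℝ (Fin d)) r,
      ‖fderiv ℝ (fun x => x - χ x) x (F x)‖ ≤ C * ‖x - χ x‖)
    {U : ℝ → EuclideanSpace ℝ (Fin d)} {c : ℝ → ℝ} {B : ℝ}
    (hd : ∀ᶠ t in 𝓝 (0 : ℝ), HasDerivAt U (c t • F (U t)) t)
    (hc : ∀ᶠ t in 𝓝 (0 : ℝ), |c t| ≤ B)
    (h0 : U 0 ∈ {x | x ∈ Metric.ball (0 : EuclideanSpace ℝ (Fin d)) r ∧ χ x = x}) :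
    ∀ᶠ t in 𝓝 (0 : ℝ), U t ∈ {x | x ∈ Metric.ball (0 : EuclideanSpace ℝ (Fin d)) r ∧ χ x = x} := by
  have hcont : ContinuousAt U 0 := hd.self_of_nhds.continuousAt
  have hball : ∀ᶠ t in 𝓝 (0 : ℝ), U t ∈ Metric.ball (0 : EuclideanSpace ℝ (Fin d)) r :=
    hcont.eventually (Metric.isOpen_ball.mem_nhds h0.1)
  have hw : ∀ᶠ t in 𝓝 (0 : ℝ), U t - χ (U t) = 0 := by
    refine eventually_eq_zero_of_norm_deriv_le (K := B * C)
      (w' := fun t => c t • fderiv ℝ (fun x => x - χ x) (U t) (F (U t))) ?_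
      (by rw [h0.2, sub_self])
    filter_upwards [hd, hc, hball] with t h1 h2 h3
    constructor
    · have hdw : DifferentiableAt ℝ (fun x => x - χ x) (U t) :=
        differentiableAt_fun_id.sub (hχ.differentiable _)
      refine (hdw.hasFDerivAt.comp_hasDerivAt t h1).congr_deriv ?_
      rw [map_smul]
    · rw [norm_smul, Real.norm_eq_abs, mul_assoc]
      have hB : 0 ≤ B := (abs_nonneg _).trans h2
      have := htr _ h3
      gcongr
  filter_upwards [hw, hball] with t h1 h2
  exact ⟨h2, (sub_eq_zero.1 h1).symm⟩

end IsCenterRetraction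

/-- This makes hypothesis (2) applicable to the fixed points of `χ`. -/
lemma exists_isCenterManifold (hF : ContDiff ℝ 1 F) (σ : SpectralSplitting (fderiv ℝ F 0))
    (hχ : IsCenterRetraction F σ.Pc χ) : ∃ r > 0,
      IsCenterManifold F {x | x ∈ Metric.ball (0 : EuclideanSpace ℝ (Fin d)) r ∧ χ x = x} := by
  have h := hχ.eventually_norm_transport_sub_le hF σ.comm_c one_pos
  obtain ⟨r, hr, hr'⟩ := Metric.eventually_nhds_iff_ball.1 h
  refine ⟨r, hr, hχ.exists_isSubmanifold σ.cc r, ?_, fun U hU0 hU => ?_⟩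
  · have := hχ.isSubmanifoldAt_zero σ.cc hr
    rwa [σ.range_c] at this
  · refine hχ.eventually_defect_eq_zero (C := ‖fderiv ℝ F 0‖ + 1) (c := fun _ => 1) (B := 1)
      (fun x hx => ?_) (by simpa using hU) (by simp) hU0
    have h1 := hr' x hx
    set y := fderiv ℝ (fun x => x - χ x) x (F x)
    set w := x - χ x
    calc ‖y‖ ≤ ‖fderiv ℝ F 0 w‖ + ‖y - fderiv ℝ F 0 w‖ := by
          have := norm_add_le (fderiv ℝ F 0 w) (y - fderiv ℝ F 0 w)
          rwa [add_sub_cancel] at this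
      _ ≤ ‖fderiv ℝ F 0‖ * ‖w‖ + 1 * ‖w‖ := add_le_add ((fderiv ℝ F 0).le_opNorm w) h1
      _ = _ := by ring

lemma IsSolutionOn.hasDerivAt {U : ℝ → EuclideanSpace ℝ (Fin d)} {I : Set ℝ}
    (hU : IsSolutionOn F ζ U I) {t : ℝ} (ht : I ∈ 𝓝 t) (hne : ζ (U t) ≠ 0) :
    HasDerivAt U ((1 / ζ (U t)) • F (U t)) t :=
  (hU.hasDerivWithinAt t (mem_of_mem_nhds ht) hne).hasDerivAt ht

namespace LocalEstimates

variable {w : EuclideanSpace ℝ (Fin d) → EuclideanSpace ℝ (Fin d)}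
  {S : EuclideanSpace ℝ (Fin d) →L[ℝ] EuclideanSpace ℝ (Fin d)} {C r : ℝ}

/-- A solution in the ball that is regular at one time is regular at all times. -/
lemma ne_zero_of_isSolutionOn (h : LocalEstimates F ζ w S C r)
    {U : ℝ → EuclideanSpace ℝ (Fin d)} {I : Set ℝ} (hI : I.OrdConnected)
    (hU : IsSolutionOn F ζ U I) (hball : ∀ t ∈ I, U t ∈ Metric.ball 0 r) {t₀ : ℝ} (ht₀ : t₀ ∈ I)
    (hne : ζ (U t₀) ≠ 0) : ∀ t ∈ I, ζ (U t) ≠ 0 := by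
  intro t₁ ht₁ hz
  rcases lt_trichotomy t₀ t₁ with hlt | rfl | hlt
  · have hsub : Icc t₀ t₁ ⊆ I := hI.out ht₀ ht₁
    have hc : ContinuousOn (fun t => ζ (U t)) (Icc t₀ t₁) :=
      h.zeta.continuous.comp_continuousOn (hU.continuousOn.mono hsub)
    have hcl : IsClosed (Icc t₀ t₁ ∩ (fun t => ζ (U t)) ⁻¹' {0}) :=
      hc.preimage_isClosed_of_isClosed isClosed_Icc isClosed_singleton
    obtain ⟨b, ⟨hb, hb0⟩, hmin⟩ := (isCompact_Icc.of_isClosed_subset hcl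
      inter_subset_left).exists_isLeast ⟨t₁, right_mem_Icc.2 hlt.le, hz⟩
    have hb0' : ζ (U b) = 0 := hb0
    have hab : t₀ < b := lt_of_le_of_ne hb.1 fun he => hne (by rw [he]; exact hb0')
    have hsubb : Icc t₀ b ⊆ I := (Icc_subset_Icc_right hb.2).trans hsub
    have hreg : ∀ t ∈ Ico t₀ b, ζ (U t) ≠ 0 := fun t ht h0 =>
      absurd (hmin ⟨⟨ht.1, ht.2.le.trans hb.2⟩, h0⟩) (not_le.2 ht.2)
    exact h.false_of_reaches_right hab (hU.continuousOn.mono hsubb)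
      (fun t ht => hU.hasDerivAt (mem_of_superset (Icc_mem_nhds ht.1 ht.2) hsubb)
        (hreg t (Ioo_subset_Ico_self ht)))
      (fun t ht => hball t (hsubb ht)) hreg hb0'
  · exact hne hz
  · have hsub : Icc t₁ t₀ ⊆ I := hI.out ht₁ ht₀
    have hc : ContinuousOn (fun t => ζ (U t)) (Icc t₁ t₀) :=
      h.zeta.continuous.comp_continuousOn (hU.continuousOn.mono hsub)
    have hcl : IsClosed (Icc t₁ t₀ ∩ (fun t => ζ (U t)) ⁻¹' {0}) :=
      hc.preimage_isClosed_of_isClosed isClosed_Icc isClosed_singleton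
    obtain ⟨a, ⟨ha, ha0⟩, hmax⟩ := (isCompact_Icc.of_isClosed_subset hcl
      inter_subset_left).exists_isGreatest ⟨t₁, left_mem_Icc.2 hlt.le, hz⟩
    have ha0' : ζ (U a) = 0 := ha0
    have hab : a < t₀ := lt_of_le_of_ne ha.2 fun he => hne (by rw [← he]; exact ha0')
    have hsubb : Icc a t₀ ⊆ I := (Icc_subset_Icc_left ha.1).trans hsub
    have hreg : ∀ t ∈ Ioc a t₀, ζ (U t) ≠ 0 := fun t ht h0 =>
      absurd (hmax ⟨⟨ha.1.trans ht.1.le, ht.2⟩, h0⟩) (not_le.2 ht.1)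
    exact h.false_of_reaches_left hab (hU.continuousOn.mono hsubb)
      (fun t ht => hU.hasDerivAt (mem_of_superset (Icc_mem_nhds ht.1 ht.2) hsubb)
        (hreg t (Ioo_subset_Ioc_self ht)))
      (fun t ht => hball t (hsubb ht)) hreg ha0'

/-- A solution in the ball is regular. -/
lemma regular_of_isSolutionOn (h : LocalEstimates F ζ w S C r)
    {U : ℝ → EuclideanSpace ℝ (Fin d)} {I : Set ℝ} (hI : I.OrdConnected)
    (hU : IsSolutionOn F ζ U I) (hball : ∀ t ∈ I, U t ∈ Metric.ball 0 r) :
    ∀ t ∈ I, ζ (U t) ≠ 0 := by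
  intro t ht
  obtain ⟨t₀, ht₀⟩ := closure_nonempty_iff.1 ⟨t, hU.dense_regular ht⟩
  exact h.ne_zero_of_isSolutionOn hI hU hball ht₀.1 ht₀.2 t ht

/-- The defect vanishes along the global solutions in the ball. -/
lemma defect_eq_zero_of_global (h : LocalEstimates F ζ w S C r) {B : ℝ}
    (hB : ∀ x ∈ Metric.ball 0 r, ‖w x‖ ≤ B)
    {U : ℝ → EuclideanSpace ℝ (Fin d)} (hU : IsSolutionOn F ζ U univ)
    (hball : ∀ t, U t ∈ Metric.ball 0 r) (t : ℝ) : w (U t) = 0 := by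
  have hne : ∀ t, ζ (U t) ≠ 0 := fun t =>
    h.regular_of_isSolutionOn ordConnected_univ hU (fun t _ => hball t) t (mem_univ t)
  have hUd : ∀ t, HasDerivAt U ((1 / ζ (U t)) • F (U t)) t := fun t =>
    hU.hasDerivAt univ_mem (hne t)
  have hζc : Continuous fun t => ζ (U t) :=
    continuous_iff_continuousAt.2 fun t => (h.hasDerivAt_zeta (hUd t)).continuousAt
  obtain ⟨s, hs, hpos⟩ : ∃ s : ℝ, (s = 1 ∨ s = -1) ∧ ∀ t, 0 < s * ζ (U t) := by
    rcases lt_or_gt_of_ne (hne 0) with h0 | h0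
    · refine ⟨-1, Or.inr rfl, fun t => ?_⟩
      by_contra hcon
      obtain ⟨x, hx⟩ := mem_range_of_exists_le_of_exists_ge hζc ⟨0, h0.le⟩
        ⟨t, show (0 : ℝ) ≤ _ by linarith⟩
      exact hne x hx
    · refine ⟨1, Or.inl rfl, fun t => ?_⟩
      by_contra hcon
      obtain ⟨x, hx⟩ := mem_range_of_exists_le_of_exists_ge hζc
        ⟨t, show _ ≤ (0 : ℝ) by linarith⟩ ⟨0, h0.le⟩
      exact hne x hx
  have hss : s * s = 1 := by rcases hs with rfl | rfl <;> norm_num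
  have hsa : |s| = 1 := by rcases hs with rfl | rfl <;> norm_num
  set v : ℝ → ℝ := fun t => s * inner ℝ (S (w (U t))) (w (U t)) with hv
  set v' : ℝ → ℝ := fun t => s * ((inner ℝ (S (fderiv ℝ w (U t) (F (U t)))) (w (U t)) +
        inner ℝ (S (w (U t))) (fderiv ℝ w (U t) (F (U t)))) / ζ (U t)) with hv'
  have hvd : ∀ t, HasDerivAt v (v' t) t := fun t => (h.hasDerivAt_lyapunov (hUd t)).const_mul s
  -- In the singular time the Lyapunov gain is divided by `|ζ| ≤ 1`, which can only increase it.
  have hv'le : ∀ t, ‖w (U t)‖ ^ 2 / 2 ≤ v' t := by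
    intro t
    have h1 := h.lyapunov _ (hball t)
    have h2 := h.zeta_le _ (hball t)
    have hz : s * ζ (U t) ≤ 1 := by
      refine (le_abs_self _).trans ?_
      rwa [abs_mul, hsa, one_mul]
    set X := inner ℝ (S (fderiv ℝ w (U t) (F (U t)))) (w (U t)) +
        inner ℝ (S (w (U t))) (fderiv ℝ w (U t) (F (U t)))
    have e : v' t = X / (s * ζ (U t)) := by
      have hs0 : s ≠ 0 := by rintro rfl; simp at hsa
      have h0 := hne t
      simp only [hv']
      rw [eq_div_iff (mul_ne_zero hs0 h0)]
      calc s * (X / ζ (U t)) * (s * ζ (U t)) = (s * s) * X := by field_simp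
        _ = X := by rw [hss, one_mul]
    rw [e, le_div_iff₀ (hpos t)]
    refine le_trans ?_ h1
    exact mul_le_of_le_one_right (by positivity) hz
  have hvle : ∀ t, |v t| ≤ ‖S‖ * ‖w (U t)‖ ^ 2 := by
    intro t
    simp only [hv]
    rw [abs_mul, hsa, one_mul, pow_two, ← mul_assoc]
    exact (abs_real_inner_le_norm _ _).trans (by gcongr; exact S.le_opNorm _)
  have hzero := eq_zero_of_bounded_of_abs_le_deriv (c := 1 / (2 * (‖S‖ + 1)))
    (B := ‖S‖ * B ^ 2) (by positivity) hvd (fun t => ?_) (fun t => ?_)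
  · have hv0 : v = fun _ => 0 := funext hzero
    have h1 := hvd t
    rw [hv0] at h1
    have h2 := h1.unique (hasDerivAt_const t (0 : ℝ))
    have h3 := hv'le t
    rw [h2] at h3
    have h4 : ‖w (U t)‖ = 0 := by nlinarith [norm_nonneg (w (U t))]
    exact norm_eq_zero.1 h4
  · refine le_trans ?_ (hv'le t)
    calc _ ≤ 1 / (2 * (‖S‖ + 1)) * ((‖S‖ + 1) * ‖w (U t)‖ ^ 2) := by
          gcongr
          refine (hvle t).trans ?_
          gcongr
          linarith
      _ = _ := by field_simp
  · refine (hvle t).trans ?_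
    have := hB _ (hball t)
    gcongr

end LocalEstimates

end CenterManifold

end SingularODE

/-! ### Assembly of the main theorem. -/

theorem theorem1 {d : ℕ}
    (F : EuclideanSpace ℝ (Fin d) → EuclideanSpace ℝ (Fin d))
    (ζ : EuclideanSpace ℝ (Fin d) → ℝ)
    (hF : ContDiff ℝ 3 F) (hζ : ContDiff ℝ 3 ζ)
    (hF0 : F 0 = 0) (hζ0 : ζ 0 = 0)
    -- (1) the gradient of `ζ` at `0` does not vanish
    (h1 : gradient ζ 0 ≠ 0)
    -- (2) near `0`, center manifolds meet the singular set only in equilibria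
    (h2 : ∀ M, SingularODE.IsCenterManifold F M → ∀ᶠ U in 𝓝 0, U ∈ M → ζ U = 0 → F U = 0)
    -- (3) a manifold of equilibria transversal to the singular set
    (h3 : ∃ M, SingularODE.IsTransversalEquilibriumManifold F ζ M)
    -- (4) `∇ζ · F = 0` on the singular set (near `0`)
    (h4 : ∀ᶠ U in 𝓝 0, ζ U = 0 → inner ℝ (gradient ζ U) (F U) = 0)
    -- (5) the continuous extension of `G = ∇ζ · F / ζ` vanishes at the singular equilibria (near `0`)
    (h5 : ∀ᶠ U in 𝓝 0, ζ U = 0 → F U = 0 →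
      Tendsto (fun V => inner ℝ (gradient ζ V) (F V) / ζ V) (𝓝[{V | ζ V ≠ 0}] U) (𝓝 0)) :
    -- inside any neighbourhood of `0` there is a manifold `M` through `0`, tangent at `0` to
    -- center directions, and a radius `δ`, such that
    ∀ r > 0, ∃ (M : Set (EuclideanSpace ℝ (Fin d))) (δ : ℝ), 0 < δ ∧
      M ⊆ Metric.ball 0 r ∧
      (∃ n, SingularODE.IsSubmanifold M n) ∧
      (∃ V ≤ SingularODE.centerSubspace (fderiv ℝ F 0), SingularODE.IsSubmanifoldAt M 0 V) ∧
      -- `M` is locally invariant for the singular equation,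
      SingularODE.IsLocallyInvariantSingular F ζ M ∧
      -- `M` contains the solutions that stay in the closed `δ`-ball for all times,
      (∀ U : ℝ → EuclideanSpace ℝ (Fin d), SingularODE.IsSolutionOn F ζ U univ →
        (∀ t, ‖U t‖ ≤ δ) → ∀ t, U t ∈ M) ∧
      -- and orbits on `M` that start off the singular set never reach it
      (∀ (U : ℝ → EuclideanSpace ℝ (Fin d)) (I : Set ℝ), I.OrdConnected → 0 ∈ I →
        SingularODE.IsSolutionOn F ζ U I → (∀ t ∈ I, U t ∈ M) →
        ζ (U 0) ≠ 0 → ∀ t ∈ I, ζ (U t) ≠ 0) := by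
  intro R hR
  simp only [SingularODE.inner_gradient_eq_fderiv] at h4 h5
  have h1' : fderiv ℝ ζ 0 ≠ 0 := by
    intro h0
    exact h1 (by simp [gradient, h0])
  have hF2 : ContDiff ℝ 2 F := hF.of_le (by norm_num)
  obtain ⟨σ⟩ := SingularODE.exists_spectralSplitting (fderiv ℝ F 0)
  obtain ⟨χ, a1, a2, a3, a4, a5, a6⟩ := σ.exists_center_retraction hF2 hF0
  have hχ : SingularODE.IsCenterRetraction F σ.Pc χ := ⟨a1, a2, a3, a4, a5, a6⟩
  obtain ⟨r₁, hr₁, hcm⟩ := SingularODE.exists_isCenterManifold (hF.of_le (by norm_num)) σ hχ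
  have h2' : ∀ᶠ x in 𝓝 0, χ x = x → ζ x = 0 → F x = 0 := by
    filter_upwards [h2 _ hcm, Metric.ball_mem_nhds 0 hr₁] with x hx hxr hχx
    exact hx ⟨hxr, hχx⟩
  obtain ⟨S, C, r₂, hr₂, hloc⟩ :=
    SingularODE.exists_localEstimates hF2 hζ hF0 hζ0 h1' σ hχ h2' h4 h5
  set r := min R r₂ with hrdef
  have hr : 0 < r := lt_min hR hr₂
  have hsub : Metric.ball (0 : EuclideanSpace ℝ (Fin d)) r ⊆ Metric.ball 0 r₂ :=
    Metric.ball_subset_ball (min_le_right _ _)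
  have hloc' : SingularODE.LocalEstimates F ζ (fun x => x - χ x) S C r :=
    { hloc with
      zeta_le := fun x hx => hloc.zeta_le x (hsub hx)
      transport := fun x hx => hloc.transport x (hsub hx)
      lyapunov := fun x hx => hloc.lyapunov x (hsub hx)
      rate := fun x hx => hloc.rate x (hsub hx)
      slow := fun x hx => hloc.slow x (hsub hx) }
  obtain ⟨B, hB⟩ : ∃ B, ∀ x ∈ Metric.ball (0 : EuclideanSpace ℝ (Fin d)) r, ‖x - χ x‖ ≤ B := by
    have hc : Continuous fun x => x - χ x := continuous_id.sub hχ.contDiff.continuous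
    obtain ⟨B, hB⟩ := (isCompact_closedBall (0 : EuclideanSpace ℝ (Fin d)) r).exists_bound_of_continuousOn
      hc.continuousOn
    exact ⟨B, fun x hx => hB x (Metric.ball_subset_closedBall hx)⟩
  refine ⟨{x | x ∈ Metric.ball 0 r ∧ χ x = x}, r / 2, by positivity,
    fun x hx => Metric.ball_subset_ball (min_le_left _ _) hx.1, hχ.exists_isSubmanifold σ.cc r,
    ⟨_, le_of_eq ?_, hχ.isSubmanifoldAt_zero σ.cc hr⟩, ?_, ?_, ?_⟩
  · exact σ.range_c
  · intro U a ha hU hU0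
    have hnhds : Ioo (-a) a ∈ 𝓝 (0 : ℝ) := Ioo_mem_nhds (by linarith) ha
    have hcont : ContinuousAt U 0 := hU.continuousOn.continuousAt hnhds
    obtain ⟨ε, hε, hball⟩ := Metric.eventually_nhds_iff_ball.1
      ((hcont.eventually (Metric.isOpen_ball.mem_nhds hU0.1)).and hnhds)
    -- The time interval is shrunk so that the solution stays in the ball. Density of the regular
    -- times survives because the smaller interval is open.
    rw [Real.ball_zero_eq_Ioo] at hball
    have hUε : SingularODE.IsSolutionOn F ζ U (Ioo (-ε) ε) := by
      refine ⟨hU.continuousOn.mono fun t ht => (hball t ht).2, fun t ht => ?_, fun t ht hne => ?_⟩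
      · have h6 := hU.dense_regular (hball t ht).2
        rw [mem_closure_iff_nhds] at h6 ⊢
        intro s hs
        obtain ⟨x, hx1, hx2, hx3⟩ := h6 _ (inter_mem hs (isOpen_Ioo.mem_nhds ht))
        exact ⟨x, hx1.1, hx1.2, hx3⟩
      · exact (hU.hasDerivWithinAt t (hball t ht).2 hne).mono fun s hs => (hball s hs).2
    -- Regularity includes time 0: no solution passes through a singular point of the ball, so `1/ζ`
    -- stays bounded near time 0.
    have hreg := hloc'.regular_of_isSolutionOn ordConnected_Ioo hUε fun t ht => (hball t ht).1
    have hε0 : Ioo (-ε) ε ∈ 𝓝 (0 : ℝ) := Ioo_mem_nhds (by linarith) hε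
    have hc0 : ContinuousAt (fun t => |1 / ζ (U t)|) 0 := by
      have : ContinuousAt (fun t => ζ (U t)) 0 := hζ.continuous.continuousAt.comp hcont
      exact (continuousAt_const.div this (hreg 0 (mem_of_mem_nhds hε0))).abs
    refine hχ.eventually_defect_eq_zero (c := fun t => 1 / ζ (U t)) (B := |1 / ζ (U 0)| + 1)
      hloc'.transport ?_ ?_ hU0
    · filter_upwards [isOpen_Ioo.mem_nhds (mem_of_mem_nhds hε0)] with t ht
      exact hUε.hasDerivAt (isOpen_Ioo.mem_nhds ht) (hreg t ht)
    · exact (hc0.eventually_lt_const (lt_add_one _)).mono fun t ht => ht.le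
  · intro U hU hδ t
    have hball : ∀ t, U t ∈ Metric.ball 0 r := fun t => by
      rw [mem_ball_zero_iff]
      linarith [hδ t]
    exact ⟨hball t, (sub_eq_zero.1 (hloc'.defect_eq_zero_of_global hB hU hball t)).symm⟩
  · intro U I hI h0 hU hM hne
    exact hloc'.ne_zero_of_isSolutionOn hI hU (fun t ht => (hM t ht).1) h0 hne
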